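/- Let $K$ be an algebraically closed field. A normal surface singularity is $X=\operatorname{Spec}A$, where $A$ is a complete local noetherian normal domain of Krull dimension $2$ with maximal ideal $\mathfrak m$, and a $K$-algebra with $K\simeq A/\mathfrak m$. CM modules are maximal Cohen--Macaulay modules. A family of CM $A$-modules based on a smooth connected affine curve $C=\operatorname{Spec}R$ over $K$ is a coherent sheaf $\mathcal M$ on the product of $X$ and $C$, i.e. a finitely generated module over $A\,\widehat\otimes_K R=\varprojlim_n (A/\mathfrak m^n\otimes_K R)$, which is flat over $R$ and such that for every closed point $c\in C$ the restriction $\mathcal M(c)$ to $X\times c\simeq X$ is a CM $A$-module. The family has rank $r$ if all $\mathcal M(c)$ have rank $r$. $X$ is CM finite if there are only finitely many indecomposable CM $A$-modules up to isomorphism. A parametrizing set for $X$ is a set $\mathfrak M$ of families of CM $A$-modules such that, for every $r\ge 0$, the subset $\mathfrak M_r$ of families of rank $r$ is finite and all indecomposable CM $A$-modules of rank $r$, except finitely many isomorphism classes, are isomorphic to some $\mathcal M(c)$ with $\mathcal M\in\mathfrak M_r$ and $c$ a closed point of its base. $X$ is CM tame if it is not CM finite and has a parametrizing set; then $d(r,X)$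 denotes the minimum of $\#\mathfrak M_r$ over all parametrizing sets $\mathfrak M$. A CM tame $X$ is bounded if there is a polynomial $\varphi$ with $d(r,X)\le\varphi(r)$ for all $r$. Let $X=\operatorname{Spec}A$ and $Y=\operatorname{Spec}B$ be normal surface singularities over $K$, and let $X\to Y$ be a finite surjective $K$-morphism given by an extension $B\to A$. It is called split if $B\to A$ splits as a monomorphism of $B$-modules, and unramified in codimension $1$ if $A_P/PA_P$ is a separable algebra over $B_P/PB_P$ for every prime ideal $P\subset B$ of height $1$. 1. If $X\to Y$ is split and $X$ is CM tame, then $Y$ is CM tame or CM finite; if moreover $X$ is bounded, then $Y$ is bounded or CM finite. 2. If $X\to Y$ is unramified in codimension $1$ and $Y$ is CM tame, then $X$ is CM tame or CM finite; if moreover $Y$ is bounded, then $X$ is bounded or CM finite. 3. If $X\to Y$ is both split and unramified in codimension $1$, then $X$ is CM tame if and only if $Y$ is, and $X$ is bounded if and only if $Y$ is. -/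

import Mathlib

open scoped TensorProduct

universe u

namespace SurfaceCM

/-- `Spec A` is a normal surface singularity over `K`: `A` is a complete local noetherian normal
domain of Krull dimension `2`, and a `K`-algebra whose residue field is `K` itself. -/
structure IsNormalSurfaceSingularity (K A : Type u) [Field K] [CommRing A] [IsLocalRing A]
    [Algebra K A] : Prop where
  isNoetherianRing : IsNoetherianRing A
  isAdicComplete : IsAdicComplete (IsLocalRing.maximalIdeal A) A
  isDomain : IsDomain A
  isIntegrallyClosed : IsIntegrallyClosed A
  ringKrullDim_eq : ringKrullDim A = 2
  residue_bijective : Function.Bijective (algebraMap K (IsLocalRing.ResidueField A))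

/-! ### Cohen-Macaulay modules -/

section Modules

variable (A : Type u) [CommRing A] [IsLocalRing A]

/-- (Maximal) Cohen-Macaulay modules over a local ring: finitely generated modules of depth at
least `dim A`, that is, having a regular sequence of length `dim A` in the maximal ideal. As usual
the zero module is admitted; for a nonzero finitely generated module a weakly regular sequence
contained in the maximal ideal is regular. -/
def IsCohenMacaulay (M : Type u) [AddCommGroup M] [Module A M] : Prop :=
  Module.Finite A M ∧
    ∃ rs : List A, (∀ x ∈ rs, x ∈ IsLocalRing.maximalIdeal A) ∧
      (rs.length : WithBot ℕ∞) = ringKrullDim A ∧ RingTheory.Sequence.IsWeaklyRegular M rs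

/-- A module is indecomposable if it is nonzero and not a direct sum of two nonzero submodules. -/
def IsIndecomposable (M : Type u) [AddCommGroup M] [Module A M] : Prop :=
  Nontrivial M ∧ ∀ P Q : Submodule A M, IsCompl P Q → P = ⊥ ∨ Q = ⊥

/-- Indecomposable Cohen-Macaulay modules. -/
def IsIndecomposableCM (M : ModuleCat.{u} A) : Prop :=
  IsCohenMacaulay A M ∧ IsIndecomposable A M

variable {A} in
/-- The modules with property `P` form only finitely many isomorphism classes. -/
def FinitelyManyIsoClasses (P : ModuleCat.{u} A → Prop) : Prop :=
  ∃ S : Set (ModuleCat.{u} A), S.Finite ∧ ∀ N, P N → ∃ M ∈ S, Nonempty (N ≃ₗ[A] M)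

/-- `Spec A` is Cohen-Macaulay finite. -/
def IsCMFinite : Prop :=
  FinitelyManyIsoClasses (IsIndecomposableCM A)

end Modules

/-! ### Families of Cohen-Macaulay modules -/

section Families

variable (K A : Type u) [Field K] [CommRing A] [IsLocalRing A] [Algebra K A]

/-- The ideal of `A ⊗ R` generated by the maximal ideal of `A`. -/
abbrev extendedMaximalIdeal (R : Type u) [CommRing R] [Algebra K R] : Ideal (A ⊗[K] R) :=
  (IsLocalRing.maximalIdeal A).map (algebraMap A (A ⊗[K] R))

/-- The ring of functions on the product of `Spec A` and `Spec R`, where `A` is a complete local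
ring: the completed tensor product `lim (A / 𝔪ⁿ ⊗ R)`. -/
abbrev ProductRing (R : Type u) [CommRing R] [Algebra K R] : Type u :=
  AdicCompletion (extendedMaximalIdeal K A R) (A ⊗[K] R)

/-- The projection of the product to `Spec A`. -/
noncomputable def leftMap (R : Type u) [CommRing R] [Algebra K R] : A →+* ProductRing K A R :=
  (algebraMap (A ⊗[K] R) (ProductRing K A R)).comp
    (Algebra.TensorProduct.includeLeft : A →ₐ[K] A ⊗[K] R).toRingHom

/-- The projection of the product to `Spec R`. -/
noncomputable def rightMap (R : Type u) [CommRing R] [Algebra K R] : R →+* ProductRing K A R :=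
  (algebraMap (A ⊗[K] R) (ProductRing K A R)).comp
    (Algebra.TensorProduct.includeRight : R →ₐ[K] A ⊗[K] R).toRingHom

/-- The restriction `M(c) = M / 𝔫_c M` of a module on the product to the fibre over the closed
point `c` of `Spec R`, regarded as an `A`-module. -/
noncomputable def fiberModule {R : Type u} [CommRing R] [Algebra K R]
    (M : ModuleCat.{u} (ProductRing K A R)) (c : MaximalSpectrum R) : ModuleCat.{u} A :=
  (ModuleCat.restrictScalars (leftMap K A R)).obj
    (ModuleCat.of (ProductRing K A R)
      (M ⧸ (c.asIdeal.map (rightMap K A R) • (⊤ : Submodule (ProductRing K A R) M))))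

/-- A family of Cohen-Macaulay `A`-modules based on a smooth connected (affine) curve `Spec R`:
a coherent module on the product of `Spec A` and the curve, flat over the curve, all of whose
fibres over closed points are Cohen-Macaulay. -/
structure CMFamily where
  /-- the coordinate ring of the base curve -/
  R : Type u
  [commRing : CommRing R]
  [algebra : Algebra K R]
  smooth : Algebra.Smooth K R
  isDomain : IsDomain R
  ringKrullDim_eq : ringKrullDim R = 1
  /-- the module on the product -/
  M : ModuleCat.{u} (ProductRing K A R)
  finite : Module.Finite (ProductRing K A R) M
  flat : Module.Flat R ((ModuleCat.restrictScalars (rightMap K A R)).obj M)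
  isCohenMacaulay : ∀ c : MaximalSpectrum R, IsCohenMacaulay A (fiberModule K A M c)

attribute [instance] CMFamily.commRing CMFamily.algebra

variable {K A}

/-- The member `M(c)` of the family. -/
noncomputable abbrev CMFamily.fiber (F : CMFamily K A) (c : MaximalSpectrum F.R) :
    ModuleCat.{u} A :=
  fiberModule K A F.M c

/-- The family has rank `r` (all its members have the same rank, as the base is connected). -/
def CMFamily.HasRank (F : CMFamily K A) (r : ℕ) : Prop :=
  ∀ c : MaximalSpectrum F.R, Module.finrank A (F.fiber c) = r

/-- The families of rank `r` from a set of families. -/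
def ofRank (D : Set (CMFamily K A)) (r : ℕ) : Set (CMFamily K A) :=
  {F ∈ D | F.HasRank r}

/-- Parametrizing sets of families: for every `r` there are only finitely many families of
rank `r`, and almost all indecomposable Cohen-Macaulay modules of rank `r` are members of them. -/
def IsParametrizingSet (D : Set (CMFamily K A)) : Prop :=
  ∀ r : ℕ, (ofRank D r).Finite ∧
    FinitelyManyIsoClasses fun N : ModuleCat.{u} A =>
      IsIndecomposableCM A N ∧ Module.finrank A N = r ∧
        ¬ ∃ F ∈ ofRank D r, ∃ c : MaximalSpectrum F.R, Nonempty (N ≃ₗ[A] F.fiber c)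

variable (K A)

/-- `Spec A` is Cohen-Macaulay tame. -/
def IsCMTame : Prop :=
  ¬ IsCMFinite A ∧ ∃ D : Set (CMFamily K A), IsParametrizingSet D

/-- `d(r, Spec A)`: the minimal number of families of rank `r` in a parametrizing set. -/
noncomputable def familyNumber (r : ℕ) : ℕ :=
  sInf {d | ∃ D : Set (CMFamily K A), IsParametrizingSet D ∧ (ofRank D r).ncard = d}

/-- `Spec A` is Cohen-Macaulay tame and bounded (of polynomial growth). -/
def IsCMBounded : Prop :=
  IsCMTame K A ∧ ∃ φ : Polynomial ℝ, ∀ r : ℕ, (familyNumber K A r : ℝ) ≤ φ.eval (r : ℝ)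

end Families

/-! ### Properties of extensions -/

section Extensions

variable (B A : Type u) [CommRing B] [CommRing A] [Algebra B A]

/-- The extension splits: `B → A` has a `B`-linear retraction. -/
def IsSplitExtension : Prop :=
  ∃ f : A →ₗ[B] B, f ∘ₗ Algebra.linearMap B A = LinearMap.id

/-- The (finite) extension is unramified in codimension `1`: for every prime `P` of height `1`
the finite algebra `A_P / P A_P` over the residue field of `P` is separable. For finite
commutative algebras over a field, separable is the same as formally unramified. -/
def IsUnramifiedInCodimOne : Prop :=
  ∀ (P : Ideal B) [P.IsPrime], P.height = 1 → Algebra.FormallyUnramified P.ResidueField (P.Fiber A)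

end Extensions

end SurfaceCM

namespace SurfaceCM

/-! Noether normalization makes `B`, hence also `A`, finite over S = K[[x,y]]. A module is then
Cohen-Macaulay (CM) exactly when it is finite free over S, so CM modules are representations by
matrices over S. Their endomorphism rings are finite over the complete local ring S, whose residue
field is algebraically closed; idempotents lift, and Krull-Schmidt holds.

Both directions of the theorem are instances of one mechanism, `IsTransfer`. It is an operation Φ
from P-modules to Q-modules that preserves CM modules, carries families to families up to finitely
many members, and is dense: every indecomposable CM Q-module N is a summand of Φ(M) for some
indecomposable CM module M with rank M ≤ C · rank N. For a split extension Φ is restriction to `B`;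
N is a summand of Hom_B(A, N), and Krull-Schmidt selects M among the indecomposable summands of the
latter. For an extension unramified in codimension one Φ is the coinduction N ↦ Hom_B(A, N). Here
the Noether different of `A` over `B` contains a power of the maximal ideal of `B`, hence powers of
x and y. These form a regular pair on every CM module M, which is enough to split M → Hom_B(A, M).

The main work is `exists_families`: the indecomposable summands of Φ(M), for M in one family of rank
r, belong to at most C'r families, up to finitely many isomorphism classes. After a covering of the
base curve Spec R a family is generically given by matrices over R[[x,y]] (`exists_matrixFamily`).
Its endomorphism ring modulo (x,y) is finite over R. Primitive idempotents exist over the algebraic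
closure of the function field, are defined over a covering (`exists_spread`), lift (x,y)-adically,
and stay primitive at almost all points, because endomorphisms of almost all members extend to the
family (`exists_forall_specialize_kernel`). Their images are again generically families
(`exists_summand`, `exists_cmFamily`), and there are at most d nonzero orthogonal idempotents among
d × d matrices.

Collecting these families over all ranks s ≤ Cr gives a parametrizing set for Q with at most Σ C's ·
d(s, P) members of rank r, a polynomial bound if d(s, P) has one. If both transfers are available,
CM finiteness passes both ways, which removes the alternative "CM finite" in the third statement. -/

/-- Power series in two variables. -/
abbrev Ser (R : Type*) [CommRing R] : Type _ := MvPowerSeries (Fin 2) R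

/-! ### Power series in two variables: divisibility, flatness, change of coefficients. -/

namespace Ser

section Basic

variable (R : Type*) [CommRing R]

/-- The ideal generated by the two variables. -/
noncomputable abbrev vars : Ideal (Ser R) := Ideal.span (Set.range MvPowerSeries.X)

variable {R}

/-- The first variable. -/
noncomputable abbrev x : Ser R := MvPowerSeries.X 0

/-- The second variable. -/
noncomputable abbrev y : Ser R := MvPowerSeries.X 1

theorem vars_eq : vars R = Ideal.span {x, y} := by
  rw [vars]; congr 1; ext f; simp [Fin.exists_fin_two, eq_comm]

theorem mem_vars_iff_exists {f : Ser R} : f ∈ vars R ↔ ∃ u v, f = x * u + y * v := by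
  rw [vars_eq, Ideal.mem_span_pair]
  constructor
  · rintro ⟨a, b, h⟩; exact ⟨a, b, by rw [← h]; ring⟩
  · rintro ⟨a, b, h⟩; exact ⟨a, b, by rw [h]; ring⟩

theorem X_mem_vars (i : Fin 2) : (MvPowerSeries.X i : Ser R) ∈ vars R :=
  Ideal.subset_span ⟨i, rfl⟩

theorem coeff_X_mul_add (i : Fin 2) (f : Ser R) (e : Fin 2 →₀ ℕ) :
    MvPowerSeries.coeff (Finsupp.single i 1 + e) (MvPowerSeries.X i * f) =
      MvPowerSeries.coeff e f := by
  rw [MvPowerSeries.X_def, MvPowerSeries.coeff_add_monomial_mul, one_mul]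

theorem coeff_X_mul_of_eq_zero (i : Fin 2) (f : Ser R) (e : Fin 2 →₀ ℕ) (he : e i = 0) :
    MvPowerSeries.coeff e (MvPowerSeries.X i * f) = 0 := by
  classical
  rw [MvPowerSeries.X_def, MvPowerSeries.coeff_monomial_mul, if_neg]
  intro h
  have := h i
  simp [he] at this

/-- The power series with given coefficients. -/
def mk (a : (Fin 2 →₀ ℕ) → R) : Ser R := a

theorem coeff_mk (a : (Fin 2 →₀ ℕ) → R) (e : Fin 2 →₀ ℕ) :
    MvPowerSeries.coeff e (mk a) = a e := rfl

theorem exists_eq_single_add {e : Fin 2 →₀ ℕ} {i : Fin 2} (h : ¬ e i = 0) :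
    ∃ e', e = Finsupp.single i 1 + e' :=
  ⟨e - Finsupp.single i 1, (add_tsub_cancel_of_le (by
    rw [Finsupp.single_le_iff]; exact Nat.one_le_iff_ne_zero.2 h)).symm⟩

/-- Division by a variable. -/
noncomputable def shift (i : Fin 2) (f : Ser R) : Ser R :=
  mk fun e => MvPowerSeries.coeff (Finsupp.single i 1 + e) f

theorem coeff_shift (i : Fin 2) (f : Ser R) (e : Fin 2 →₀ ℕ) :
    MvPowerSeries.coeff e (shift i f) = MvPowerSeries.coeff (Finsupp.single i 1 + e) f := rfl

theorem mem_vars_iff {f : Ser R} : f ∈ vars R ↔ MvPowerSeries.constantCoeff f = 0 := by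
  constructor
  · rw [mem_vars_iff_exists]
    rintro ⟨u, v, rfl⟩
    simp
  · intro h
    rw [mem_vars_iff_exists]
    -- The product `x * shift 0 f` collects all monomials divisible by x. The rest is a series in y
    -- without constant term, hence divisible by y.
    refine ⟨shift 0 f, shift 1 (f - x * shift 0 f), ?_⟩
    ext e
    rw [map_add]
    by_cases h0 : e 0 = 0
    · rw [coeff_X_mul_of_eq_zero 0 _ e h0, zero_add]
      by_cases h1 : e 1 = 0
      · rw [coeff_X_mul_of_eq_zero 1 _ e h1]
        have : e = 0 := by ext i; fin_cases i <;> simpa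
        rw [this]; simpa using h
      · obtain ⟨e', rfl⟩ : ∃ e', e = Finsupp.single 1 1 + e' :=
          exists_eq_single_add h1
        rw [coeff_X_mul_add, coeff_shift, map_sub, coeff_X_mul_of_eq_zero 0 _ _ h0, sub_zero]
    · obtain ⟨e', rfl⟩ : ∃ e', e = Finsupp.single 0 1 + e' :=
        exists_eq_single_add h0
      rw [coeff_X_mul_add, coeff_shift]
      by_cases h1 : (Finsupp.single 0 1 + e' : Fin 2 →₀ ℕ) 1 = 0
      · rw [coeff_X_mul_of_eq_zero 1 _ _ h1, add_zero]
      · have h1' : e' 1 ≠ 0 := by simpa using h1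
        obtain ⟨e'', rfl⟩ : ∃ e'', e' = Finsupp.single 1 1 + e'' :=
          exists_eq_single_add h1'
        rw [add_left_comm, coeff_X_mul_add, coeff_shift, map_sub, add_left_comm, coeff_X_mul_add,
          coeff_shift, sub_self, add_zero]

theorem C_constantCoeff_sub_mem (f : Ser R) :
    f - MvPowerSeries.C (MvPowerSeries.constantCoeff f) ∈ vars R := by
  rw [mem_vars_iff]; simp

/-- This is the regularity of the sequence x, y: a coefficient of u at an exponent free of x is a
coefficient of yu = xv at an exponent free of x, hence zero. -/
theorem x_dvd_of_y_mul_eq {u v : Ser R} (h : y * u = x * v) : ∃ w, u = x * w := by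
  refine ⟨shift 0 u, ?_⟩
  ext e
  by_cases h0 : e 0 = 0
  · rw [coeff_X_mul_of_eq_zero 0 _ e h0, ← coeff_X_mul_add 1, h,
      coeff_X_mul_of_eq_zero 0 _ _ (by simpa using h0)]
  · obtain ⟨e', rfl⟩ : ∃ e', e = Finsupp.single 0 1 + e' :=
        exists_eq_single_add h0
    rw [coeff_X_mul_add, coeff_shift]

theorem X_mul_cancel {i : Fin 2} {u v : Ser R}
    (h : MvPowerSeries.X i * u = MvPowerSeries.X i * v) : u = v := by
  ext e
  rw [← coeff_X_mul_add i, h, coeff_X_mul_add]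

/-- Power series are an adic completion of the polynomial ring, flat over it in the noetherian case,
and polynomials are free over R. -/
instance flat [IsNoetherianRing R] : Module.Flat R (Ser R) := by
  have h1 : Module.Flat (MvPolynomial (Fin 2) R) (AdicCompletion (MvPolynomial.idealOfVars (Fin 2) R)
    (MvPolynomial (Fin 2) R)) := inferInstance
  have h2 : Module.Flat (MvPolynomial (Fin 2) R) (Ser R) :=
    Module.Flat.of_linearEquiv (MvPowerSeries.toAdicCompletionAlgEquiv (Fin 2) R).toLinearEquiv
  exact Module.Flat.trans R (MvPolynomial (Fin 2) R) (Ser R)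

end Basic

section Map

variable {R R' : Type*} [CommRing R] [CommRing R']

theorem map_surjective {c : R →+* R'} (hc : Function.Surjective c) :
    Function.Surjective (MvPowerSeries.map c : Ser R →+* Ser R') := by
  intro f
  choose g hg using hc
  refine ⟨mk fun e => g (MvPowerSeries.coeff e f), ?_⟩
  ext e
  rw [MvPowerSeries.coeff_map, coeff_mk]
  exact hg _

/-- Finite generation lets all the infinitely many coefficients be written with the same finitely
many elements of the kernel. -/
theorem exists_sum_of_map_eq_zero {c : R →+* R'} (h : (RingHom.ker c).FG) :
    ∃ (n : ℕ) (p : Fin n → R), (∀ i, c (p i) = 0) ∧ ∀ f : Ser R, MvPowerSeries.map c f = 0 →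
      ∃ g : Fin n → Ser R, f = ∑ i, p i • g i := by
  obtain ⟨n, p, hp⟩ := Submodule.fg_iff_exists_fin_generating_family.1 h
  refine ⟨n, p, fun i => ?_, fun f hf => ?_⟩
  · have : p i ∈ RingHom.ker c := by rw [← hp]; exact Submodule.subset_span ⟨i, rfl⟩
    exact this
  · have : ∀ e, ∃ g : Fin n → R, ∑ i, g i • p i = MvPowerSeries.coeff e f := by
      intro e
      rw [← Submodule.mem_span_range_iff_exists_fun R, hp]
      change c _ = 0
      rw [← MvPowerSeries.coeff_map, hf, map_zero]
    choose g hg using this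
    refine ⟨fun i => mk fun e => g e i, ?_⟩
    ext e
    rw [← hg e, map_sum]
    refine Finset.sum_congr rfl fun i _ => ?_
    rw [MvPowerSeries.coeff_smul, coeff_mk, smul_eq_mul, mul_comm]

theorem map_mem_vars {c : R →+* R'} {f : Ser R} (hf : f ∈ vars R) :
    MvPowerSeries.map c f ∈ vars R' := by
  rw [mem_vars_iff] at hf ⊢
  simp [hf]

end Map

section Field

variable (K : Type*) [Field K]

theorem vars_eq_maximalIdeal : vars K = IsLocalRing.maximalIdeal (Ser K) := by
  ext f
  rw [mem_vars_iff, IsLocalRing.mem_maximalIdeal, mem_nonunits_iff,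
    MvPowerSeries.isUnit_iff_constantCoeff, isUnit_iff_ne_zero, not_not]

instance : (vars K).IsMaximal := by rw [vars_eq_maximalIdeal]; infer_instance

end Field

end Ser
end SurfaceCM

namespace SurfaceCM

open Ser

/-! ### Regular pairs -/

/-- `a, b` is a weakly regular sequence on `M`. -/
def IsRegularPair {A : Type*} (M : Type*) [CommRing A] [AddCommGroup M] [Module A M] (a b : A) :
    Prop :=
  (∀ u : M, a • u = 0 → u = 0) ∧ ∀ u v : M, b • u = a • v → ∃ w, u = a • w

section RegularPair

variable {A M : Type*} [CommRing A] [AddCommGroup M] [Module A M] {a b : A}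

open Pointwise in
theorem isWeaklyRegular_pair_iff :
    RingTheory.Sequence.IsWeaklyRegular M [a, b] ↔ IsRegularPair M a b := by
  rw [RingTheory.Sequence.isWeaklyRegular_cons_iff,
    RingTheory.Sequence.isWeaklyRegular_singleton_iff, isSMulRegular_iff_right_eq_zero_of_smul,
    isSMulRegular_iff_right_eq_zero_of_smul]
  refine and_congr Iff.rfl ⟨fun h u v huv => ?_, fun h u hu => ?_⟩
  · have h1 := h (Submodule.Quotient.mk u) (by
      rw [← Submodule.Quotient.mk_smul, Submodule.Quotient.mk_eq_zero,
        Submodule.mem_smul_pointwise_iff_exists]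
      exact ⟨v, trivial, huv.symm⟩)
    rw [Submodule.Quotient.mk_eq_zero, Submodule.mem_smul_pointwise_iff_exists] at h1
    obtain ⟨w, -, hw⟩ := h1
    exact ⟨w, hw.symm⟩
  · obtain ⟨u, rfl⟩ := Submodule.Quotient.mk_surjective _ u
    rw [← Submodule.Quotient.mk_smul, Submodule.Quotient.mk_eq_zero,
        Submodule.mem_smul_pointwise_iff_exists] at hu
    obtain ⟨v, -, hv⟩ := hu
    obtain ⟨w, hw⟩ := h u v hv.symm
    rw [Submodule.Quotient.mk_eq_zero, Submodule.mem_smul_pointwise_iff_exists]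
    exact ⟨w, trivial, hw.symm⟩

theorem IsRegularPair.eq_of_smul_eq (h : IsRegularPair M a b) {u v : M} (huv : a • u = a • v) :
    u = v := by
  rw [← sub_eq_zero]
  exact h.1 _ (by rw [smul_sub, huv, sub_self])

theorem IsRegularPair.pow_right (h : IsRegularPair M a b) (k : ℕ) : IsRegularPair M a (b ^ k) := by
  refine ⟨h.1, ?_⟩
  induction k with
  | zero => intro u v huv; exact ⟨v, by simpa using huv⟩
  | succ k ih =>
    intro u v huv
    rw [pow_succ', mul_smul] at huv
    obtain ⟨w, hw⟩ := h.2 _ _ huv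
    exact ih _ _ hw

theorem IsRegularPair.pow_left (h : IsRegularPair M a b) (j : ℕ) : IsRegularPair M (a ^ j) b := by
  induction j with
  | zero => exact ⟨fun u hu => by simpa using hu, fun u v _ => ⟨u, by simp⟩⟩
  | succ j ih =>
    refine ⟨fun u hu => ?_, fun u v huv => ?_⟩
    · rw [pow_succ', mul_smul] at hu
      exact ih.1 _ (h.1 _ hu)
    · rw [pow_succ', mul_smul] at huv
      obtain ⟨w, rfl⟩ := h.2 _ _ huv
      rw [smul_comm] at huv
      obtain ⟨w', rfl⟩ := ih.2 _ _ (h.eq_of_smul_eq huv)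
      exact ⟨w', by rw [pow_succ', mul_smul]⟩

theorem IsRegularPair.pow (h : IsRegularPair M a b) (j k : ℕ) :
    IsRegularPair M (a ^ j) (b ^ k) := (h.pow_left j).pow_right k

theorem IsRegularPair.algebraMap_iff {S : Type*} [CommRing S] [Algebra S A] [Module S M]
    [IsScalarTower S A M] {s t : S} :
    IsRegularPair M (algebraMap S A s) (algebraMap S A t) ↔ IsRegularPair M s t := by
  simp only [IsRegularPair, algebraMap_smul]

end RegularPair

/-! ### Two-dimensional local domains -/

section TwoDim

variable {A : Type*} [CommRing A] [IsLocalRing A] [IsDomain A]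

/-- Otherwise 0 < p < q < 𝔪 would be a chain of length three. -/
theorem eq_maximalIdeal_of_lt (hdim : ringKrullDim A = 2) {p q : Ideal A} [p.IsPrime] [q.IsPrime]
    (hp : p ≠ ⊥) (hpq : p < q) : q = IsLocalRing.maximalIdeal A := by
  by_contra hq
  have h0 := Ideal.height_add_one_le_of_lt_of_isPrime (bot_lt_iff_ne_bot.2 hp)
  have h1 := Ideal.height_add_one_le_of_lt_of_isPrime hpq
  have h2 := Ideal.height_add_one_le_of_lt_of_isPrime
    (lt_of_le_of_ne (IsLocalRing.le_maximalIdeal (Ideal.IsPrime.ne_top ‹q.IsPrime›)) hq)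
  have h3 : (IsLocalRing.maximalIdeal A).height = 2 := by
    have := IsLocalRing.maximalIdeal_height_eq_ringKrullDim (R := A)
    rw [hdim] at this
    exact WithBot.coe_injective (by rw [this]; rfl)
  rw [h3] at h2
  have h4 : (1 : ℕ∞) ≤ p.height := le_trans (by simp) h0
  have h5 : (2 : ℕ∞) ≤ q.height := le_trans (by
    rw [show (2 : ℕ∞) = 1 + 1 by norm_num]; gcongr) h1
  have h6 : (3 : ℕ∞) ≤ 2 := le_trans (by
    rw [show (3 : ℕ∞) = 2 + 1 by norm_num]; gcongr) h2
  exact absurd h6 (by decide)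

/-- CM modules are torsion-free. A nonzero associated prime p avoids a, so the only prime over p +
(a) is the maximal ideal, and some power b^k lies in p + (a). Nakayama provides an element of M
killed by p and not in aM; it contradicts the regularity of a, b^k. -/
theorem smul_eq_zero_of_isRegularPair [IsNoetherianRing A] (hdim : ringKrullDim A = 2)
    {M : Type*} [AddCommGroup M] [Module A M] [Module.Finite A M] {a b : A}
    (ha : a ∈ IsLocalRing.maximalIdeal A) (hb : b ∈ IsLocalRing.maximalIdeal A)
    (h : IsRegularPair M a b) {t : A} (ht : t ≠ 0) {u : M} (htu : t • u = 0) : u = 0 := by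
  by_contra hu
  obtain ⟨p, hp, hup⟩ := exists_le_isAssociatedPrime_of_isNoetherianRing A u hu
  rw [isAssociatedPrime_iff] at hp
  obtain ⟨hprime, z, hz⟩ := hp
  have hmem : ∀ r, r ∈ p ↔ r • z = 0 := fun r => by rw [hz]; simp [Submodule.mem_colon_singleton]
  have hz0 : z ≠ 0 := by
    rintro rfl
    exact hprime.ne_top ((Ideal.eq_top_iff_one _).2 ((hmem 1).2 (by simp)))
  have hp0 : p ≠ ⊥ := fun h0 => ht (by
    have : t ∈ p := hup (by simp [Submodule.mem_colon_singleton, htu])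
    simpa [h0] using this)
  have hap : a ∉ p := fun h1 => hz0 (h.1 _ ((hmem a).1 h1))
  let N : Submodule A M :=
    { carrier := {w | ∀ r ∈ p, r • w = 0}
      add_mem' := fun h1 h2 r hr => by rw [smul_add, h1 r hr, h2 r hr, add_zero]
      zero_mem' := fun r _ => smul_zero r
      smul_mem' := fun c w hw r hr => by rw [smul_comm, hw r hr, smul_zero] }
  have hN : N ≠ ⊥ := fun h1 => hz0 (by
    have : z ∈ N := fun r hr => (hmem r).1 hr
    rwa [h1, Submodule.mem_bot] at this)
  obtain ⟨v, hvN, hv⟩ : ∃ v ∈ N, ∀ w : M, v ≠ a • w := by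
    by_contra! hcon
    refine hN (Submodule.eq_bot_of_le_smul_of_le_jacobson_bot (Ideal.span {a}) N
      (IsNoetherian.noetherian N) ?_ ?_)
    · intro v hv
      obtain ⟨w, rfl⟩ := hcon v hv
      refine Submodule.smul_mem_smul (Ideal.mem_span_singleton_self a) ?_
      intro r hr
      exact h.1 _ (by rw [smul_comm]; exact hv r hr)
    · rw [Ideal.span_singleton_le_iff_mem, IsLocalRing.jacobson_eq_maximalIdeal _ bot_ne_top]
      exact ha
  obtain ⟨k, hk⟩ : ∃ k, b ^ k ∈ p ⊔ Ideal.span {a} := by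
    have : b ∈ (p ⊔ Ideal.span {a}).radical := by
      rw [Ideal.radical_eq_sInf, Ideal.mem_sInf]
      rintro q ⟨hq1, hq2⟩
      have : p < q := lt_of_le_of_ne (le_sup_left.trans hq1) (by
        rintro rfl
        exact hap (hq1 (Ideal.mem_sup_right (Ideal.mem_span_singleton_self a))))
      rw [eq_maximalIdeal_of_lt hdim hp0 this]
      exact hb
    exact this
  obtain ⟨c, hc, d, hd, hcd⟩ := Submodule.mem_sup.1 hk
  obtain ⟨e, rfl⟩ := Ideal.mem_span_singleton'.1 hd
  obtain ⟨w, hw⟩ := (h.pow_right k).2 v (e • v) (by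
    rw [← hcd, add_smul, hvN c hc, zero_add, mul_comm, mul_smul])
  exact hv w hw

/-- The second condition for a regular pair passes to any pair generating a primary ideal. -/
theorem IsRegularPair.exchange [IsNoetherianRing A] (hdim : ringKrullDim A = 2)
    {M : Type*} [AddCommGroup M] [Module A M] [Module.Finite A M] {a b s t : A}
    (ha : a ∈ IsLocalRing.maximalIdeal A) (hb : b ∈ IsLocalRing.maximalIdeal A)
    (h : IsRegularPair M a b) (hs : s ≠ 0) {k : ℕ}
    (hst : IsLocalRing.maximalIdeal A ^ k ≤ Ideal.span {s, t}) : IsRegularPair M s t := by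
  have htf : ∀ u : M, s • u = 0 → u = 0 := fun u hu =>
    smul_eq_zero_of_isRegularPair hdim ha hb h hs hu
  refine ⟨htf, fun u v huv => ?_⟩
  -- The relation t u = s v shows that (s, t) carries u into sM, and so does 𝔪^k. Using this for a^k
  -- and b^k and cancelling s gives b^k w = a^k w'; regularity of a^k, b^k then divides w by a^k.
  have hm : ∀ z ∈ IsLocalRing.maximalIdeal A ^ k, ∃ w, z • u = s • w := by
    intro z hz
    obtain ⟨c, d, rfl⟩ := Ideal.mem_span_pair.1 (hst hz)
    exact ⟨c • u + d • v, by
      rw [add_smul, mul_smul, mul_smul, huv, smul_add, smul_comm c, smul_comm d]⟩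
  obtain ⟨w, hw⟩ := hm (a ^ k) (Ideal.pow_mem_pow ha k)
  obtain ⟨w', hw'⟩ := hm (b ^ k) (Ideal.pow_mem_pow hb k)
  have key : b ^ k • w = a ^ k • w' := by
    rw [← sub_eq_zero]
    apply htf
    rw [smul_sub, smul_comm s, ← hw, smul_comm s, ← hw', smul_comm, sub_self]
  obtain ⟨w'', rfl⟩ := (h.pow k k).2 _ _ key
  refine ⟨w'', (h.pow_left k).eq_of_smul_eq ?_⟩
  rw [hw, smul_comm]

end TwoDim

/-! ### Surfaces finite over the ring of power series -/

/-- A normal surface singularity presented as a finite extension of the ring of power series in two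
variables. -/
structure IsFiniteOverSer (K A : Type u) [Field K] [CommRing A] [IsLocalRing A] [Algebra K A]
    [Algebra (Ser K) A] : Prop where
  sing : IsNormalSurfaceSingularity K A
  tower : IsScalarTower K (Ser K) A
  finite : Module.Finite (Ser K) A
  x_ne_zero : algebraMap (Ser K) A x ≠ 0

section Free

variable {K : Type u} [Field K]

instance : Module.Free (Ser K) (Ser K) := inferInstance

theorem isRegularPair_of_free (M : Type*) [AddCommGroup M] [Module (Ser K) M]
    [Module.Free (Ser K) M] : IsRegularPair M (x : Ser K) (y : Ser K) := by
  let b := Module.Free.chooseBasis (Ser K) M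
  refine ⟨fun u hu => ?_, fun u v huv => ?_⟩
  · apply b.ext_elem
    intro i
    apply X_mul_cancel (i := 0)
    have := congrArg (fun w => b.repr w i) hu
    simpa using this
  · have : ∀ i, ∃ w, b.repr u i = x * w := fun i =>
      x_dvd_of_y_mul_eq (v := b.repr v i) (by simpa using congrArg (fun w => b.repr w i) huv)
    choose w hw using this
    have hfin : (Function.support w).Finite := by
      refine (b.repr u).hasFiniteSupport.subset fun i hi h0 => hi ?_
      apply X_mul_cancel (i := 0)
      rw [← hw, h0, mul_zero]
    refine ⟨b.repr.symm (Finsupp.ofSupportFinite w hfin), b.ext_elem fun i => ?_⟩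
    rw [hw, map_smul, LinearEquiv.apply_symm_apply]
    rfl

-- Freeness can be tested modulo a regular element of the Jacobson radical. Doing so for x and then
-- for y reduces to a module over the field K[[x,y]]/(x,y).
open Pointwise in
theorem free_of_isRegularPair (M : Type*) [AddCommGroup M] [Module (Ser K) M]
    [Module.Finite (Ser K) M] (h : IsRegularPair M (x : Ser K) (y : Ser K)) :
    Module.Free (Ser K) M := by
  rw [← isWeaklyRegular_pair_iff, RingTheory.Sequence.isWeaklyRegular_cons_iff,
    RingTheory.Sequence.isWeaklyRegular_singleton_iff] at h
  have hjac : ∀ i : Fin 2, (MvPowerSeries.X i : Ser K) ∈ (⊥ : Ideal (Ser K)).jacobson := by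
    intro i
    rw [IsLocalRing.jacobson_eq_maximalIdeal _ bot_ne_top, ← vars_eq_maximalIdeal]
    exact X_mem_vars i
  have : Module.FinitePresentation (Ser K) M := Module.finitePresentation_of_finite _ _
  rw [← Module.free_quotSMulTop_iff_free (Ser K) M (hjac 0) h.1]
  let S' := Ser K ⧸ Ideal.span {(x : Ser K)}
  let M' := QuotSMulTop (x : Ser K) M
  have hfin : Module.Finite S' M' := Module.Finite.of_restrictScalars_finite (Ser K) S' M'
  have : Module.FinitePresentation S' M' := Module.finitePresentation_of_finite _ _
  have hj : (algebraMap (Ser K) S' y) ∈ (⊥ : Ideal S').jacobson := by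
    have h1 := Ideal.map_jacobson_of_surjective (I := Ideal.span {(x : Ser K)})
      (f := algebraMap (Ser K) S') Ideal.Quotient.mk_surjective (by
        change RingHom.ker (Ideal.Quotient.mk _) ≤ _; rw [Ideal.mk_ker])
    have h2 : Ideal.map (algebraMap (Ser K) S') (Ideal.span {(x : Ser K)}) = ⊥ := by
      rw [Ideal.map_span, Set.image_singleton, Ideal.span_singleton_eq_bot]
      exact Ideal.Quotient.eq_zero_iff_mem.2 (Ideal.mem_span_singleton_self _)
    rw [h2] at h1
    rw [← h1]
    exact Ideal.mem_map_of_mem _ (Ideal.jacobson_mono bot_le (hjac 1))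
  have hreg : IsSMulRegular M' (algebraMap (Ser K) S' y) := by
    intro u v huv
    apply h.2
    simpa only [algebraMap_smul] using huv
  rw [← Module.free_quotSMulTop_iff_free S' M' hj hreg]
  have hmax : (Ideal.span {algebraMap (Ser K) S' y}).IsMaximal := by
    have h2 : Ideal.map (algebraMap (Ser K) S') (vars K) = Ideal.span {algebraMap (Ser K) S' y} := by
      rw [vars_eq, Ideal.map_span, Set.image_pair]
      have : algebraMap (Ser K) S' x = 0 :=
        Ideal.Quotient.eq_zero_iff_mem.2 (Ideal.mem_span_singleton_self _)
      rw [this, Ideal.span_insert_zero]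
    rw [← h2]
    refine Ideal.IsMaximal.map_of_surjective_of_ker_le Ideal.Quotient.mk_surjective ?_
    rw [Ideal.mk_ker, Ideal.span_singleton_le_iff_mem]
    exact X_mem_vars 0
  let _ := Ideal.Quotient.field (Ideal.span {algebraMap (Ser K) S' y})
  exact Module.Free.of_divisionRing _ _

end Free

section Criterion

variable {K A : Type u} [Field K] [CommRing A] [IsLocalRing A] [Algebra K A]
    [Algebra (Ser K) A]

theorem IsFiniteOverSer.algebraMap_X_mem (h : IsFiniteOverSer K A) (i : Fin 2) :
    algebraMap (Ser K) A (MvPowerSeries.X i) ∈ IsLocalRing.maximalIdeal A := by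
  have := h.finite
  have h1 := Ideal.isMaximal_comap_of_isIntegral_of_isMaximal (R := Ser K)
    (IsLocalRing.maximalIdeal A)
  have h2 := IsLocalRing.eq_maximalIdeal h1
  rw [← vars_eq_maximalIdeal] at h2
  rw [← Ideal.mem_comap, h2]
  exact X_mem_vars i

theorem IsFiniteOverSer.exists_pow_le (h : IsFiniteOverSer K A) :
    ∃ k, IsLocalRing.maximalIdeal A ^ k ≤
      Ideal.span {algebraMap (Ser K) A x, algebraMap (Ser K) A y} := by
  have := h.finite
  have := h.sing.isNoetherianRing
  refine Ideal.exists_pow_le_of_le_radical_of_fg ?_ (IsNoetherian.noetherian _)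
  rw [Ideal.radical_eq_sInf]
  refine le_sInf ?_
  rintro q ⟨hq1, hq2⟩
  have h1 : vars K ≤ q.comap (algebraMap (Ser K) A) := by
    rw [← Ideal.map_le_iff_le_comap, vars_eq, Ideal.map_span, Set.image_pair]
    exact hq1
  have h2 : (q.comap (algebraMap (Ser K) A)).IsMaximal := by
    rw [← Ideal.IsMaximal.eq_of_le (inferInstance : (vars K).IsMaximal)
      (Ideal.comap_ne_top _ hq2.ne_top) h1]
    infer_instance
  exact (IsLocalRing.eq_maximalIdeal (Ideal.isMaximal_of_isIntegral_of_isMaximal_comap q h2)).ge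

variable {M : Type u} [AddCommGroup M] [Module A M]

theorem IsFiniteOverSer.exists_isRegularPair (h : IsFiniteOverSer K A)
    (hM : IsCohenMacaulay A M) : ∃ a ∈ IsLocalRing.maximalIdeal A,
      ∃ b ∈ IsLocalRing.maximalIdeal A, IsRegularPair M a b := by
  obtain ⟨-, rs, h1, h2, h3⟩ := hM
  rw [h.sing.ringKrullDim_eq] at h2
  have h4 : rs.length = 2 := by exact_mod_cast h2
  obtain ⟨a, b, rfl⟩ := List.length_eq_two.1 h4
  exact ⟨a, h1 a (by simp), b, h1 b (by simp), isWeaklyRegular_pair_iff.1 h3⟩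

theorem IsFiniteOverSer.isRegularPair (h : IsFiniteOverSer K A) (hM : IsCohenMacaulay A M) :
    IsRegularPair M (algebraMap (Ser K) A x) (algebraMap (Ser K) A y) := by
  have := h.sing.isNoetherianRing
  have := h.sing.isDomain
  have := hM.1
  obtain ⟨a, ha, b, hb, hab⟩ := h.exists_isRegularPair hM
  obtain ⟨k, hk⟩ := h.exists_pow_le
  exact hab.exchange h.sing.ringKrullDim_eq ha hb h.x_ne_zero hk

theorem IsFiniteOverSer.isCohenMacaulay_of_isRegularPair (h : IsFiniteOverSer K A)
    [Module.Finite A M]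
    (hM : IsRegularPair M (algebraMap (Ser K) A x) (algebraMap (Ser K) A y)) :
    IsCohenMacaulay A M := by
  refine ⟨inferInstance, [_, _], ?_, ?_, isWeaklyRegular_pair_iff.2 hM⟩
  · intro z hz
    simp only [List.mem_cons, List.not_mem_nil, or_false] at hz
    rcases hz with rfl | rfl
    exacts [h.algebraMap_X_mem 0, h.algebraMap_X_mem 1]
  · rw [h.sing.ringKrullDim_eq]; rfl

/-- Since any regular pair may be exchanged for x, y, being CM depends only on the underlying module
over K[[x,y]]. This is what allows CM modules to be treated as matrices. -/
theorem IsFiniteOverSer.isCohenMacaulay_iff (h : IsFiniteOverSer K A) [Module (Ser K) M]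
    [IsScalarTower (Ser K) A M] :
    IsCohenMacaulay A M ↔ Module.Finite (Ser K) M ∧ Module.Free (Ser K) M := by
  have := h.finite
  constructor
  · intro hM
    have := hM.1
    have : Module.Finite (Ser K) M := Module.Finite.trans A M
    exact ⟨this, free_of_isRegularPair M (IsRegularPair.algebraMap_iff.1 (h.isRegularPair hM))⟩
  · rintro ⟨h1, h2⟩
    have : Module.Finite A M := Module.Finite.of_restrictScalars_finite (Ser K) A M
    exact h.isCohenMacaulay_of_isRegularPair
      (IsRegularPair.algebraMap_iff.2 (isRegularPair_of_free M))

end Criterion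

end SurfaceCM

namespace SurfaceCM

/-! ### Complete modules -/

section Complete

variable {T : Type*} [CommRing T] (I : Ideal T)

theorem pi_mem_smul_top {ι : Type*} [Finite ι] {J : Ideal T} {f : ι → T} (hf : ∀ i, f i ∈ J) :
    f ∈ (J • ⊤ : Submodule T (ι → T)) := by
  classical
  have := Fintype.ofFinite ι
  rw [← Finset.univ_sum_single f]
  refine Submodule.sum_mem _ fun i _ => ?_
  have : (Pi.single i (f i) : ι → T) = f i • Pi.single i 1 := by
    rw [← Pi.single_smul, smul_eq_mul, mul_one]
  rw [this]
  exact Submodule.smul_mem_smul (hf i) trivial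

theorem apply_mem_of_mem_smul_top {ι : Type*} {J : Ideal T} {f : ι → T}
    (hf : f ∈ (J • ⊤ : Submodule T (ι → T))) (i : ι) : f i ∈ J := by
  refine Submodule.smul_induction_on hf (fun r hr n _ => ?_) (fun a b ha hb => ?_)
  · exact J.mul_mem_right _ hr
  · exact J.add_mem ha hb

instance isPrecomplete_pi {ι : Type*} [Finite ι] [IsPrecomplete I T] :
    IsPrecomplete I (ι → T) := by
  refine ⟨fun f hf => ?_⟩
  have h1 : ∀ i, ∃ L : T, ∀ n, f n i ≡ L [SMOD (I ^ n • ⊤ : Submodule T T)] := fun i =>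
    IsPrecomplete.prec' (I := I) (fun n => f n i) fun {m n} hmn => by
      have := hf hmn
      rw [SModEq.sub_mem] at this ⊢
      simpa using apply_mem_of_mem_smul_top this i
  choose L hL using h1
  refine ⟨L, fun n => ?_⟩
  rw [SModEq.sub_mem]
  refine pi_mem_smul_top fun i => ?_
  have := hL i n
  rw [SModEq.sub_mem] at this
  simpa using this

/-- Separatedness is Krull's intersection theorem, as I lies in the Jacobson radical. Completeness
descends along a surjection from a finite free module, which stays surjective on completions. -/
theorem isAdicComplete_of_finite [IsNoetherianRing T] [IsAdicComplete I T] (M : Type*)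
    [AddCommGroup M] [Module T M] [Module.Finite T M] : IsAdicComplete I M := by
  have h1 : IsHausdorff I M := IsHausdorff.of_le_jacobson I M (IsAdicComplete.le_jacobson_bot I)
  have h2 : IsPrecomplete I M := by
    obtain ⟨n, f, hf⟩ := Module.Finite.exists_fin' T M
    rw [← AdicCompletion.of_surjective_iff]
    intro z
    obtain ⟨z', rfl⟩ := AdicCompletion.map_surjective I hf z
    obtain ⟨w, rfl⟩ := AdicCompletion.of_surjective I (Fin n → T) z'
    exact ⟨f w, by rw [AdicCompletion.map_of]⟩
  exact { h1, h2 with }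

end Complete

/-! ### Lifting idempotents over complete rings -/

section Lift

variable {T E : Type*} [CommRing T] [Ring E] [Algebra T E]

theorem mul_left_mem_smul_top {I : Ideal T} {z : E} (hz : z ∈ (I • ⊤ : Submodule T E)) (c : E) :
    c * z ∈ (I • ⊤ : Submodule T E) := by
  refine Submodule.smul_induction_on (p := fun z => c * z ∈ (I • ⊤ : Submodule T E)) hz
    (fun r hr n _ => ?_) (fun a b ha hb => ?_)
  · rw [mul_smul_comm]; exact Submodule.smul_mem_smul hr trivial
  · rw [mul_add]; exact Submodule.add_mem _ ha hb

theorem mul_right_mem_smul_top {I : Ideal T} {z : E} (hz : z ∈ (I • ⊤ : Submodule T E)) (c : E) :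
    z * c ∈ (I • ⊤ : Submodule T E) := by
  refine Submodule.smul_induction_on (p := fun z => z * c ∈ (I • ⊤ : Submodule T E)) hz
    (fun r hr n _ => ?_) (fun a b ha hb => ?_)
  · rw [smul_mul_assoc]; exact Submodule.smul_mem_smul hr trivial
  · rw [add_mul]; exact Submodule.add_mem _ ha hb

/-- The two-sided ideal of a `T`-algebra generated by an ideal of `T`. -/
def smulIdeal (E : Type*) [Ring E] [Algebra T E] (I : Ideal T) : Ideal E where
  __ := (I • ⊤ : Submodule T E)
  smul_mem' := fun c _ hz => mul_left_mem_smul_top hz c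

theorem mem_smulIdeal {I : Ideal T} {z : E} :
    z ∈ smulIdeal E I ↔ z ∈ (I • ⊤ : Submodule T E) := Iff.rfl

instance (I : Ideal T) : (smulIdeal E I).IsTwoSided := ⟨fun c hz => mul_right_mem_smul_top hz c⟩

theorem mul_mem_smulIdeal {I J : Ideal T} {z w : E} (hz : z ∈ smulIdeal E I)
    (hw : w ∈ smulIdeal E J) : z * w ∈ smulIdeal E (I * J) := by
  rw [mem_smulIdeal] at hz
  refine Submodule.smul_induction_on (p := fun z => z * w ∈ smulIdeal E (I * J)) hz
    (fun r hr n _ => ?_) (fun a b ha hb => ?_)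
  · rw [smul_mul_assoc, mem_smulIdeal, Submodule.mul_smul]
    exact Submodule.smul_mem_smul hr (mul_left_mem_smul_top hw n)
  · rw [add_mul]; exact Ideal.add_mem _ ha hb

theorem pow_mem_smulIdeal {I : Ideal T} {z : E} (hz : z ∈ smulIdeal E I) (n : ℕ) :
    z ^ n ∈ smulIdeal E (I ^ n) := by
  induction n with
  | zero => rw [pow_zero, pow_zero, mem_smulIdeal, Ideal.one_eq_top, Submodule.top_smul]; trivial
  | succ n ih => rw [pow_succ, pow_succ]; exact mul_mem_smulIdeal ih hz

theorem smulIdeal_mono {I J : Ideal T} (h : I ≤ J) : smulIdeal E I ≤ smulIdeal E J :=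
  fun _ hz => Submodule.smul_mono_left h hz

variable {ι : Type*} [Fintype ι]

theorem exists_lift_step {I : Ideal T} {n : ℕ} (hn : n ≠ 0) {a : ι → E}
    (ha : CompleteOrthogonalIdempotents fun i => Ideal.Quotient.mk (smulIdeal E (I ^ n)) (a i)) :
    ∃ b : ι → E,
      (CompleteOrthogonalIdempotents fun i => Ideal.Quotient.mk (smulIdeal E (I ^ (n + 1))) (b i)) ∧
      ∀ i, a i - b i ∈ smulIdeal E (I ^ n) := by
  let f : E ⧸ smulIdeal E (I ^ (n + 1)) →+* E ⧸ smulIdeal E (I ^ n) :=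
    Ideal.Quotient.factor (smulIdeal_mono (Ideal.pow_le_pow_right n.le_succ))
  obtain ⟨b', hb', hfb⟩ := CompleteOrthogonalIdempotents.lift_of_isNilpotent_ker f
    (by
      intro z hz
      obtain ⟨z, rfl⟩ := Ideal.Quotient.mk_surjective z
      have hz' : Ideal.Quotient.mk (smulIdeal E (I ^ n)) z = 0 := hz
      rw [Ideal.Quotient.eq_zero_iff_mem] at hz'
      -- The kernel has square zero because n + 1 ≤ 2n for n ≥ 1.
      refine ⟨2, ?_⟩
      rw [← map_pow, Ideal.Quotient.eq_zero_iff_mem]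
      refine smulIdeal_mono ?_ (pow_mem_smulIdeal hz' 2)
      rw [← pow_mul]
      exact Ideal.pow_le_pow_right (by omega)) ha
    (fun i => ⟨Ideal.Quotient.mk _ (a i), rfl⟩)
  have hsurj : ∀ i, ∃ b : E, Ideal.Quotient.mk (smulIdeal E (I ^ (n + 1))) b = b' i := fun i =>
    Ideal.Quotient.mk_surjective _
  choose b hb using hsurj
  refine ⟨b, by simpa only [hb] using hb', fun i => ?_⟩
  have h1 := congrFun hfb i
  rw [Function.comp_apply, ← hb] at h1
  rw [← Ideal.Quotient.eq]
  exact h1.symm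

/-- Successive lifts form a Cauchy sequence, and the identities hold for its limit modulo every
power of I, hence exactly. Indices are shifted: `P n` concerns the quotient by I^(n+1), so that `P
0` is the hypothesis. -/
theorem exists_lift_idempotents (I : Ideal T) [IsAdicComplete I E] {a : ι → E}
    (ha : CompleteOrthogonalIdempotents fun i => Ideal.Quotient.mk (smulIdeal E I) (a i)) :
    ∃ b : ι → E, CompleteOrthogonalIdempotents b ∧ ∀ i, b i - a i ∈ smulIdeal E I := by
  classical
  let P : ℕ → (ι → E) → Prop := fun n a =>
    CompleteOrthogonalIdempotents fun i => Ideal.Quotient.mk (smulIdeal E (I ^ (n + 1))) (a i)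
  have hstep : ∀ n (a : {a // P n a}), ∃ b : {b // P (n + 1) b},
      ∀ i, a.1 i - b.1 i ∈ smulIdeal E (I ^ (n + 1)) := fun n a => by
    obtain ⟨b, hb, hab⟩ := exists_lift_step n.succ_ne_zero a.2
    exact ⟨⟨b, hb⟩, hab⟩
  choose next hnext using hstep
  have hI : I = I ^ (0 + 1) := by simp
  have h0 : P 0 a := by
    have : ∀ J : Ideal T, J = I →
      CompleteOrthogonalIdempotents fun i => Ideal.Quotient.mk (smulIdeal E J) (a i) := by
      rintro J rfl; exact ha
    exact this _ hI.symm
  let s : ∀ n, {a // P n a} := fun n => Nat.rec ⟨a, h0⟩ (fun n a => next n a) n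
  have hs : ∀ n i, (s n).1 i - (s (n + 1)).1 i ∈ smulIdeal E (I ^ (n + 1)) := fun n i =>
    hnext n (s n) i
  have hcau : ∀ i {m n : ℕ}, m ≤ n →
      (s m).1 i ≡ (s n).1 i [SMOD (I ^ m • ⊤ : Submodule T E)] := by
    intro i m n hmn
    induction n, hmn using Nat.le_induction with
    | base => rfl
    | succ n hmn ih =>
      refine ih.trans ?_
      rw [SModEq.sub_mem]
      exact smulIdeal_mono (Ideal.pow_le_pow_right (by omega)) (hs n i)
  have hlim := fun i => IsPrecomplete.prec' (I := I) (fun n => (s n).1 i) (hcau i)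
  choose b hb using hlim
  have hb' : ∀ n i, b i - (s n).1 i ∈ smulIdeal E (I ^ (n + 1)) := by
    intro n i
    have h1 := hb i (n + 1)
    rw [SModEq.sub_mem] at h1
    have h2 : b i - (s n).1 i =
      -((s n).1 i - (s (n + 1)).1 i) - ((s (n + 1)).1 i - b i) := by abel
    rw [h2]
    exact Ideal.sub_mem _ (Ideal.neg_mem_iff _ |>.2 (hs n i)) h1
  have hPb : ∀ n, P n b := by
    intro n
    have : (fun i => Ideal.Quotient.mk (smulIdeal E (I ^ (n + 1))) (b i)) =
        fun i => Ideal.Quotient.mk (smulIdeal E (I ^ (n + 1))) ((s n).1 i) := by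
      funext i
      rw [Ideal.Quotient.eq]
      exact hb' n i
    change CompleteOrthogonalIdempotents _
    rw [this]
    exact (s n).2
  have hzero : ∀ z : E, (∀ n, z ∈ smulIdeal E (I ^ (n + 1))) → z = 0 := by
    intro z hz
    refine IsHausdorff.haus' (I := I) z fun n => ?_
    rw [SModEq.zero]
    exact smulIdeal_mono (Ideal.pow_le_pow_right n.le_succ) (hz n)
  refine ⟨b, ⟨⟨fun i => ?_, fun i j hij => ?_⟩, ?_⟩, fun i => ?_⟩
  · change b i * b i = b i
    rw [← sub_eq_zero]
    refine hzero _ fun n => ?_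
    rw [← Ideal.Quotient.eq, map_mul]
    exact (hPb n).idem i
  · refine hzero _ fun n => ?_
    rw [← Ideal.Quotient.eq_zero_iff_mem, map_mul]
    exact (hPb n).ortho hij
  · rw [← sub_eq_zero]
    refine hzero _ fun n => ?_
    rw [← Ideal.Quotient.eq, map_sum, map_one]
    exact (hPb n).complete
  · have := hb' 0 i
    rwa [zero_add, pow_one] at this

end Lift

/-! ### Finite-dimensional algebras over an algebraically closed field -/

section Wedderburn

/-- The idempotents are the diagonal matrix units E_aa of all the blocks; the corner of E_aa
consists of the multiples of E_aa by the entries z_aa. -/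
theorem exists_idempotents_matrix (F : Type*) [Field F] {n : ℕ} (d : Fin n → ℕ) :
    ∃ (k : ℕ) (e : Fin k → Π i, Matrix (Fin (d i)) (Fin (d i)) F),
      CompleteOrthogonalIdempotents e ∧ ∀ i z, ∃ c : F, e i * z * e i = c • e i := by
  classical
  let e : (Σ i, Fin (d i)) → Π i, Matrix (Fin (d i)) (Fin (d i)) F := fun p =>
    Pi.single p.1 (Matrix.single p.2 p.2 1)
  have he : CompleteOrthogonalIdempotents e := by
    refine ⟨⟨fun p => ?_, fun p q hpq => ?_⟩, ?_⟩
    · simp [e, IsIdempotentElem, ← Pi.single_mul]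
    · obtain ⟨i, a⟩ := p
      obtain ⟨j, b⟩ := q
      by_cases hij : i = j
      · subst hij
        have hab : a ≠ b := fun h => hpq (by rw [h])
        simp only [e]
        rw [← Pi.single_mul, Matrix.single_mul_single_of_ne _ _ _ _ hab, Pi.single_zero]
      · simp only [e]
        funext k
        rw [Pi.mul_apply]
        by_cases hk : k = i
        · subst hk
          rw [Pi.single_eq_of_ne hij, mul_zero]; rfl
        · rw [Pi.single_eq_of_ne hk, zero_mul]; rfl
    · simp only [e]
      rw [Fintype.sum_sigma]
      funext i
      rw [Finset.sum_apply, Finset.sum_eq_single i]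
      · rw [Finset.sum_apply]
        simp only [Pi.single_eq_same, Pi.one_apply]
        ext a b
        rw [Matrix.sum_apply]
        by_cases hab : a = b
        · simp [Matrix.single_apply, Matrix.one_apply, hab]
        · rw [Matrix.one_apply_ne hab]
          refine Finset.sum_eq_zero fun j _ => ?_
          rw [Matrix.single_apply, if_neg]
          rintro ⟨rfl, rfl⟩
          exact hab rfl
      · intro j _ hj
        rw [Finset.sum_apply]
        exact Finset.sum_eq_zero fun a _ => Pi.single_eq_of_ne hj.symm _
      · simp
  have hc : ∀ p z, ∃ c : F, e p * z * e p = c • e p := by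
    rintro ⟨i, a⟩ z
    refine ⟨z i a a, ?_⟩
    funext k
    by_cases hk : k = i
    · subst hk
      simp only [e, Pi.mul_apply, Pi.smul_apply, Pi.single_eq_same]
      rw [Matrix.single_mul_mul_single, one_mul, mul_one, Matrix.smul_single, smul_eq_mul, mul_one]
    · simp only [e, Pi.mul_apply, Pi.smul_apply]
      rw [Pi.single_eq_of_ne hk]; simp
  let φ := (Fintype.equivFin (Σ i, Fin (d i))).symm
  exact ⟨_, e ∘ φ, CompleteOrthogonalIdempotents.equiv φ |>.2 he, fun i z => hc _ z⟩

/-- A finite-dimensional algebra over an algebraically closed field has a complete system of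
orthogonal idempotents with local corners. -/
theorem exists_primitive_idempotents (F Λ : Type*) [Field F] [IsAlgClosed F] [Ring Λ] [Algebra F Λ]
    [FiniteDimensional F Λ] :
    ∃ (k m : ℕ) (e : Fin k → Λ), CompleteOrthogonalIdempotents e ∧ ∃ J : Ideal Λ,
      J ^ m = 0 ∧ ∀ i z, ∃ c : F, e i * z * e i - c • e i ∈ J := by
  have : IsArtinianRing Λ := IsArtinianRing.of_finite F Λ
  obtain ⟨m, hm⟩ := IsSemiprimaryRing.isNilpotent (R := Λ)
  have hss : IsSemisimpleRing (Λ ⧸ Ring.jacobson Λ) := IsSemiprimaryRing.isSemisimpleRing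
  have hfd : FiniteDimensional F (Λ ⧸ Ring.jacobson Λ) :=
    Module.Finite.of_surjective (Ideal.Quotient.mkₐ F (Ring.jacobson Λ)).toLinearMap
      Ideal.Quotient.mk_surjective
  -- Modulo its nilpotent radical the algebra is a product of matrix algebras over F. Diagonal
  -- matrix units lift along the radical, and the corner of a lift is scalar modulo the radical.
  obtain ⟨n, d, -, ⟨φ⟩⟩ :=
    IsSemisimpleRing.exists_algEquiv_pi_matrix_of_isAlgClosed F (Λ ⧸ Ring.jacobson Λ)
  obtain ⟨k, e, he, hc⟩ := exists_idempotents_matrix F d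
  have he' : CompleteOrthogonalIdempotents (φ.symm.toRingEquiv.toRingHom ∘ e) := he.map _
  obtain ⟨e', he1, he2⟩ := CompleteOrthogonalIdempotents.lift_of_isNilpotent_ker
    (Ideal.Quotient.mk (Ring.jacobson Λ)) (fun z hz => ⟨m, by
      have := Ideal.pow_mem_pow (Ideal.mk_ker.le hz) m
      rw [hm] at this
      simpa using this⟩) he' (fun i => Ideal.Quotient.mk_surjective _)
  refine ⟨k, m, e', he1, Ring.jacobson Λ, hm, fun i z => ?_⟩
  obtain ⟨c, hcz⟩ := hc i (φ (Ideal.Quotient.mk _ z))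
  refine ⟨c, ?_⟩
  rw [← Ideal.Quotient.eq_zero_iff_mem]
  have h1 : Ideal.Quotient.mk (Ring.jacobson Λ) (e' i) = φ.symm (e i) := congrFun he2 i
  have h2 : Ideal.Quotient.mk (Ring.jacobson Λ) (c • e' i) = c • φ.symm (e i) := by
    rw [← h1]; rfl
  rw [map_sub, map_mul, map_mul, h1, h2, sub_eq_zero]
  apply φ.injective
  simpa using hcz

end Wedderburn

end SurfaceCM

namespace SurfaceCM

open Ser

/-! ### Primitive idempotents and Krull-Schmidt -/

section Primitive

variable {T E : Type*} [CommRing T] [Ring E] [Algebra T E]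

/-- The elements of the corner of `e` are scalars up to nilpotents modulo `I`. -/
def IsPrimitiveMod (I : Ideal T) (e : E) : Prop :=
  ∀ z : E, ∃ (c : T) (m : ℕ), (e * z * e - c • e) ^ m ∈ smulIdeal E I

theorem isUnit_of_left_right_inverse {z v v' : E} (hv : z * v = 1) (hv' : v' * z = 1) : IsUnit z :=
  ⟨⟨z, v, hv, by rw [← left_inv_eq_right_inv hv' hv, hv']⟩, rfl⟩

/-- For an idempotent f in the corner of e, the element f - ce acts as 1 - c on f and as -c on e -
f. This lemma and the next record the powers of the two eigenvalues. -/
theorem pow_sub_smul_mul {e f : E} (hef : e * f = f) (hf : f * f = f) (c : T) (m : ℕ) :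
    (f - c • e) ^ m * f = (1 - c) ^ m • f := by
  induction m with
  | zero => simp
  | succ m ih =>
    rw [pow_succ, mul_assoc, sub_mul, hf, smul_mul_assoc, hef]
    rw [show f - c • f = (1 - c) • f by rw [sub_smul, one_smul], mul_smul_comm, ih, smul_smul,
      pow_succ']

theorem pow_sub_smul_mul' {e f : E} (he : e * e = e) (hef : e * f = f) (hf : f * f = f)
    (hfe : f * e = f) (c : T) (m : ℕ) :
    (f - c • e) ^ m * (e - f) = (-c) ^ m • (e - f) := by
  induction m with
  | zero => simp
  | succ m ih =>
    have : (f - c • e) * (e - f) = (-c) • (e - f) := by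
      rw [sub_mul, mul_sub, mul_sub, hfe, hf, smul_mul_assoc, smul_mul_assoc, he, hef, sub_self,
        zero_sub, ← smul_sub, neg_smul]
    rw [pow_succ, mul_assoc, this, mul_smul_comm, ih, smul_smul, pow_succ']

theorem mem_of_isUnit_smul_mem {c : T} (hc : IsUnit c) {f : E} {I : Ideal T}
    (h : c • f ∈ smulIdeal E I) : f ∈ smulIdeal E I := by
  obtain ⟨d, hd⟩ := hc.exists_left_inv
  have := (I • ⊤ : Submodule T E).smul_mem d h
  rwa [smul_smul, hd, one_smul] at this

variable [IsLocalRing T]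

local notation "𝔪" => IsLocalRing.maximalIdeal T

/-- An idempotent equals its n-th power, so it lies in 𝔪^n E for every n. -/
theorem eq_zero_of_mem_smulIdeal [IsHausdorff 𝔪 E] {f : E} (hf : f * f = f)
    (h : f ∈ smulIdeal E 𝔪) : f = 0 := by
  have h1 : ∀ n, f ∈ smulIdeal E (𝔪 ^ n) := by
    intro n
    have h2 := pow_mem_smulIdeal h n
    rcases n with _ | n
    · rw [mem_smulIdeal, pow_zero, Ideal.one_eq_top, Submodule.top_smul]; trivial
    · rwa [(show IsIdempotentElem f from hf).pow_succ_eq] at h2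
  exact IsHausdorff.haus' (I := 𝔪) f fun n => by rw [SModEq.zero]; exact h1 n

/-- Some power of f - ce lies in 𝔪E. If c is a unit, then e - f lies in 𝔪E, and otherwise 1 - c is a
unit and f does; an idempotent of 𝔪E vanishes. -/
theorem IsPrimitiveMod.eq_zero_or_eq [IsHausdorff 𝔪 E] {e f : E} (h : IsPrimitiveMod 𝔪 e)
    (he : e * e = e) (hf : f * f = f) (hef : e * f = f) (hfe : f * e = f) : f = 0 ∨ f = e := by
  obtain ⟨c, m, hcm⟩ := h f
  rw [hef, hfe] at hcm
  by_cases hc : IsUnit c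
  · right
    have h1 := (smulIdeal E 𝔪).mul_mem_right (e - f) hcm
    rw [pow_sub_smul_mul' he hef hf hfe] at h1
    have h2 := eq_zero_of_mem_smulIdeal (by
      rw [sub_mul, mul_sub, mul_sub, he, hef, hfe, hf, sub_self, sub_zero])
      (mem_of_isUnit_smul_mem (hc.neg.pow m) h1)
    exact (sub_eq_zero.1 h2).symm
  · left
    have h1 := (smulIdeal E 𝔪).mul_mem_right f hcm
    rw [pow_sub_smul_mul hef hf] at h1
    exact eq_zero_of_mem_smulIdeal hf
      (mem_of_isUnit_smul_mem (((IsLocalRing.isUnit_or_isUnit_one_sub_self c).resolve_left hc).pow m)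
        h1)

/-- By Nakayama, left and right multiplications by 1 - w are surjective, being the identity modulo
𝔪. -/
theorem isUnit_one_sub_of_mem [Module.Finite T E] {w : E}
    (hw : w ∈ smulIdeal E 𝔪) : IsUnit (1 - w) := by
  have key : ∀ φ : E →ₗ[T] E, (∀ z, z - φ z ∈ smulIdeal E 𝔪) → Function.Surjective φ := by
    intro φ hφ
    rw [← LinearMap.range_eq_top, eq_top_iff]
    refine Submodule.le_of_le_smul_of_le_jacobson_bot (I := 𝔪) Module.Finite.fg_top
      (IsLocalRing.maximalIdeal_le_jacobson _) fun z _ => ?_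
    rw [show z = φ z + (z - φ z) by abel]
    exact Submodule.add_mem_sup ⟨z, rfl⟩ (hφ z)
  obtain ⟨v, hv⟩ := key (LinearMap.mulLeft T (1 - w)) (fun z => by
    rw [LinearMap.mulLeft_apply, sub_mul, one_mul, sub_sub_cancel]
    exact (smulIdeal E 𝔪).mul_mem_right _ hw) 1
  obtain ⟨v', hv'⟩ := key (LinearMap.mulRight T (1 - w)) (fun z => by
    rw [LinearMap.mulRight_apply, mul_sub, mul_one, sub_sub_cancel]
    exact (smulIdeal E 𝔪).mul_mem_left _ hw) 1
  exact isUnit_of_left_right_inverse hv hv'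

/-- If z - c is nilpotent modulo 𝔪E and c is a unit, a geometric series inverts z. One of c, 1 - c
is always a unit of the local ring T, so E is local too. -/
theorem IsPrimitiveMod.isUnit_or_isUnit_one_sub [Module.Finite T E]
    (h : IsPrimitiveMod 𝔪 (1 : E)) (z : E) : IsUnit z ∨ IsUnit (1 - z) := by
  have key : ∀ (c : T) (m : ℕ) (z : E), IsUnit c → (z - c • 1) ^ m ∈ smulIdeal E 𝔪 →
      IsUnit z := by
    intro c m z hc hm
    obtain ⟨d, hd⟩ := hc.exists_left_inv
    have h1 : 1 - d • z = -(d • (z - c • 1)) := by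
      rw [smul_sub, smul_smul, hd, one_smul]; abel
    have h2 : (1 - d • z) ^ m ∈ smulIdeal E 𝔪 := by
      rw [h1, neg_pow, smul_pow]
      exact Ideal.mul_mem_left _ _ ((𝔪 • ⊤ : Submodule T E).smul_mem _ hm)
    have h3 := isUnit_one_sub_of_mem h2
    have h4 : IsUnit (d • z) := by
      have h6 : (1 - (1 - d • z)) * ∑ i ∈ Finset.range m, (1 - d • z) ^ i = 1 - (1 - d • z) ^ m :=
        mul_neg_geom_sum _ _
      have h7 : (∑ i ∈ Finset.range m, (1 - d • z) ^ i) * (1 - (1 - d • z)) = 1 - (1 - d • z) ^ m :=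
        geom_sum_mul_neg _ _
      rw [sub_sub_cancel] at h6 h7
      obtain ⟨r, hr⟩ := h3.exists_right_inv
      obtain ⟨l, hl⟩ := h3.exists_left_inv
      exact isUnit_of_left_right_inverse
        (by rw [← h6, mul_assoc] at hr; exact hr)
        (by rw [← h7, ← mul_assoc] at hl; exact hl)
    have h8 : z = c • (d • z) := by rw [smul_smul, mul_comm, hd, one_smul]
    rw [h8, Algebra.smul_def]
    exact (hc.map (algebraMap T E)).mul h4
  obtain ⟨c, m, hcm⟩ := h z
  rw [one_mul, mul_one] at hcm
  rcases IsLocalRing.isUnit_or_isUnit_one_sub_self c with hc | hc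
  · exact Or.inl (key c m z hc hcm)
  · refine Or.inr (key (1 - c) m (1 - z) hc ?_)
    have : (1 : E) - z - (1 - c) • 1 = -(z - c • 1) := by rw [sub_smul, one_smul]; abel
    rw [this, neg_pow]
    exact Ideal.mul_mem_left _ _ hcm

end Primitive

theorem exists_lift_idempotents_of_surjective {T E Λ ι : Type*} [CommRing T] [Ring E] [Algebra T E]
    [Ring Λ] [Fintype ι] (I : Ideal T) [IsAdicComplete I E] (π : E →+* Λ)
    (hπ : Function.Surjective π) (hker : ∀ z, π z = 0 ↔ z ∈ smulIdeal E I) {e : ι → Λ}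
    (he : CompleteOrthogonalIdempotents e) :
    ∃ b : ι → E, CompleteOrthogonalIdempotents b ∧ ∀ i, π (b i) = e i := by
  choose a ha using fun i => hπ (e i)
  have hmk : ∀ z w, π z = π w →
      Ideal.Quotient.mk (smulIdeal E I) z = Ideal.Quotient.mk (smulIdeal E I) w := by
    intro z w h
    rw [Ideal.Quotient.eq, ← hker, map_sub, h, sub_self]
  obtain ⟨b, hb, hab⟩ := exists_lift_idempotents I (a := a) (by
    refine ⟨⟨fun i => ?_, fun i j hij => ?_⟩, ?_⟩
    · change _ * _ = _
      rw [← map_mul]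
      exact hmk _ _ (by rw [map_mul, ha]; exact he.idem i)
    · change _ * _ = _
      rw [← map_mul, ← map_zero (Ideal.Quotient.mk _)]
      exact hmk _ _ (by rw [map_mul, ha, ha, map_zero]; exact he.ortho hij)
    · rw [← map_sum, ← map_one (Ideal.Quotient.mk _)]
      exact hmk _ _ (by rw [map_sum, map_one, ← he.complete]; simp only [ha]))
  refine ⟨b, hb, fun i => ?_⟩
  rw [← ha, ← sub_eq_zero, ← map_sub, hker]
  exact hab i

theorem exists_isPrimitiveMod_of_surjective {T E Λ : Type*} [CommRing T] [Ring E] [Algebra T E]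
    [Ring Λ] [Algebra T Λ] (I : Ideal T) [IsAdicComplete I E] (π : E →ₐ[T] Λ)
    (hπ : Function.Surjective π) (hker : ∀ z, π z = 0 ↔ z ∈ smulIdeal E I)
    {k : ℕ} {e : Fin k → Λ} (he : CompleteOrthogonalIdempotents e)
    (hc : ∀ i z, ∃ (c : T) (m : ℕ), (e i * z * e i - c • e i) ^ m = 0) :
    ∃ (k : ℕ) (e : Fin k → E), CompleteOrthogonalIdempotents e ∧
      ∀ i, IsPrimitiveMod I (e i) := by
  obtain ⟨b, hb, hbe⟩ := exists_lift_idempotents_of_surjective I π.toRingHom hπ hker he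
  replace hbe : ∀ i, π (b i) = e i := hbe
  refine ⟨k, b, hb, fun i z => ?_⟩
  obtain ⟨c, m, hcz⟩ := hc i (π z)
  refine ⟨c, m, ?_⟩
  rw [← hker, map_pow, map_sub, map_mul, map_mul, map_smul, hbe, hcz]

theorem finite_quotient_smulIdeal {T E : Type*} [CommRing T] [Ring E]
    [Algebra T E] [Module.Finite T E] (I : Ideal T) : Module.Finite T (E ⧸ smulIdeal E I) :=
  Module.Finite.of_surjective (Ideal.Quotient.mkₐ T (smulIdeal E I)).toLinearMap
      Ideal.Quotient.mk_surjective

theorem smul_quotient_smulIdeal {T E : Type*} [CommRing T] [Ring E]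
    [Algebra T E] {I : Ideal T} {t : T} (ht : t ∈ I) (z : E ⧸ smulIdeal E I) : t • z = 0 := by
  obtain ⟨z, rfl⟩ := Ideal.Quotient.mk_surjective z
  have h : t • z ∈ smulIdeal E I := mem_smulIdeal.2 (Submodule.smul_mem_smul ht Submodule.mem_top)
  exact Ideal.Quotient.eq_zero_iff_mem.2 h

theorem exists_primitive_decomposition_of_quotient {T : Type*} {E : Type u} [CommRing T] [Ring E]
    [Algebra T E] [Module.Finite T E] (I : Ideal T) [IsAdicComplete I E]
    (H : ∀ (Λ : Type u) [Ring Λ] [Algebra T Λ] [Module.Finite T Λ],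
      (∀ t ∈ I, ∀ z : Λ, t • z = 0) →
      ∃ (k : ℕ) (e : Fin k → Λ), CompleteOrthogonalIdempotents e ∧
        ∀ i z, ∃ (c : T) (m : ℕ), (e i * z * e i - c • e i) ^ m = 0) :
    ∃ (k : ℕ) (e : Fin k → E), CompleteOrthogonalIdempotents e ∧
      ∀ i, IsPrimitiveMod I (e i) := by
  have := finite_quotient_smulIdeal (E := E) I
  obtain ⟨k, e, he, hc⟩ := H _ fun t ht => smul_quotient_smulIdeal (E := E) ht
  exact exists_isPrimitiveMod_of_surjective I (Ideal.Quotient.mkₐ T (smulIdeal E I))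
    (Ideal.Quotient.mkₐ_surjective T _) (fun z => Ideal.Quotient.eq_zero_iff_mem) he hc

/-! ### Idempotents in finite algebras over K[[x, y]]. -/

section PowerSeriesAlgebra

variable (K : Type u) [Field K]

theorem exists_primitive_idempotents_of_smul_eq_zero [IsAlgClosed K] (Λ : Type u) [Ring Λ]
    [Algebra (Ser K) Λ] [Module.Finite (Ser K) Λ] (h : ∀ t ∈ vars K, ∀ z : Λ, t • z = 0) :
    ∃ (k : ℕ) (e : Fin k → Λ), CompleteOrthogonalIdempotents e ∧
      ∀ i z, ∃ (c : Ser K) (m : ℕ), (e i * z * e i - c • e i) ^ m = 0 := by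
  let _ : Algebra K Λ := Algebra.compHom Λ (MvPowerSeries.C : K →+* Ser K)
  have hC : ∀ (c : K) (z : Λ), c • z = (MvPowerSeries.C c : Ser K) • z := fun c z => rfl
  have hsmul : ∀ (t : Ser K) (z : Λ), t • z = MvPowerSeries.constantCoeff t • z := by
    intro t z
    rw [hC, ← sub_eq_zero, ← sub_smul]
    exact h _ (C_constantCoeff_sub_mem t) _
  have : FiniteDimensional K Λ := by
    obtain ⟨s, hs⟩ := Module.Finite.fg_top (R := Ser K) (M := Λ)
    refine ⟨s, ?_⟩
    rw [eq_top_iff]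
    intro z _
    have hz : z ∈ Submodule.span (Ser K) (s : Set Λ) := by rw [hs]; trivial
    induction hz using Submodule.span_induction with
    | mem z hz => exact Submodule.subset_span hz
    | zero => exact Submodule.zero_mem _
    | add a b _ _ ha hb => exact Submodule.add_mem _ (ha trivial) (hb trivial)
    | smul t z _ hz => rw [hsmul]; exact Submodule.smul_mem _ _ (hz trivial)
  obtain ⟨k, m, e, he, J, hJ, hc⟩ := exists_primitive_idempotents K Λ
  refine ⟨k, e, he, fun i z => ?_⟩
  obtain ⟨c, hcz⟩ := hc i z
  refine ⟨MvPowerSeries.C c, m, ?_⟩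
  have := Ideal.pow_mem_pow hcz m
  rw [hJ] at this
  rw [← hC]
  simpa using this

variable (E : Type u) [Ring E] [Algebra (Ser K) E] [Module.Finite (Ser K) E]

instance : IsAdicComplete (vars K) E := isAdicComplete_of_finite _ _

theorem isHausdorff_maximalIdeal : IsHausdorff (IsLocalRing.maximalIdeal (Ser K)) E := by
  rw [← vars_eq_maximalIdeal]; infer_instance

variable [IsAlgClosed K]

theorem exists_primitive_decomposition :
    ∃ (k : ℕ) (e : Fin k → E), CompleteOrthogonalIdempotents e ∧
      ∀ i, IsPrimitiveMod (vars K) (e i) :=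
  exists_primitive_decomposition_of_quotient (vars K) fun Λ _ _ _ h =>
    exists_primitive_idempotents_of_smul_eq_zero K Λ h

/-- If only 0 and 1 are idempotent, a decomposition of 1 into primitive idempotents must contain 1
itself, so 1 is primitive and E is local. -/
theorem isUnit_or_isUnit_one_sub_of_idempotents (K : Type u) [Field K] [IsAlgClosed K] (E : Type u)
    [Ring E] [Algebra (Ser K) E] [Module.Finite (Ser K) E] [Nontrivial E]
    (h : ∀ f : E, f * f = f → f = 0 ∨ f = 1) (z : E) : IsUnit z ∨ IsUnit (1 - z) := by
  obtain ⟨k, e, he, hp⟩ := exists_primitive_decomposition K E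
  have : ∃ i, e i = 1 := by
    by_contra! hne
    have h0 : ∑ i, e i = 0 := Finset.sum_eq_zero fun i _ => (h _ (he.idem i)).resolve_right (hne i)
    rw [he.complete] at h0
    exact one_ne_zero h0
  obtain ⟨i, hi⟩ := this
  have h1 := hp i
  rw [hi, vars_eq_maximalIdeal] at h1
  exact h1.isUnit_or_isUnit_one_sub z

end PowerSeriesAlgebra

/-! ### Direct summands and the Krull-Schmidt exchange argument. -/

section Summand

/-- `N` is isomorphic to a direct summand of `M`. -/
def IsSummand (A N M : Type*) [CommRing A] [AddCommGroup N] [Module A N] [AddCommGroup M]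
    [Module A M] : Prop :=
  ∃ (i : N →ₗ[A] M) (p : M →ₗ[A] N), p ∘ₗ i = LinearMap.id

variable {A N M L : Type*} [CommRing A] [AddCommGroup N] [Module A N] [AddCommGroup M]
    [Module A M] [AddCommGroup L] [Module A L]

theorem IsSummand.trans (h : IsSummand A N M) (h' : IsSummand A M L) : IsSummand A N L := by
  obtain ⟨i, p, hp⟩ := h
  obtain ⟨i', p', hp'⟩ := h'
  refine ⟨i' ∘ₗ i, p ∘ₗ p', ?_⟩
  rw [LinearMap.comp_assoc, ← LinearMap.comp_assoc i, hp', LinearMap.id_comp, hp]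

theorem IsSummand.of_equiv (e : N ≃ₗ[A] M) : IsSummand A N M :=
  ⟨e, e.symm, by ext; simp⟩

theorem isSummand_range {e : Module.End A M} (he : e * e = e) :
    IsSummand A (LinearMap.range e) M :=
  ⟨(LinearMap.range e).subtype, LinearMap.rangeRestrict e, by
    ext ⟨_, w, rfl⟩
    exact LinearMap.congr_fun he w⟩

theorem isIndecomposable_iff {A : Type u} [CommRing A] [IsLocalRing A] {M : Type u}
    [AddCommGroup M] [Module A M] : IsIndecomposable A M ↔
    Nontrivial M ∧ ∀ f : Module.End A M, f * f = f → f = 0 ∨ f = 1 := by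
  refine and_congr Iff.rfl ⟨fun h f hf => ?_, fun h P Q hPQ => ?_⟩
  · have hf' : IsIdempotentElem f := hf
    rcases h _ _ (LinearMap.IsIdempotentElem.isCompl hf') with h1 | h1
    · left; rwa [LinearMap.range_eq_bot] at h1
    · right
      have hinj := LinearMap.ker_eq_bot.1 h1
      ext w
      exact hinj (LinearMap.congr_fun hf w)
  · rcases h _ (Submodule.isIdempotentElem_projection hPQ) with h1 | h1
    · left
      rw [← Submodule.range_projection hPQ, h1, LinearMap.range_zero]
    · right
      rw [← Submodule.ker_projection hPQ, h1]
      exact LinearMap.ker_id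

/-- With i and p exhibiting N as a summand, the sum of the endomorphisms p e_k i is 1 in the local
ring End N. Some term is therefore a unit, which splits N off the image of e_k. -/
theorem exists_isSummand_range {ι : Type*} [Fintype ι] {e : ι → Module.End A M}
    (he : CompleteOrthogonalIdempotents e) [Nontrivial N]
    (hN : ∀ z : Module.End A N, IsUnit z ∨ IsUnit (1 - z)) (h : IsSummand A N M) :
    ∃ k, IsSummand A N (LinearMap.range (e k)) := by
  classical
  obtain ⟨i, p, hp⟩ := h
  have key : ∀ (s : Finset ι) (a : ι → Module.End A N), ∑ k ∈ s, a k = 1 →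
      ∃ k ∈ s, IsUnit (a k) := by
    intro s
    induction s using Finset.induction_on with
    | empty => intro a ha; simp at ha
    | insert k s hk ih =>
      intro a ha
      rw [Finset.sum_insert hk] at ha
      rcases hN (a k) with h1 | h1
      · exact ⟨k, Finset.mem_insert_self _ _, h1⟩
      · have h2 : 1 - a k = ∑ j ∈ s, a j := by rw [← ha]; abel
        rw [h2] at h1
        obtain ⟨u, hu⟩ := h1
        obtain ⟨j, hj, hja⟩ := ih (fun j => (↑u⁻¹ : Module.End A N) * a j) (by
          rw [← Finset.mul_sum, ← hu, Units.inv_mul])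
        exact ⟨j, Finset.mem_insert_of_mem hj, by simpa using hja⟩
  obtain ⟨k, -, ⟨u, hu⟩⟩ := key Finset.univ (fun k => p ∘ₗ e k ∘ₗ i) (by
    have h1 : ∑ k, p ∘ₗ e k ∘ₗ i = p ∘ₗ (∑ k, e k) ∘ₗ i := by
      ext w; simp [LinearMap.sum_apply]
    rw [h1, he.complete]
    exact hp)
  refine ⟨k, (LinearMap.rangeRestrict (e k)) ∘ₗ i,
    (↑u⁻¹ : Module.End A N) ∘ₗ p ∘ₗ (LinearMap.range (e k)).subtype, ?_⟩
  have h1 : (↑u⁻¹ : Module.End A N) * ↑u = 1 := Units.inv_mul u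
  rw [hu] at h1
  exact h1

theorem nonempty_equiv_of_isSummand [Nontrivial N] (h : IsSummand A N M)
    (hM : ∀ f : Module.End A M, f * f = f → f = 0 ∨ f = 1) : Nonempty (N ≃ₗ[A] M) := by
  obtain ⟨i, p, hp⟩ := h
  have hp' : ∀ w, p (i w) = w := LinearMap.congr_fun hp
  rcases hM (i ∘ₗ p) (by ext w; simp [hp']) with h1 | h1
  · exfalso
    obtain ⟨w, hw⟩ := exists_ne (0 : N)
    apply hw
    have := LinearMap.congr_fun h1 (i w)
    simp only [LinearMap.comp_apply, hp', LinearMap.zero_apply] at this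
    rw [← hp' w, this, map_zero]
  · exact ⟨LinearEquiv.ofLinearMap i p h1 hp⟩

/-- An idempotent endomorphism f of the image of e extends to the idempotent f ∘ e of the corner of
e, where `eq_zero_or_eq` applies. -/
theorem IsPrimitiveMod.range_idempotents {T : Type*} [CommRing T] [IsLocalRing T]
    [Algebra T (Module.End A M)]
    [IsHausdorff (IsLocalRing.maximalIdeal T) (Module.End A M)] {e : Module.End A M}
    (he : e * e = e) (h : IsPrimitiveMod (IsLocalRing.maximalIdeal T) e)
    (f : Module.End A (LinearMap.range e)) (hf : f * f = f) : f = 0 ∨ f = 1 := by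
  have hew : ∀ w : LinearMap.range e, e w = w := by
    rintro ⟨_, w, rfl⟩; exact LinearMap.congr_fun he w
  let g : Module.End A M := (LinearMap.range e).subtype ∘ₗ f ∘ₗ LinearMap.rangeRestrict e
  have hg : ∀ w : LinearMap.range e, g w = f w := by
    intro w
    have : LinearMap.rangeRestrict e w = w := Subtype.ext (hew w)
    simp [g, this]
  have hge : ∀ w, g w = f (LinearMap.rangeRestrict e w) := fun w => rfl
  rcases h.eq_zero_or_eq (f := g) he (by
      ext w
      rw [Module.End.mul_apply, hge w, hg]
      exact congrArg Subtype.val (LinearMap.congr_fun hf _))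
    (by ext w; exact hew _)
    (by
      ext w
      rw [Module.End.mul_apply, hge, hge]
      congr 2
      exact Subtype.ext (LinearMap.congr_fun he w)) with h1 | h1
  · left
    ext w
    rw [← hg, h1]; rfl
  · right
    ext w
    rw [← hg, h1, hew]; rfl

end Summand

end SurfaceCM

namespace SurfaceCM

open Ser

/-! ### Ranks over domains -/

section Rank

variable {R H : Type*} [CommRing R] [IsDomain R] [AddCommGroup H] [Module R H]

theorem exists_smul_eq_zero_of_fg [Module.Finite R H] (h : ∀ z : H, ∃ a : R, a ≠ 0 ∧ a • z = 0) :
    ∃ f : R, f ≠ 0 ∧ ∀ z : H, f • z = 0 := by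
  classical
  obtain ⟨s, hs⟩ := Module.Finite.fg_top (R := R) (M := H)
  choose a ha haz using h
  refine ⟨∏ z ∈ s, a z, Finset.prod_ne_zero_iff.2 fun z _ => ha z, fun z => ?_⟩
  have hz : z ∈ Submodule.span R (s : Set H) := by rw [hs]; trivial
  induction hz using Submodule.span_induction with
  | mem z hz =>
    obtain ⟨c, hc⟩ := Finset.dvd_prod_of_mem a hz
    rw [hc, mul_comm, mul_smul, haz, smul_zero]
  | zero => rw [smul_zero]
  | add u v _ _ hu hv => rw [smul_add, hu, hv, add_zero]
  | smul t z _ hz => rw [smul_comm, hz, smul_zero]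

/-- A finitely generated module over a domain is generically free. -/
theorem exists_linearIndependent_smul_mem_span [Module.Finite R H] :
    ∃ (m : Fin (Module.finrank R H) → H) (f : R), LinearIndependent R m ∧ f ≠ 0 ∧
      ∀ z : H, f • z ∈ Submodule.span R (Set.range m) := by
  obtain ⟨m, hm⟩ := exists_linearIndependent_of_le_finrank (R := R) (M := H) le_rfl
  let N := Submodule.span R (Set.range m)
  have h1 := rank_quotient_add_rank_of_isDomain N
  have h3 : Module.finrank R (H ⧸ N) = 0 := by
    have h2 : Module.rank R N = Module.rank R H := by
      have : Module.Finite R N := Module.Finite.span_of_finite R (Set.finite_range m)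
      rw [← Module.finrank_eq_rank R N, ← Module.finrank_eq_rank R H, finrank_span_eq_card hm,
        Fintype.card_fin]
    rw [h2, ← Module.finrank_eq_rank R H, ← Module.finrank_eq_rank R (H ⧸ N)] at h1
    have h4 : Module.finrank R (H ⧸ N) + Module.finrank R H = Module.finrank R H := by
      exact_mod_cast h1
    omega
  obtain ⟨f, hf, hfz⟩ := exists_smul_eq_zero_of_fg (Module.finrank_eq_zero_iff.1 h3)
  refine ⟨m, f, hm, hf, fun z => ?_⟩
  have := hfz (N.mkQ z)
  rwa [← map_smul, Submodule.mkQ_apply, Submodule.Quotient.mk_eq_zero] at this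

/-- The element s is a constant coefficient of an equation of a over S. As long as that coefficient
vanishes in A, the factor X is removed from the equation, which is allowed in a domain; this stops
because the equation is monic. -/
theorem exists_algebraMap_mul_of_finite {S A : Type*} [CommRing S] [CommRing A] [IsDomain A]
    [Algebra S A] [Module.Finite S A] {a : A} (ha : a ≠ 0) :
    ∃ (s : S) (b : A), algebraMap S A s = b * a ∧ algebraMap S A s ≠ 0 := by
  have hint : IsIntegral S a := Algebra.IsIntegral.isIntegral a
  obtain ⟨p, hp, hpa⟩ := hint
  have key : ∀ (n : ℕ) (p : Polynomial S), p.natDegree ≤ n → p.eval₂ (algebraMap S A) a = 0 →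
      p.map (algebraMap S A) ≠ 0 →
      ∃ (s : S) (b : A), algebraMap S A s = b * a ∧ algebraMap S A s ≠ 0 := by
    intro n
    induction n with
    | zero =>
      intro p hp h0 hne
      rw [Polynomial.eq_C_of_natDegree_le_zero hp] at h0 hne
      simp only [Polynomial.eval₂_C] at h0
      simp [h0] at hne
    | succ n ih =>
      intro p hp h0 hne
      by_cases hc : algebraMap S A (p.coeff 0) = 0
      · have h1 := Polynomial.divX_mul_X_add p
        rw [← h1] at h0 hne
        simp only [Polynomial.eval₂_add, Polynomial.eval₂_mul, Polynomial.eval₂_X,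
          Polynomial.eval₂_C, hc, add_zero, mul_eq_zero, ha, or_false] at h0
        refine ih p.divX (by rw [Polynomial.natDegree_divX_eq_natDegree_tsub_one]; omega) h0 ?_
        intro h2
        apply hne
        simp [h2, hc]
      · refine ⟨p.coeff 0, -(p.divX.eval₂ (algebraMap S A) a), ?_, hc⟩
        have h1 := Polynomial.divX_mul_X_add p
        rw [← h1] at h0
        simp only [Polynomial.eval₂_add, Polynomial.eval₂_mul, Polynomial.eval₂_X,
          Polynomial.eval₂_C] at h0
        rw [neg_mul, ← sub_eq_zero, sub_neg_eq_add, add_comm, h0]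
  exact key _ p le_rfl hpa (hp.map _).ne_zero

theorem finrank_fin_fun_of_isDomain (S A : Type*) [CommRing S] [IsDomain S] [AddCommGroup A]
    [Module S A] [Module.Finite S A] (n : ℕ) : Module.finrank S (Fin n → A) = n * Module.finrank S A := by
  let f := LocalizedModule.mkLinearMap (nonZeroDivisors S) A
  let Q := FractionRing S
  let AQ := LocalizedModule (nonZeroDivisors S) A
  let _ : Module Q AQ := inferInstanceAs (Module (Localization (nonZeroDivisors S)) AQ)
  have : IsScalarTower S Q AQ :=
    inferInstanceAs (IsScalarTower S (Localization (nonZeroDivisors S)) AQ)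
  have : Module.Finite Q AQ := Module.Finite.of_isLocalizedModule (nonZeroDivisors S) f
  have h1 := IsLocalizedModule.finrank_eq (nonZeroDivisors S) f le_rfl
  have h2 := IsLocalizedModule.finrank_eq (nonZeroDivisors S)
    (LinearMap.pi fun i : Fin n => f ∘ₗ LinearMap.proj i) le_rfl
  rw [← h1, ← h2, ← IsFractionRing.finrank_right_eq S Q AQ,
    ← IsFractionRing.finrank_right_eq S Q (Fin n → AQ), Module.finrank_pi_fintype]
  simp

/-- A free A-module of rank `finrank A M` embeds in M with torsion cokernel. Torsion over A is
torsion over S, since every nonzero element of A has a nonzero multiple coming from S. -/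
theorem finrank_eq_mul_of_finite {S A M : Type u} [CommRing S] [IsDomain S] [CommRing A]
    [IsDomain A] [Algebra S A] [Module.Finite S A] [AddCommGroup M] [Module A M] [Module S M]
    [IsScalarTower S A M] [Module.Finite A M] :
    Module.finrank S M = Module.finrank S A * Module.finrank A M := by
  obtain ⟨m, f, hm, hf, hz⟩ := exists_linearIndependent_smul_mem_span (R := A) (H := M)
  have : Module.Finite S M := Module.Finite.trans A M
  let φ : (Fin (Module.finrank A M) → A) →ₗ[S] M := (Fintype.linearCombination A m).restrictScalars S
  have hφ : Function.Injective φ := hm.fintypeLinearCombination_injective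
  have h1 := rank_quotient_add_rank_of_isDomain (LinearMap.range φ)
  obtain ⟨s, b, hsb, hs⟩ := exists_algebraMap_mul_of_finite (S := S) hf
  have hs0 : s ≠ 0 := by rintro rfl; exact hs (map_zero _)
  have h2 : Module.finrank S (M ⧸ LinearMap.range φ) = 0 := by
    rw [Module.finrank_eq_zero_iff]
    intro z
    obtain ⟨z, rfl⟩ := (LinearMap.range φ).mkQ_surjective z
    refine ⟨s, hs0, ?_⟩
    rw [← map_smul, Submodule.mkQ_apply, Submodule.Quotient.mk_eq_zero]
    have h3 : f • b • z ∈ Submodule.span A (Set.range m) := hz _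
    rw [← Fintype.range_linearCombination] at h3
    obtain ⟨w, hw⟩ := h3
    refine ⟨w, ?_⟩
    rw [← algebraMap_smul A s z, hsb, mul_comm, mul_smul]
    exact hw
  have h4 : Module.finrank S (LinearMap.range φ) = Module.finrank S A * Module.finrank A M := by
    rw [← (LinearEquiv.ofInjective φ hφ).finrank_eq]
    rw [finrank_fin_fun_of_isDomain, mul_comm]
  rw [← Module.finrank_eq_rank S M, ← Module.finrank_eq_rank S (M ⧸ _),
    ← Module.finrank_eq_rank S (LinearMap.range φ), h2, h4] at h1
  have h6 : 0 + Module.finrank S A * Module.finrank A M = Module.finrank S M := by exact_mod_cast h1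
  omega

end Rank

end SurfaceCM

namespace SurfaceCM

open Ser

/-! ### Decompositions of Cohen-Macaulay modules -/

section FinitelyMany

variable {A : Type u} [CommRing A]

theorem FinitelyManyIsoClasses.mono {P Q : ModuleCat.{u} A → Prop} (h : FinitelyManyIsoClasses Q)
    (hPQ : ∀ N, P N → Q N) : FinitelyManyIsoClasses P :=
  let ⟨S, hS, h⟩ := h
  ⟨S, hS, fun N hN => h N (hPQ N hN)⟩

theorem FinitelyManyIsoClasses.biUnion {ι : Type*} {s : Set ι} (hs : s.Finite)
    {P : ι → ModuleCat.{u} A → Prop} (h : ∀ i ∈ s, FinitelyManyIsoClasses (P i)) :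
    FinitelyManyIsoClasses fun N => ∃ i ∈ s, P i N := by
  choose! S hS h using h
  refine ⟨⋃ i ∈ s, S i, hs.biUnion hS, ?_⟩
  rintro N ⟨i, hi, hN⟩
  obtain ⟨M, hM, e⟩ := h i hi N hN
  exact ⟨M, Set.mem_biUnion hi hM, e⟩

theorem FinitelyManyIsoClasses.or {P Q : ModuleCat.{u} A → Prop} (hP : FinitelyManyIsoClasses P)
    (hQ : FinitelyManyIsoClasses Q) : FinitelyManyIsoClasses fun N => P N ∨ Q N := by
  obtain ⟨S, hS, hP⟩ := hP
  obtain ⟨S', hS', hQ⟩ := hQ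
  refine ⟨S ∪ S', hS.union hS', ?_⟩
  rintro N (hN | hN)
  · obtain ⟨M, hM, e⟩ := hP N hN
    exact ⟨M, Or.inl hM, e⟩
  · obtain ⟨M, hM, e⟩ := hQ N hN
    exact ⟨M, Or.inr hM, e⟩

end FinitelyMany

section CohenMacaulay

theorem IsRegularPair.of_isSummand {A N M : Type*} [CommRing A] [AddCommGroup N] [Module A N]
    [AddCommGroup M] [Module A M] {a b : A} (h : IsRegularPair M a b) (hN : IsSummand A N M) :
    IsRegularPair N a b := by
  obtain ⟨i, p, hp⟩ := hN
  have hp' : ∀ w, p (i w) = w := LinearMap.congr_fun hp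
  have hi : Function.Injective i := Function.LeftInverse.injective hp'
  refine ⟨fun u hu => hi ?_, fun u v huv => ?_⟩
  · rw [map_zero]
    exact h.1 _ (by rw [← map_smul, hu, map_zero])
  · obtain ⟨w, hw⟩ := h.2 (i u) (i v) (by rw [← map_smul, huv, map_smul])
    exact ⟨p w, by rw [← hp' u, hw, map_smul]⟩

variable {K A : Type u} [Field K] [CommRing A] [IsLocalRing A] [Algebra K A]
    [Algebra (Ser K) A] {M N : Type u} [AddCommGroup M] [Module A M] [AddCommGroup N] [Module A N]

theorem IsFiniteOverSer.isCohenMacaulay_of_isSummand (h : IsFiniteOverSer K A)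
    (hM : IsCohenMacaulay A M) (hN : IsSummand A N M) : IsCohenMacaulay A N := by
  have := hM.1
  have hN' := hN
  obtain ⟨i, p, hp⟩ := hN'
  have : Module.Finite A N :=
    Module.Finite.of_surjective p (Function.RightInverse.surjective (LinearMap.congr_fun hp))
  exact h.isCohenMacaulay_of_isRegularPair ((h.isRegularPair hM).of_isSummand hN)

theorem IsFiniteOverSer.isCohenMacaulay_congr (h : IsFiniteOverSer K A)
    (hM : IsCohenMacaulay A M) (e : N ≃ₗ[A] M) : IsCohenMacaulay A N :=
  h.isCohenMacaulay_of_isSummand hM (IsSummand.of_equiv e)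

theorem IsFiniteOverSer.finite_end (h : IsFiniteOverSer K A) (hM : IsCohenMacaulay A M)
    [Module (Ser K) M] [IsScalarTower (Ser K) A M] : Module.Finite (Ser K) (Module.End A M) := by
  obtain ⟨h1, h2⟩ := h.isCohenMacaulay_iff.1 hM
  let φ : Module.End A M →ₗ[Ser K] Module.End (Ser K) M :=
    { toFun := fun f => f.restrictScalars (Ser K)
      map_add' := fun _ _ => rfl
      map_smul' := fun _ _ => rfl }
  exact Module.Finite.of_injective φ (LinearMap.restrictScalars_injective _)

instance : IsDomain (Ser K) := NoZeroDivisors.to_isDomain _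

theorem IsFiniteOverSer.finrank_eq (h : IsFiniteOverSer K A) [Module (Ser K) M]
    [IsScalarTower (Ser K) A M] (hM : Module.Finite A M) :
    Module.finrank (Ser K) M = Module.finrank (Ser K) A * Module.finrank A M := by
  have := h.finite
  have := h.sing.isDomain
  exact finrank_eq_mul_of_finite

variable [IsAlgClosed K]

theorem IsFiniteOverSer.isUnit_or_isUnit_one_sub (h : IsFiniteOverSer K A)
    (hM : IsCohenMacaulay A M) (hM' : IsIndecomposable A M) (z : Module.End A M) :
    IsUnit z ∨ IsUnit (1 - z) := by
  let _ : Module (Ser K) M := Module.compHom M (algebraMap (Ser K) A)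
  have : IsScalarTower (Ser K) A M := ⟨fun s a w => by
    rw [Algebra.smul_def, mul_smul]; rfl⟩
  have := h.finite_end hM
  rw [isIndecomposable_iff] at hM'
  have := hM'.1
  exact isUnit_or_isUnit_one_sub_of_idempotents K _ hM'.2 z

theorem IsFiniteOverSer.exists_decomposition (h : IsFiniteOverSer K A)
    (hM : IsCohenMacaulay A M) :
    ∃ (k : ℕ) (e : Fin k → Module.End A M), CompleteOrthogonalIdempotents e ∧
      ∀ i, ∀ f : Module.End A (LinearMap.range (e i)), f * f = f → f = 0 ∨ f = 1 := by
  let _ : Module (Ser K) M := Module.compHom M (algebraMap (Ser K) A)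
  have : IsScalarTower (Ser K) A M := ⟨fun s a w => by
    rw [Algebra.smul_def, mul_smul]; rfl⟩
  have := h.finite_end hM
  obtain ⟨k, e, he, hp⟩ := exists_primitive_decomposition K (Module.End A M)
  have := isHausdorff_maximalIdeal K (Module.End A M)
  refine ⟨k, e, he, fun i f hf => ?_⟩
  have h1 := hp i
  rw [vars_eq_maximalIdeal] at h1
  exact h1.range_idempotents (he.idem i) f hf

/-- Krull-Schmidt: an indecomposable summand of `M` appears in every decomposition of `M` whose
members have only trivial idempotents. -/
theorem IsFiniteOverSer.exists_equiv_range (h : IsFiniteOverSer K A)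
    (hN : IsCohenMacaulay A N) (hN' : IsIndecomposable A N) (hNM : IsSummand A N M)
    {ι : Type*} [Fintype ι] {e : ι → Module.End A M} (he : CompleteOrthogonalIdempotents e)
    (hf : ∀ i, ∀ f : Module.End A (LinearMap.range (e i)), f * f = f → f = 0 ∨ f = 1) :
    ∃ i, Nonempty (N ≃ₗ[A] LinearMap.range (e i)) := by
  have := hN'.1
  obtain ⟨i, hi⟩ := exists_isSummand_range he (h.isUnit_or_isUnit_one_sub hN hN') hNM
  exact ⟨i, nonempty_equiv_of_isSummand hi (hf i)⟩

/-- By Krull-Schmidt only the members of one fixed decomposition occur. This disposes of the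
finitely many exceptional modules in all later arguments. -/
theorem IsFiniteOverSer.finitelyMany_summands (h : IsFiniteOverSer K A)
    (hM : IsCohenMacaulay A M) :
    FinitelyManyIsoClasses fun N : ModuleCat.{u} A => IsIndecomposableCM A N ∧ IsSummand A N M := by
  obtain ⟨k, e, he, hf⟩ := h.exists_decomposition hM
  refine ⟨Set.range fun i => ModuleCat.of A (LinearMap.range (e i)), Set.finite_range _, ?_⟩
  rintro N ⟨⟨h1, h2⟩, h3⟩
  obtain ⟨i, hi⟩ := h.exists_equiv_range h1 h2 h3 he hf
  exact ⟨_, ⟨i, rfl⟩, hi⟩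

end CohenMacaulay

end SurfaceCM

namespace SurfaceCM

/-! ### Points of affine curves -/

section Points

variable {K R : Type*} [Field K] [CommRing R] [Algebra K R]

theorem isMaximal_ker_point (c : R →ₐ[K] K) : (RingHom.ker c).IsMaximal :=
  RingHom.ker_isMaximal_of_surjective c fun k => ⟨algebraMap K R k, by simp⟩

theorem point_ext {c c' : R →ₐ[K] K} (h : ∀ r, c r = 0 → c' r = 0) : c = c' := by
  ext r
  have := h (r - algebraMap K R (c r)) (by simp)
  rw [map_sub, AlgHom.commutes, sub_eq_zero] at this
  exact this.symm

/-- In dimension at most one the kernel of a point killing f ≠ 0 is a minimal prime over (f), and a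
noetherian ring has finitely many of these. -/
theorem finite_points [Algebra.FiniteType K R] [IsDomain R] (hR : ringKrullDim R ≤ 1) {f : R}
    (hf : f ≠ 0) :
    {c : R →ₐ[K] K | c f = 0}.Finite := by
  have : IsNoetherianRing R := Algebra.FiniteType.isNoetherianRing K R
  have h1 := Ideal.finite_minimalPrimes_of_isNoetherianRing R (Ideal.span {f})
  refine Set.Finite.of_finite_image (f := fun c : R →ₐ[K] K => RingHom.ker c) (h1.subset ?_) ?_
  · rintro _ ⟨c, hc, rfl⟩
    have := isMaximal_ker_point c
    refine ⟨⟨inferInstance, by rw [Ideal.span_singleton_le_iff_mem]; exact hc⟩, ?_⟩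
    rintro q ⟨hq, hfq⟩ hqc
    rw [Ideal.span_singleton_le_iff_mem] at hfq
    have hq0 : q ≠ ⊥ := fun h => hf (by rwa [h] at hfq)
    by_contra hlt
    have hlt' : q < RingHom.ker c := lt_of_le_not_ge hqc hlt
    have h2 := Ideal.height_add_one_le_of_lt_of_isPrime (bot_lt_iff_ne_bot.2 hq0)
    have h3 := Ideal.height_add_one_le_of_lt_of_isPrime hlt'
    have h4 : (2 : WithBot ℕ∞) ≤ ringKrullDim R := by
      refine le_trans ?_ (Ideal.height_le_ringKrullDim_of_isPrime (I := RingHom.ker c))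
      have h5 : (2 : ℕ∞) ≤ (RingHom.ker c).height := by
        refine le_trans ?_ h3
        rw [← one_add_one_eq_two]
        exact add_le_add_left (le_trans (by simp) h2) 1
      exact WithBot.coe_le_coe.2 h5
    exact absurd (h4.trans hR) (by decide)
  · intro c _ c' _ h
    exact point_ext fun r hr => (SetLike.ext_iff.1 h r).1 hr

variable [IsAlgClosed K]

theorem exists_point_of_isMaximal [Algebra.FiniteType K R] (m : Ideal R) [m.IsMaximal] :
    ∃ c : R →ₐ[K] K, RingHom.ker c = m := by
  let _ : Field (R ⧸ m) := Ideal.Quotient.field m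
  have : Module.Finite K (R ⧸ m) := finite_of_finite_type_of_isJacobsonRing K (R ⧸ m)
  have hb := IsAlgClosed.algebraMap_bijective_of_isIntegral (k := K) (K := R ⧸ m)
  let e : K ≃ₐ[K] R ⧸ m := AlgEquiv.ofBijective (Algebra.ofId K (R ⧸ m)) hb
  refine ⟨(e.symm : R ⧸ m →ₐ[K] K).comp (Ideal.Quotient.mkₐ K m), ?_⟩
  ext r
  rw [RingHom.mem_ker, AlgHom.comp_apply, ← Ideal.Quotient.eq_zero_iff_mem]
  exact map_eq_zero_iff _ e.symm.injective

/-- This is lying over away from the zeros of f, as R' is integral over R only up to powers of f. If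
ker c generated the unit ideal of R', clearing those powers would put a power of f into a prime of
the integral closure lying over ker c. -/
theorem exists_lift_point {R' : Type*} [CommRing R'] [Algebra K R'] [Algebra R R']
    [IsScalarTower K R R'] [Algebra.FiniteType K R'] (hinj : Function.Injective (algebraMap R R'))
    {f : R} (hint : ∀ z : R', ∃ n : ℕ, IsIntegral R (algebraMap R R' f ^ n * z)) (c : R →ₐ[K] K) (hc : c f ≠ 0) :
    ∃ c' : R' →ₐ[K] K, ∀ r, c' (algebraMap R R' r) = c r := by
  have := isMaximal_ker_point c
  have h1 : (RingHom.ker c).map (algebraMap R R') ≠ ⊤ := by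
    intro htop
    obtain ⟨Q, hQ, hQc⟩ := Ideal.exists_ideal_over_maximal_of_isIntegral
      (S := integralClosure R R') (RingHom.ker c) (by
        rw [(RingHom.injective_iff_ker_eq_bot _).1 (fun a b hab => hinj (congrArg Subtype.val hab))]
        exact bot_le)
    have key : ∀ w ∈ (RingHom.ker c).map (algebraMap R R'),
        ∃ n : ℕ, ∃ d ∈ Q, algebraMap R R' f ^ n * w = (d : R') := by
      intro w hw
      refine Submodule.span_induction (p := fun w _ =>
        ∃ n : ℕ, ∃ d ∈ Q, algebraMap R R' f ^ n * w = (d : R')) ?_ ?_ ?_ ?_ hw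
      · rintro _ ⟨r, hr, rfl⟩
        refine ⟨0, algebraMap R _ r, ?_, by simp⟩
        rw [← Ideal.mem_comap, hQc]
        exact hr
      · exact ⟨0, 0, Q.zero_mem, by simp⟩
      · rintro u v - - ⟨n, d, hd, h⟩ ⟨n', d', hd', h'⟩
        refine ⟨n + n', algebraMap R _ f ^ n' * d + algebraMap R _ f ^ n * d',
          Q.add_mem (Q.mul_mem_left _ hd) (Q.mul_mem_left _ hd'), ?_⟩
        have e1 : ((algebraMap R (integralClosure R R') f : integralClosure R R') : R') =
          algebraMap R R' f := rfl
        rw [Subalgebra.coe_add, Subalgebra.coe_mul, Subalgebra.coe_mul, Subalgebra.coe_pow,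
          Subalgebra.coe_pow, ← h, ← h', e1]
        ring
      · rintro z w - ⟨n, d, hd, h⟩
        obtain ⟨n', hn'⟩ := hint z
        refine ⟨n' + n, ⟨_, hn'⟩ * d, Q.mul_mem_left _ hd, ?_⟩
        rw [Subalgebra.coe_mul, ← h, smul_eq_mul]
        ring
    obtain ⟨n, d, hd, h⟩ := key 1 (by rw [htop]; trivial)
    have h2 : (algebraMap R (integralClosure R R') f) ^ n ∈ Q := by
      convert hd
      ext
      rw [← h, mul_one]; rfl
    have h3 := hQ.isPrime.mem_of_pow_mem _ h2
    rw [← Ideal.mem_comap, hQc] at h3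
    exact hc h3
  obtain ⟨m, hm, hle⟩ := Ideal.exists_le_maximal _ h1
  obtain ⟨c', rfl⟩ := exists_point_of_isMaximal (K := K) m
  refine ⟨c', fun r => ?_⟩
  have h2 : c = c'.comp (IsScalarTower.toAlgHom K R R') :=
    point_ext fun r hr => hle (Ideal.mem_map_of_mem _ hr)
  rw [h2]; rfl

variable [Algebra.FiniteType K R]

theorem eq_zero_of_forall_point [IsDomain R] {f r : R} (hf : f ≠ 0)
    (h : ∀ c : R →ₐ[K] K, c f ≠ 0 → c r = 0) : r = 0 := by
  have : IsJacobsonRing R := isJacobsonRing_of_finiteType (A := K)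
  have h1 : f * r ∈ (⊥ : Ideal R).jacobson := by
    rw [Ideal.jacobson, Submodule.mem_sInf]
    rintro m ⟨-, hm⟩
    obtain ⟨c, rfl⟩ := exists_point_of_isMaximal (K := K) m
    rw [RingHom.mem_ker, map_mul]
    by_cases hc : c f = 0
    · rw [hc, zero_mul]
    · rw [h c hc, mul_zero]
  rw [(isJacobsonRing_iff.1 this) ⊥ Ideal.isPrime_bot.isRadical] at h1
  exact (mul_eq_zero.1 h1).resolve_left hf

theorem exists_point_ne_zero [IsDomain R] {f : R} (hf : f ≠ 0) : ∃ c : R →ₐ[K] K, c f ≠ 0 := by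
  by_contra! h
  exact hf (eq_zero_of_forall_point (K := K) one_ne_zero fun c _ => h c)

end Points

end SurfaceCM

namespace SurfaceCM

/-! ### Smooth curves in algebraic extensions -/

section Curves

/-- The function field is formally smooth over a perfect field, so R is smooth at its generic point,
and smoothness spreads to a neighbourhood. -/
theorem exists_notMem_smooth_of_perfectField (K R : Type u) [Field K] [PerfectField K] [CommRing R]
    [IsDomain R] [Algebra K R] [Algebra.FiniteType K R] :
    ∃ h : R, h ≠ 0 ∧ Algebra.Smooth K (Localization.Away h) := by
  have : Algebra.FinitePresentation K R := (Algebra.FinitePresentation.of_finiteType).1 inferInstance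
  let L := Localization.AtPrime (⊥ : Ideal R)
  have hL : IsFractionRing R L := by
    have h1 : (⊥ : Ideal R).primeCompl = nonZeroDivisors R := by
      ext r; simp [Ideal.primeCompl, mem_nonZeroDivisors_iff_ne_zero]
    have h2 : ∀ (M : Submonoid R), (⊥ : Ideal R).primeCompl = M → IsLocalization M L := by
      rintro _ rfl; exact inferInstanceAs (IsLocalization (⊥ : Ideal R).primeCompl _)
    exact h2 _ h1
  let _ : Field L := IsFractionRing.toField R
  have h3 : Algebra.EssFiniteType R L := .of_isLocalization _ (nonZeroDivisors R)
  have h4 : Algebra.EssFiniteType K L := .comp _ R _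
  have : Algebra.IsSmoothAt K (⊥ : Ideal R) := Algebra.FormallySmooth.of_perfectField (K := K) (L := L)
  obtain ⟨h, hh, hs⟩ := Algebra.IsSmoothAt.exists_notMem_smooth K (⊥ : Ideal R)
  exact ⟨h, by simpa using hh, hs⟩

theorem smooth_away_of_dvd (K R : Type u) [Field K] [CommRing R]
    [Algebra K R] [Algebra.FiniteType K R] {f h : R} (hfh : h ∣ f)
    (hs : Algebra.Smooth K (Localization.Away h)) : Algebra.Smooth K (Localization.Away f) := by
  have : Algebra.FinitePresentation K R := (Algebra.FinitePresentation.of_finiteType).1 inferInstance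
  rw [← Algebra.basicOpen_subset_smoothLocus_iff_smooth] at hs ⊢
  refine subset_trans ?_ hs
  obtain ⟨c, rfl⟩ := hfh
  exact PrimeSpectrum.basicOpen_mul_le_left h c

variable {K R F : Type u} [Field K] [CommRing R] [Algebra K R] [Field F]
  [Algebra K F] [Algebra R F] [IsScalarTower K R F] [Algebra.IsAlgebraic R F]

theorem exists_mul_eq_algebraMap (R' : Subalgebra R F) {h : R'} (hh : h ≠ 0) :
    ∃ (r : R) (h' : R'), r ≠ 0 ∧ h * h' = algebraMap R R' r := by
  have halg : IsAlgebraic R (h : F) := Algebra.IsAlgebraic.isAlgebraic _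
  have h1 : IsAlgebraic R h := by
    obtain ⟨p, hp, hpz⟩ := halg
    refine ⟨p, hp, Subtype.ext ?_⟩
    refine Eq.trans ?_ hpz
    exact (Polynomial.aeval_algHom_apply R'.val h p).symm
  obtain ⟨r, hr, h', hd⟩ := h1.exists_nonzero_dvd (mem_nonZeroDivisors_of_ne_zero hh)
  exact ⟨r, h', hr, hd.symm⟩

variable [IsDomain R]

theorem exists_isIntegral_mul_of_mem_adjoin (W : Finset F) :
    ∃ f : R, f ≠ 0 ∧ ∀ z ∈ Algebra.adjoin R (W : Set F), ∃ n : ℕ,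
      IsIntegral R (algebraMap R F f ^ n * z) := by
  classical
  have h1 : ∀ w : F, ∃ f : R, f ≠ 0 ∧ IsIntegral R (algebraMap R F f * w) := fun w => by
    obtain ⟨f, hf, hi⟩ := (Algebra.IsAlgebraic.isAlgebraic (R := R) w).exists_integral_multiple
    exact ⟨f, hf, by rwa [← Algebra.smul_def]⟩
  choose g hg hgi using h1
  refine ⟨∏ w ∈ W, g w, Finset.prod_ne_zero_iff.2 fun w _ => hg w, fun z hz => ?_⟩
  set f := ∏ w ∈ W, g w
  induction hz using Algebra.adjoin_induction with
  | mem w hw =>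
    refine ⟨1, ?_⟩
    obtain ⟨c, hc⟩ := Finset.dvd_prod_of_mem g hw
    rw [pow_one, show f = g w * c from hc, map_mul, mul_comm (algebraMap R F (g w)), mul_assoc]
    exact isIntegral_algebraMap.mul (hgi w)
  | algebraMap r => exact ⟨0, by simpa using isIntegral_algebraMap⟩
  | add u v _ _ hu hv =>
    obtain ⟨n, hn⟩ := hu
    obtain ⟨m, hm⟩ := hv
    refine ⟨n + m, ?_⟩
    have : algebraMap R F f ^ (n + m) * (u + v) =
      algebraMap R F f ^ m * (algebraMap R F f ^ n * u) +
        algebraMap R F f ^ n * (algebraMap R F f ^ m * v) := by ring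
    rw [this]
    exact ((isIntegral_algebraMap.pow m).mul hn).add ((isIntegral_algebraMap.pow n).mul hm)
  | mul u v _ _ hu hv =>
    obtain ⟨n, hn⟩ := hu
    obtain ⟨m, hm⟩ := hv
    refine ⟨n + m, ?_⟩
    have : algebraMap R F f ^ (n + m) * (u * v) =
      (algebraMap R F f ^ n * u) * (algebraMap R F f ^ m * v) := by ring
    rw [this]
    exact hn.mul hm

variable [FaithfulSMul R F]

variable [IsAlgClosed K] [Algebra.FiniteType K R]

/-- A nonzero prime p of R' contains a nonzero element of R, so it contracts to the kernel of a
point c, with c(f) ≠ 0 as f is a unit in R'. Then R'/p is integral over K, hence a field. For the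
lower bound, the kernel of a point of R' over a point of R cannot be zero. -/
theorem ringKrullDim_eq_one_of_isIntegral_mul (hdim : ringKrullDim R = 1) {R' : Subalgebra R F}
    [Algebra.FiniteType K R'] {f : R} (hf : f ≠ 0) (hf' : IsUnit (algebraMap R R' f))
    (hint : ∀ z : R', ∃ n : ℕ, IsIntegral R (algebraMap R R' f ^ n * z)) :
    ringKrullDim R' = 1 := by
  have hinj : Function.Injective (algebraMap R R') := FaithfulSMul.algebraMap_injective _ _
  have hle : Ring.KrullDimLE 1 R' := by
    rw [Ring.krullDimLE_one_iff_of_noZeroDivisors]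
    intro p hp0 hp
    obtain ⟨h, hhp, hh0⟩ := Submodule.exists_mem_ne_zero_of_ne_bot hp0
    obtain ⟨r, h', hr, hrh⟩ := exists_mul_eq_algebraMap R' hh0
    have hrp : r ∈ p.comap (algebraMap R R') := by
      rw [Ideal.mem_comap, ← hrh]; exact p.mul_mem_right _ hhp
    have hR1 : Ring.KrullDimLE 1 R := by
      rw [Ring.krullDimLE_iff, hdim]; rfl
    have hmax : (p.comap (algebraMap R R')).IsMaximal :=
      (Ring.krullDimLE_one_iff_of_noZeroDivisors.1 hR1) _
        (fun h => hr (by rwa [h] at hrp)) inferInstance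
    obtain ⟨c, hc⟩ := exists_point_of_isMaximal (K := K) (p.comap (algebraMap R R'))
    have hint' : Algebra.IsIntegral K (R' ⧸ p) := by
      refine ⟨fun z => ?_⟩
      have hmk : ∀ r : R, Ideal.Quotient.mk p (algebraMap R R' r) = algebraMap K (R' ⧸ p) (c r) := by
        intro r
        change _ = Ideal.Quotient.mk p (algebraMap K R' (c r))
        rw [Ideal.Quotient.eq, IsScalarTower.algebraMap_apply K R R', ← map_sub, ← Ideal.mem_comap,
          ← hc, RingHom.mem_ker, map_sub, AlgHom.commutes]
        simp
      obtain ⟨z, rfl⟩ := Ideal.Quotient.mk_surjective z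
      obtain ⟨n, q, hq, hqz⟩ := hint z
      have h1 : IsIntegral K (Ideal.Quotient.mk p (algebraMap R R' f ^ n * z)) := by
        refine ⟨q.map (c : R →+* K), hq.map _, ?_⟩
        have h2 : (algebraMap K (R' ⧸ p)).comp (c : R →+* K) =
            (Ideal.Quotient.mk p).comp (algebraMap R R') := by
          ext r; exact (hmk r).symm
        rw [Polynomial.eval₂_map, h2, ← Polynomial.hom_eval₂, hqz, map_zero]
      have hcf : c f ≠ 0 := by
        intro h
        have h3 : f ∈ p.comap (algebraMap R R') := by rw [← hc]; exact h
        exact hp.ne_top (Ideal.eq_top_of_isUnit_mem _ h3 hf')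
      rw [map_mul, map_pow, hmk] at h1
      have h4 : Ideal.Quotient.mk p z = algebraMap K (R' ⧸ p) ((c f)⁻¹ ^ n) *
          (algebraMap K (R' ⧸ p) (c f) ^ n * Ideal.Quotient.mk p z) := by
        rw [← mul_assoc, ← map_pow, ← map_mul, ← mul_pow, inv_mul_cancel₀ hcf, one_pow, map_one,
          one_mul]
      rw [h4]
      exact isIntegral_algebraMap.mul h1
    have := isField_of_isIntegral_of_isField' (R := K) (S := R' ⧸ p) (Field.toIsField K)
    exact Ideal.Quotient.maximal_of_isField _ this
  refine le_antisymm (by rw [Ring.krullDimLE_iff] at hle; exact hle) ?_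
  obtain ⟨c, hc⟩ := exists_point_ne_zero (K := K) hf
  obtain ⟨c', hc'⟩ := exists_lift_point hinj hint c hc
  have := isMaximal_ker_point c'
  have hne : RingHom.ker c' ≠ ⊥ := by
    intro h0
    have h1 : Function.Injective c := by
      intro r s hrs
      rw [← hc', ← hc'] at hrs
      exact hinj ((RingHom.injective_iff_ker_eq_bot (c' : R' →+* K)).2 h0 hrs)
    have h2 : IsField R := by
      have h3 : Function.Bijective c := ⟨h1, fun k => ⟨algebraMap K R k, by simp⟩⟩
      exact (RingEquiv.ofBijective c h3).toMulEquiv.isField (Field.toIsField K)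
    rw [ringKrullDim_eq_zero_of_isField h2] at hdim
    exact zero_ne_one hdim
  have h2 := Ideal.height_add_one_le_of_lt_of_isPrime (bot_lt_iff_ne_bot.2 hne)
  refine le_trans ?_ (Ideal.height_le_ringKrullDim_of_isPrime (I := RingHom.ker c'))
  exact WithBot.coe_le_coe.2 (le_trans (by simp) h2)

/-- Finitely many elements of an algebraic extension of the function field of a curve are regular
functions on a smooth curve which covers almost all points of the given curve. -/
theorem exists_smooth_curve (hdim : ringKrullDim R = 1) (W : Finset F) :
    ∃ (R' : Subalgebra R F) (f : R), (W : Set F) ⊆ R' ∧ Algebra.Smooth K R' ∧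
      ringKrullDim R' = 1 ∧ f ≠ 0 ∧ IsUnit (algebraMap R R' f) ∧
      ∀ c : R →ₐ[K] K, c f ≠ 0 → ∃ c' : R' →ₐ[K] K, ∀ r, c' (algebraMap R R' r) = c r := by
  let R₁ := Algebra.adjoin R (W : Set F)
  have : Algebra.FiniteType R R₁ := (Subalgebra.fg_iff_finiteType _).1 ⟨W, rfl⟩
  have hft : Algebra.FiniteType K R₁ := Algebra.FiniteType.trans (S := R) inferInstance inferInstance
  obtain ⟨h, hh, hsm⟩ := exists_notMem_smooth_of_perfectField K R₁
  obtain ⟨r, h', hr, hrh⟩ := exists_mul_eq_algebraMap R₁ hh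
  obtain ⟨g, hg, hgi⟩ := exists_isIntegral_mul_of_mem_adjoin (R := R) W
  -- Inverting g makes R[W] integral over R; inverting r, a multiple of h, makes it smooth. The
  -- required curve is the localization of R[W] at f, realized inside F.
  let f := g * r
  have hf : f ≠ 0 := mul_ne_zero hg hr
  let f₁ : R₁ := algebraMap R R₁ f
  have hsm' : Algebra.Smooth K (Localization.Away f₁) := by
    refine smooth_away_of_dvd K R₁ ⟨h' * algebraMap R R₁ g, ?_⟩ hsm
    rw [← mul_assoc, hrh, mul_comm, ← map_mul]
  have hu : ∀ z : Submonoid.powers f₁, IsUnit (R₁.val z) := by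
    rintro ⟨_, n, rfl⟩
    rw [map_pow]
    refine IsUnit.pow _ (IsUnit.mk0 _ ?_)
    exact (map_ne_zero_iff (algebraMap R F) (FaithfulSMul.algebraMap_injective R F)).2 hf
  let φ : Localization.Away f₁ →ₐ[R] F := IsLocalization.liftAlgHom (M := Submonoid.powers f₁) hu
  have hφ : ∀ z, φ (algebraMap R₁ _ z) = z := fun z => IsLocalization.lift_eq _ z
  have hφinj : Function.Injective φ := by
    refine (IsLocalization.lift_injective_iff _).2 fun x y => ?_
    have h1 : Function.Injective (algebraMap R₁ (Localization.Away f₁)) :=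
      IsLocalization.injective _ (powers_le_nonZeroDivisors_of_noZeroDivisors
        ((map_ne_zero_iff (algebraMap R R₁) (FaithfulSMul.algebraMap_injective R R₁)).2 hf))
    rw [h1.eq_iff]
    exact Subtype.val_injective.eq_iff.symm
  let e := AlgEquiv.ofInjective φ hφinj
  have hK : IsScalarTower K R φ.range := inferInstance
  have hsm'' : Algebra.Smooth K φ.range := Algebra.Smooth.of_equiv (e.restrictScalars K)
  have hunit : IsUnit (algebraMap R φ.range f) := by
    have h1 : IsUnit (algebraMap R₁ (Localization.Away f₁) f₁) :=
      IsLocalization.Away.algebraMap_isUnit f₁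
    have h2 := h1.map e
    rwa [show e (algebraMap R₁ (Localization.Away f₁) f₁) = algebraMap R φ.range f from
      Subtype.ext (hφ _)] at h2
  have hint : ∀ z : φ.range, ∃ n : ℕ, IsIntegral R (algebraMap R φ.range f ^ n * z) := by
    rintro ⟨_, z, rfl⟩
    obtain ⟨⟨a, ⟨_, m, rfl⟩⟩, hz⟩ := IsLocalization.surj (Submonoid.powers f₁) z
    obtain ⟨n, hn⟩ := hgi a a.2
    refine ⟨m + n, ?_⟩
    rw [← isIntegral_algHom_iff φ.range.val Subtype.val_injective]
    have h1 : φ.range.val (algebraMap R φ.range f ^ (m + n) * ⟨φ z, z, rfl⟩) =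
        algebraMap R F r ^ n * (algebraMap R F g ^ n * a) := by
      have h2 := congrArg φ hz
      rw [map_mul, hφ, hφ] at h2
      have h3 : ((f₁ ^ m : R₁) : F) = algebraMap R F f ^ m := rfl
      have h4 : φ z * ((f₁ ^ m : R₁) : F) = (a : F) := h2
      rw [h3] at h4
      have h5 : φ.range.val (algebraMap R φ.range f ^ (m + n) * ⟨φ z, z, rfl⟩) =
        algebraMap R F f ^ (m + n) * φ z := rfl
      rw [h5, ← h4, show f = g * r from rfl, map_mul]
      ring
    have h6 := ((isIntegral_algebraMap (R := R) (A := F) (x := r)).pow n).mul hn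
    rw [← h1] at h6
    exact h6
  have hft' : Algebra.FiniteType K φ.range := by
    have := hsm''.finitePresentation
    infer_instance
  refine ⟨φ.range, f, fun w hw => ⟨algebraMap R₁ _ ⟨w, Algebra.subset_adjoin hw⟩, hφ _⟩, hsm'',
    ringKrullDim_eq_one_of_isIntegral_mul (K := K) hdim hf hunit hint, hf, hunit,
    fun c hc => exists_lift_point (FaithfulSMul.algebraMap_injective _ _) hint c hc⟩

end Curves

end SurfaceCM

namespace SurfaceCM

/-! ### Normality of smooth curves -/

section Normal

/-- Integral closure commutes with smooth base change, so the integral closure of S in S ⊗ Frac P is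
S ⊗ P = S. This tensor product fills Frac S, because Frac S is algebraic over P and denominators can
therefore be taken from P. -/
theorem isIntegrallyClosed_of_etale (P S : Type u) [CommRing P] [IsDomain P] [IsIntegrallyClosed P]
    [CommRing S] [IsDomain S] [Algebra P S] [Algebra.Etale P S] : IsIntegrallyClosed S := by
  have hPS : Function.Injective (algebraMap P S) := FaithfulSMul.algebraMap_injective P S
  let Q := FractionRing P
  let L := FractionRing S
  have hPL : Function.Injective (algebraMap P L) := by
    rw [IsScalarTower.algebraMap_eq P S L]
    exact (IsFractionRing.injective S L).comp hPS
  let _ : Algebra Q L := (IsFractionRing.lift hPL).toAlgebra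
  have : IsScalarTower P Q L := IsScalarTower.of_algebraMap_eq fun p =>
    (IsFractionRing.lift_algebraMap hPL p).symm
  have h1 : Algebra.FormallyUnramified S L := .of_isLocalization (nonZeroDivisors S)
  have h2 : Algebra.FormallyUnramified P L := .comp P S L
  have h3 : Algebra.FormallyUnramified Q L := .of_restrictScalars P Q L
  have h4 : Algebra.EssFiniteType S L := .of_isLocalization _ (nonZeroDivisors S)
  have h5 : Algebra.EssFiniteType P L := .comp P S L
  have h6 : Algebra.EssFiniteType Q L := .of_comp P Q L
  have h7 : Module.Finite Q L := Algebra.FormallyUnramified.finite_of_free Q L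
  have h8 : Algebra.IsAlgebraic P L := (IsFractionRing.comap_isAlgebraic_iff (K := Q)).2 inferInstance
  let ψ : S ⊗[P] Q →ₐ[S] L := Algebra.TensorProduct.lift (Algebra.ofId S L)
    (IsScalarTower.toAlgHom P Q L) fun _ _ => mul_comm _ _
  have hψ : ∀ s q, ψ (s ⊗ₜ q) = algebraMap S L s * algebraMap Q L q := fun s q =>
    Algebra.TensorProduct.lift_tmul _ _ _ _ _
  have key : ∀ w : S ⊗[P] Q, ∃ (s : S) (p : P), p ≠ 0 ∧ p • w = s ⊗ₜ 1 := by
    intro w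
    induction w with
    | zero => exact ⟨0, 1, one_ne_zero, by simp⟩
    | tmul s q =>
      obtain ⟨a, b, hb, rfl⟩ := IsFractionRing.div_surjective (A := P) q
      have hb' : b ≠ 0 := nonZeroDivisors.ne_zero hb
      refine ⟨a • s, b, hb', ?_⟩
      have h9 : algebraMap P Q b ≠ 0 := (map_ne_zero_iff _ (IsFractionRing.injective P Q)).2 hb'
      rw [← TensorProduct.tmul_smul, Algebra.smul_def, mul_div_cancel₀ _ h9,
        TensorProduct.smul_tmul, Algebra.smul_def, mul_one]
    | add u v hu hv =>
      obtain ⟨s, p, hp, h⟩ := hu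
      obtain ⟨s', p', hp', h'⟩ := hv
      refine ⟨p' • s + p • s', p * p', mul_ne_zero hp hp', ?_⟩
      rw [smul_add, mul_smul, mul_smul, h', smul_comm, h, TensorProduct.add_tmul,
        TensorProduct.smul_tmul', TensorProduct.smul_tmul']
  have hinj : Function.Injective ψ := by
    rw [injective_iff_map_eq_zero]
    intro w hw
    obtain ⟨s, p, hp, h⟩ := key w
    have h9 : ψ (p • w) = 0 := by rw [← algebraMap_smul S p w, map_smul, hw, smul_zero]
    rw [h, hψ, map_one, mul_one, map_eq_zero_iff _ (IsFractionRing.injective S L)] at h9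
    rw [h9, TensorProduct.zero_tmul] at h
    have h10 : (1 : S) ⊗ₜ[P] ((algebraMap P Q p)⁻¹) * (p • w) = w := by
      have h9 : algebraMap P Q p ≠ 0 := (map_ne_zero_iff _ (IsFractionRing.injective P Q)).2 hp
      rw [mul_smul_comm, ← smul_mul_assoc, ← TensorProduct.tmul_smul, Algebra.smul_def,
        mul_inv_cancel₀ h9, ← Algebra.TensorProduct.one_def, one_mul]
    rw [← h10, h, mul_zero]
  rw [isIntegrallyClosed_iff L]
  intro z hz
  obtain ⟨a, b, hb, rfl⟩ := IsFractionRing.div_surjective (A := S) z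
  have hb' : b ≠ 0 := nonZeroDivisors.ne_zero hb
  have hba : IsAlgebraic P b := by
    have := Algebra.IsAlgebraic.isAlgebraic (R := P) (algebraMap S L b)
    exact (isAlgebraic_algebraMap_iff (IsFractionRing.injective S L)).1 this
  obtain ⟨p, hp, b', hbb⟩ := hba.exists_nonzero_dvd hb
  have hp' : algebraMap P L p ≠ 0 := (map_ne_zero_iff _ hPL).2 hp
  have hbL : algebraMap S L b ≠ 0 := (map_ne_zero_iff _ (IsFractionRing.injective S L)).2 hb'
  have h9 : algebraMap S L a / algebraMap S L b = ψ ((a * b') ⊗ₜ (algebraMap P Q p)⁻¹) := by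
    rw [hψ, map_inv₀, ← IsScalarTower.algebraMap_apply P Q L, div_eq_iff hbL, mul_right_comm,
      map_mul, mul_assoc (algebraMap S L a), mul_comm (algebraMap S L b'), ← map_mul, ← hbb,
      ← IsScalarTower.algebraMap_apply P S L, mul_assoc, mul_inv_cancel₀ hp', mul_one]
  rw [h9] at hz ⊢
  rw [isIntegral_algHom_iff ψ hinj] at hz
  obtain ⟨t, ht⟩ := (TensorProduct.toIntegralClosure_bijective_of_smooth (R := P) (S := S)
    (B := Q)).2 ⟨_, hz⟩
  have h10 : ∀ t : S ⊗[P] integralClosure P Q, ∃ s : S,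
      (TensorProduct.toIntegralClosure P S Q t : S ⊗[P] Q) = s ⊗ₜ 1 := by
    intro t
    induction t with
    | zero => exact ⟨0, by simp⟩
    | tmul s q =>
      obtain ⟨p, hp⟩ := (isIntegrallyClosed_iff Q).1 ‹IsIntegrallyClosed P› q.2
      refine ⟨p • s, ?_⟩
      have : (TensorProduct.toIntegralClosure P S Q (s ⊗ₜ q) : S ⊗[P] Q) = s ⊗ₜ (q : Q) := rfl
      rw [this, ← hp, TensorProduct.smul_tmul, Algebra.smul_def, mul_one]
    | add u v hu hv =>
      obtain ⟨s, h⟩ := hu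
      obtain ⟨s', h'⟩ := hv
      refine ⟨s + s', ?_⟩
      rw [map_add, Subalgebra.coe_add, h, h', TensorProduct.add_tmul]
  obtain ⟨s, hs⟩ := h10 t
  rw [ht] at hs
  refine ⟨s, ?_⟩
  have h11 := congrArg ψ hs
  rw [hψ s 1, map_one, mul_one] at h11
  exact h11.symm

/-- The ideal I of denominators of an integral element z contains, for each maximal ideal m, a power
of some f outside m, so I is not contained in m. -/
theorem isIntegrallyClosed_of_forall_away (S : Type u) [CommRing S] [IsDomain S]
    (h : ∀ m : Ideal S, m.IsMaximal → ∃ f ∉ m, IsIntegrallyClosed (Localization.Away f)) :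
    IsIntegrallyClosed S := by
  let L := FractionRing S
  rw [isIntegrallyClosed_iff L]
  intro z hz
  let I : Ideal S :=
    { carrier := {s | ∃ a, algebraMap S L s * z = algebraMap S L a}
      add_mem' := by
        rintro s t ⟨a, ha⟩ ⟨b, hb⟩
        exact ⟨a + b, by rw [map_add, add_mul, ha, hb, map_add]⟩
      zero_mem' := ⟨0, by simp⟩
      smul_mem' := by
        rintro c s ⟨a, ha⟩
        exact ⟨c * a, by rw [smul_eq_mul, map_mul, mul_assoc, ha, map_mul]⟩ }
  have hI : I = ⊤ := by
    by_contra hI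
    obtain ⟨m, hm, hIm⟩ := Ideal.exists_le_maximal I hI
    obtain ⟨f, hfm, hf⟩ := h m hm
    have hf0 : f ≠ 0 := fun h => hfm (h ▸ m.zero_mem)
    have hle := powers_le_nonZeroDivisors_of_noZeroDivisors hf0
    have : IsDomain (Localization.Away f) := IsLocalization.isDomain_localization hle
    have : ∀ y : Submonoid.powers f, IsUnit (algebraMap S L y) := fun y =>
      IsUnit.mk0 _ ((map_ne_zero_iff _ (IsFractionRing.injective S L)).2
        (nonZeroDivisors.ne_zero (hle y.2)))
    let _ : Algebra (Localization.Away f) L := (IsLocalization.lift this).toAlgebra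
    have : IsScalarTower S (Localization.Away f) L :=
      IsScalarTower.of_algebraMap_eq fun s => (IsLocalization.lift_eq _ s).symm
    have : IsFractionRing (Localization.Away f) L :=
      IsFractionRing.isFractionRing_of_isDomain_of_isLocalization (Submonoid.powers f) _ L
    obtain ⟨w, hw⟩ := (isIntegrallyClosed_iff L).1 hf hz.tower_top
    obtain ⟨⟨a, ⟨_, n, rfl⟩⟩, haw⟩ := IsLocalization.surj (Submonoid.powers f) w
    have h1 := congrArg (algebraMap (Localization.Away f) L) haw
    rw [map_mul, hw, ← IsScalarTower.algebraMap_apply, ← IsScalarTower.algebraMap_apply,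
      mul_comm] at h1
    exact hfm (hm.isPrime.mem_of_pow_mem n (hIm ⟨a, h1⟩))
  obtain ⟨a, ha⟩ : (1 : S) ∈ I := by rw [hI]; trivial
  exact ⟨a, by rw [← ha, map_one, one_mul]⟩

/-- Locally a smooth algebra is étale over a polynomial ring, which is integrally closed. -/
theorem isIntegrallyClosed_of_smooth (K R : Type u) [Field K] [CommRing R] [IsDomain R]
    [Algebra K R] [Algebra.Smooth K R] : IsIntegrallyClosed R := by
  refine isIntegrallyClosed_of_forall_away R fun m hm => ?_
  have : Algebra.IsSmoothAt K m := by
    have h1 : (⟨m, inferInstance⟩ : PrimeSpectrum R) ∈ Algebra.smoothLocus K R := by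
      rw [Algebra.smoothLocus_eq_univ]; trivial
    exact h1
  obtain ⟨f, hf, n, _, _, _⟩ :=
    Algebra.IsSmoothAt.exists_isStandardEtale_mvPolynomial (R := K) (p := m)
  have hf' : f ≠ 0 := fun h => hf (h ▸ m.zero_mem)
  refine ⟨f, hf, ?_⟩
  have : IsDomain (Localization.Away f) := IsLocalization.isDomain_localization
    (powers_le_nonZeroDivisors_of_noZeroDivisors hf')
  have : Algebra.Etale (MvPolynomial (Fin n) K) (Localization.Away f) := inferInstance
  exact isIntegrallyClosed_of_etale (MvPolynomial (Fin n) K) _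

/-- The maximal ideals of points are locally principal. -/
def IsLocallyPrincipal (K R : Type*) [Field K] [CommRing R] [Algebra K R] : Prop :=
  ∀ c : R →ₐ[K] K, ∃ π s : R, c π = 0 ∧ c s ≠ 0 ∧ ∀ r, c r = 0 → ∃ t, s * r = π * t

/-- For π in n but not in n², write (π) = nI. Then I is not contained in n, and any s in I outside n
satisfies s n ⊆ (π). -/
theorem isLocallyPrincipal_of_isDedekindDomain (K R : Type*) [Field K] [CommRing R] [Algebra K R]
    [IsDedekindDomain R] : IsLocallyPrincipal K R := by
  intro c
  have hmax := isMaximal_ker_point c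
  set n := RingHom.ker c with hn
  by_cases h0 : n = ⊥
  · refine ⟨0, 1, map_zero _, by simp, fun r hr => ⟨0, ?_⟩⟩
    have : r ∈ n := hr
    rw [h0, Ideal.mem_bot] at this
    rw [this]; ring
  · have hlt : n ^ 2 < n := by
      simpa using Ideal.pow_right_strictAnti n h0 hmax.ne_top (show 1 < 2 by norm_num)
    obtain ⟨π, hπ, hπ2⟩ := Set.exists_of_ssubset hlt
    obtain ⟨I, hI⟩ := Ideal.dvd_iff_le.2 ((Ideal.span_singleton_le_iff_mem _).2 hπ)
    have hIn : ¬ I ≤ n := by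
      intro hle
      apply hπ2
      have h1 : π ∈ n * I := by rw [← hI]; exact Ideal.mem_span_singleton_self π
      rw [pow_two]
      exact Ideal.mul_mono_right hle h1
    obtain ⟨s, hs, hsn⟩ := Set.not_subset.1 hIn
    refine ⟨π, s, hπ, hsn, fun r hr => ?_⟩
    have h2 : r * s ∈ Ideal.span {π} := by
      rw [hI]; exact Ideal.mul_mem_mul hr hs
    obtain ⟨t, ht⟩ := Ideal.mem_span_singleton.1 h2
    exact ⟨t, by rw [mul_comm, ht]⟩

theorem isDedekindDomain_of_smooth (K R : Type u) [Field K] [CommRing R] [IsDomain R]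
    [Algebra K R] [Algebra.Smooth K R] (hR : ringKrullDim R = 1) : IsDedekindDomain R := by
  have h1 := isIntegrallyClosed_of_smooth K R
  have h2 := (inferInstance : Algebra.Smooth K R).finitePresentation
  have h3 : IsNoetherianRing R := Algebra.FiniteType.isNoetherianRing K R
  have h4 : Ring.KrullDimLE 1 R := by rw [Ring.krullDimLE_iff, hR]; rfl
  have h5 : Ring.DimensionLEOne R :=
    ⟨fun {p} hp hp' => Ring.krullDimLE_one_iff_of_noZeroDivisors.1 h4 p hp hp'⟩
  exact { }

theorem isLocallyPrincipal_of_smooth (K R : Type u) [Field K] [CommRing R] [IsDomain R]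
    [Algebra K R] [Algebra.Smooth K R] (hR : ringKrullDim R = 1) : IsLocallyPrincipal K R :=
  have := isDedekindDomain_of_smooth K R hR
  isLocallyPrincipal_of_isDedekindDomain K R

end Normal

end SurfaceCM

namespace SurfaceCM

open Ser

/-! ### Kernels of linear maps over power series and specialization -/

section Kernel

variable {K R : Type*} [Field K] [CommRing R] {ι κ : Type*}

/-- The specialization of tuples of power series at a point. -/
noncomputable def specialize (c : R →+* K) (Z : ι → Ser R) : ι → Ser K :=
  fun i => MvPowerSeries.map c (Z i)

theorem specialize_add (c : R →+* K) (Z W : ι → Ser R) :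
    specialize c (Z + W) = specialize c Z + specialize c W := by
  funext i; exact map_add _ _ _

theorem specialize_sub (c : R →+* K) (Z W : ι → Ser R) :
    specialize c (Z - W) = specialize c Z - specialize c W := by
  funext i; exact map_sub _ _ _

theorem specialize_smul (c : R →+* K) (t : Ser R) (Z : ι → Ser R) :
    specialize c (t • Z) = MvPowerSeries.map c t • specialize c Z := by
  funext i; exact map_mul _ _ _

theorem smul_eq_C_smul (r : R) (Z : ι → Ser R) : r • Z = (MvPowerSeries.C r : Ser R) • Z := by
  funext i; exact MvPowerSeries.smul_eq_C_mul _ _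

theorem specialize_smul' (c : R →+* K) (r : R) (Z : ι → Ser R) :
    specialize c (r • Z) = c r • specialize c Z := by
  rw [smul_eq_C_smul, specialize_smul, MvPowerSeries.map_C]
  funext i
  exact (MvPowerSeries.smul_eq_C_mul _ _).symm

/-- One pair π, s serves all elements vanishing at c, hence all the infinitely many coefficients of
the series at once. -/
theorem exists_smul_eq_smul_of_specialize_eq_zero [Algebra K R] (c : R →ₐ[K] K) {π s : R}
    (hs : ∀ r, c r = 0 → ∃ t, s * r = π * t) {Z : ι → Ser R}
    (hZ : specialize (c : R →+* K) Z = 0) : ∃ W, s • Z = π • W := by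
  have h : ∀ i, ∃ w : Ser R, s • Z i = π • w := by
    intro i
    choose! t ht using hs
    refine ⟨fun n => t (MvPowerSeries.coeff n (Z i)), ?_⟩
    ext n
    have h1 : c (MvPowerSeries.coeff n (Z i)) = 0 := by
      have := congrArg (MvPowerSeries.coeff n) (congrFun hZ i)
      rw [specialize, MvPowerSeries.coeff_map] at this
      exact this
    exact ht _ h1
  choose W hW using h
  exact ⟨W, funext hW⟩

variable (L : (ι → Ser R) →ₗ[Ser R] (κ → Ser R))

theorem map_smul_of_linearMap (r : R) (Z : ι → Ser R) : L (r • Z) = r • L Z := by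
  rw [smul_eq_C_smul, map_smul, smul_eq_C_smul]

variable [IsDomain R]

/-- The elements that are R-torsion modulo the image of L form a submodule over the noetherian ring
R[[x,y]]. Finitely many generators have a common annihilator f. -/
theorem exists_smul_mem_range [IsNoetherianRing R] [Finite κ] : ∃ f : R, f ≠ 0 ∧ ∀ (r : R) (w : κ → Ser R), r ≠ 0 →
    r • w ∈ LinearMap.range L → f • w ∈ LinearMap.range L := by
  let N : Submodule (Ser R) (κ → Ser R) :=
    { carrier := {w | ∃ r : R, r ≠ 0 ∧ r • w ∈ LinearMap.range L}
      add_mem' := by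
        rintro v w ⟨r, hr, hv⟩ ⟨s, hs, hw⟩
        refine ⟨r * s, mul_ne_zero hr hs, ?_⟩
        rw [smul_add, mul_comm, mul_smul, mul_comm, mul_smul, smul_eq_C_smul s, smul_eq_C_smul r (s • w)]
        exact Submodule.add_mem _ (Submodule.smul_mem _ _ hv) (Submodule.smul_mem _ _ hw)
      zero_mem' := ⟨1, one_ne_zero, by rw [smul_zero]; exact Submodule.zero_mem _⟩
      smul_mem' := by
        rintro t w ⟨r, hr, hw⟩
        refine ⟨r, hr, ?_⟩
        rw [smul_comm]
        exact Submodule.smul_mem _ _ hw }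
  have hN : N.FG := IsNoetherian.noetherian N
  obtain ⟨S, hS⟩ := hN
  have h1 : ∀ w ∈ N, ∃ r : R, r ≠ 0 ∧ r • w ∈ LinearMap.range L := fun w hw => hw
  choose! g hg hgw using h1
  classical
  have hSN : ∀ w ∈ S, w ∈ N := fun w hw => by rw [← hS]; exact Submodule.subset_span hw
  refine ⟨∏ w ∈ S, g w, Finset.prod_ne_zero_iff.2 fun w hw => hg w (hSN w hw), fun r w hr hw => ?_⟩
  have hwN : w ∈ Submodule.span (Ser R) (S : Set (κ → Ser R)) := by rw [hS]; exact ⟨r, hr, hw⟩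
  clear hw
  induction hwN using Submodule.span_induction with
  | mem w hw =>
    obtain ⟨c, hc⟩ := Finset.dvd_prod_of_mem g hw
    rw [hc, mul_comm, mul_smul, smul_eq_C_smul c]
    exact Submodule.smul_mem _ _ (hgw w (hSN w hw))
  | zero => rw [smul_zero]; exact Submodule.zero_mem _
  | add u v _ _ hu hv => rw [smul_add]; exact Submodule.add_mem _ hu hv
  | smul t z _ hz => rw [smul_comm]; exact Submodule.smul_mem _ _ hz

/-- Almost everywhere on a curve, the kernel of the specialization of a linear map is the
specialization of its kernel. -/
theorem exists_forall_specialize_kernel [Algebra K R] [IsNoetherianRing R] [Finite κ]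
    (hR : IsLocallyPrincipal K R) :
    ∃ f : R, f ≠ 0 ∧ ∀ c : R →ₐ[K] K, c f ≠ 0 → ∀ Z : ι → Ser R,
      specialize (c : R →+* K) (L Z) = 0 → ∃ Z', L Z' = 0 ∧
        specialize (c : R →+* K) Z' = specialize (c : R →+* K) Z := by
  obtain ⟨f, hf, hfw⟩ := exists_smul_mem_range L
  refine ⟨f, hf, fun c hc Z hZ => ?_⟩
  obtain ⟨π, s, hπ, hs, hst⟩ := hR c
  obtain ⟨W, hW⟩ := exists_smul_eq_smul_of_specialize_eq_zero c hst hZ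
  -- As L Z vanishes at c, s L Z = π W, and W is R-torsion modulo the image of L if π ≠ 0, so that f
  -- W = L u. Then fsZ - πu is in the kernel, and dividing it by the constant c(fs) restores the
  -- value of Z at c.
  have h1 : ∃ u, (f * s) • L Z = π • L u := by
    by_cases hπ0 : π = 0
    · refine ⟨0, ?_⟩
      rw [mul_smul, hW, hπ0, zero_smul, zero_smul, smul_zero]
    · obtain ⟨u, hu⟩ := hfw π W hπ0 (by
        rw [← hW, ← map_smul_of_linearMap]; exact ⟨_, rfl⟩)
      exact ⟨u, by rw [hu, mul_smul, hW, smul_comm]⟩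
  obtain ⟨u, hu⟩ := h1
  refine ⟨algebraMap K R (c (f * s))⁻¹ • ((f * s) • Z - π • u), ?_, ?_⟩
  · rw [map_smul_of_linearMap, map_sub, map_smul_of_linearMap, map_smul_of_linearMap, hu, sub_self,
      smul_zero]
  · have h2 : c (f * s) ≠ 0 := by rw [map_mul]; exact mul_ne_zero hc hs
    have h3 : (c : R →+* K) π = 0 := hπ
    have h4 : (c : R →+* K) (algebraMap K R (c (f * s))⁻¹) = (c (f * s))⁻¹ := by
      exact c.commutes _
    rw [specialize_smul', specialize_sub, specialize_smul', specialize_smul', h3, zero_smul,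
      sub_zero, smul_smul, h4]
    rw [show (c : R →+* K) (f * s) = c (f * s) from rfl, inv_mul_cancel₀ h2, one_smul]

/-- An element of the kernel vanishing at c is a combination of kernel elements with coefficients
vanishing at c. From sZ = πW follows Z = (π/c(s)) W + (1 - s/c(s)) Z, where the second term makes it
unnecessary to invert s. -/
theorem exists_eq_add_of_specialize_eq_zero [Algebra K R] (hR : IsLocallyPrincipal K R) (c : R →ₐ[K] K)
    {Z : ι → Ser R} (hLZ : L Z = 0) (hZ : specialize (c : R →+* K) Z = 0) :
    ∃ (a b : R) (W : ι → Ser R), c a = 0 ∧ c b = 0 ∧ L W = 0 ∧ Z = a • W + b • Z := by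
  obtain ⟨π, s, hπ, hs, hst⟩ := hR c
  obtain ⟨W, hW⟩ := exists_smul_eq_smul_of_specialize_eq_zero c hst hZ
  have h1 : ∃ W, s • Z = π • W ∧ L W = 0 := by
    by_cases hπ0 : π = 0
    · refine ⟨0, ?_, map_zero _⟩
      rw [hW, hπ0, zero_smul, zero_smul]
    · refine ⟨W, hW, ?_⟩
      have h2 := map_smul_of_linearMap L s Z
      rw [hW, hLZ, smul_zero, map_smul_of_linearMap] at h2
      funext i
      have h3 := congrFun h2 i
      ext n
      have h4 := congrArg (MvPowerSeries.coeff n) h3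
      exact (mul_eq_zero.1 (show π * MvPowerSeries.coeff n (L W i) = 0 from h4)).resolve_left hπ0
  obtain ⟨W, hW, hLW⟩ := h1
  refine ⟨algebraMap K R (c s)⁻¹ * π, 1 - algebraMap K R (c s)⁻¹ * s, W, by rw [map_mul, hπ, mul_zero],
    ?_, hLW, ?_⟩
  · rw [map_sub, map_mul, AlgHom.commutes, map_one]
    simp [hs]
  · rw [mul_smul, ← hW, sub_smul, one_smul, mul_smul]; abel

end Kernel

end SurfaceCM

namespace SurfaceCM

open Ser

/-! ### Coverings of curves and spreading out -/

/-- Smooth connected affine curves. -/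
structure SmoothCurve (K : Type u) [Field K] where
  /-- the coordinate ring -/
  R : Type u
  [commRing : CommRing R]
  [algebra : Algebra K R]
  smooth : Algebra.Smooth K R
  isDomain : IsDomain R
  ringKrullDim_eq : ringKrullDim R = 1

namespace SmoothCurve

attribute [instance] commRing algebra smooth isDomain

variable {K : Type u} [Field K]

instance (C : SmoothCurve K) : Algebra.FiniteType K C.R :=
  have := C.smooth.finitePresentation
  inferInstance

instance (C : SmoothCurve K) : IsNoetherianRing C.R := Algebra.FiniteType.isNoetherianRing K C.R

/-- A morphism of curves whose image contains almost all points. -/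
structure Cover (C C' : SmoothCurve K) where
  /-- the comorphism -/
  hom : C.R →ₐ[K] C'.R
  finite : {c : C.R →ₐ[K] K | ¬ ∃ c' : C'.R →ₐ[K] K, c'.comp hom = c}.Finite

theorem Cover.finite_of_finite {C C' : SmoothCurve K} (φ : Cover C C') {P : (C'.R →ₐ[K] K) → Prop}
    (hP : {c' | ¬ P c'}.Finite) :
    {c : C.R →ₐ[K] K | ¬ ∃ c' : C'.R →ₐ[K] K, c'.comp φ.hom = c ∧ P c'}.Finite := by
  refine (φ.finite.union (hP.image fun c' => c'.comp φ.hom)).subset ?_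
  intro c hc
  by_cases h : ∃ c' : C'.R →ₐ[K] K, c'.comp φ.hom = c
  · obtain ⟨c', rfl⟩ := h
    exact Or.inr ⟨c', fun hp => hc ⟨c', rfl, hp⟩, rfl⟩
  · exact Or.inl h

theorem finite_zeros (C : SmoothCurve K) {f : C.R} (hf : f ≠ 0) :
    {c : C.R →ₐ[K] K | ¬ c f ≠ 0}.Finite := by
  have := finite_points (K := K) C.ringKrullDim_eq.le hf
  simpa using this

variable [IsAlgClosed K]

/-- An algebraic closure of the field of functions. -/
abbrev FunctionField (C : SmoothCurve K) : Type u := AlgebraicClosure (FractionRing C.R)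

theorem exists_cover (C : SmoothCurve K) (W : Finset C.FunctionField) :
    ∃ (C' : SmoothCurve K) (φ : Cover C C') (ι : C'.R →ₐ[K] C.FunctionField),
      Function.Injective ι ∧ (∀ r, ι (φ.hom r) = algebraMap C.R _ r) ∧
      ∀ w ∈ W, ∃ r, ι r = w := by
  have h1 : FaithfulSMul C.R C.FunctionField := by
    rw [faithfulSMul_iff_algebraMap_injective,
      IsScalarTower.algebraMap_eq C.R (FractionRing C.R) C.FunctionField]
    exact (algebraMap (FractionRing C.R) C.FunctionField).injective.comp
      (IsFractionRing.injective _ _)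
  have h2 : Algebra.IsAlgebraic C.R C.FunctionField :=
    (IsFractionRing.comap_isAlgebraic_iff (K := FractionRing C.R)).2 inferInstance
  obtain ⟨R', f, hW, hs, hd, hf, hu, hc⟩ := exists_smooth_curve (K := K) C.ringKrullDim_eq W
  refine ⟨⟨R', hs, inferInstance, hd⟩, ⟨IsScalarTower.toAlgHom K C.R R', ?_⟩,
    (R'.val).restrictScalars K, Subtype.val_injective, fun r => rfl, fun w hw => ⟨⟨w, hW hw⟩, rfl⟩⟩
  refine (C.finite_zeros hf).subset ?_
  rintro c hc' hcf
  obtain ⟨c', h⟩ := hc c hcf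
  exact hc' ⟨c', AlgHom.ext h⟩

theorem exists_cover_isUnit (C : SmoothCurve K) {f : C.R} (hf : f ≠ 0) :
    ∃ (C' : SmoothCurve K) (φ : Cover C C'), IsUnit (φ.hom f) := by
  obtain ⟨C', φ, ι, hι, hφ, hW⟩ := C.exists_cover {(algebraMap C.R _ f)⁻¹}
  refine ⟨C', φ, ?_⟩
  obtain ⟨g, hg⟩ := hW _ (Finset.mem_singleton_self _)
  have hf' : algebraMap C.R C.FunctionField f ≠ 0 := by
    rw [IsScalarTower.algebraMap_apply C.R (FractionRing C.R) C.FunctionField]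
    exact (map_ne_zero _).2 ((map_ne_zero_iff _ (IsFractionRing.injective _ _)).2 hf)
  refine IsUnit.of_mul_eq_one g (hι ?_)
  rw [map_mul, hφ, hg, mul_inv_cancel₀ hf', map_one]

/-- Primitive decompositions spread out over curves. -/
theorem exists_spread (C : SmoothCurve K) (Λ : Type u) [Ring Λ] [Algebra C.R Λ]
    [Module.Finite C.R Λ] :
    ∃ (C' : SmoothCurve K) (φ : Cover C C') (k : ℕ), ∀ (Γ : Type u) [Ring Γ] [Algebra C'.R Γ]
      (g : Λ →+* Γ), (∀ r z, g (r • z) = φ.hom r • g z) →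
      ∃ e : Fin k → Γ, CompleteOrthogonalIdempotents e ∧
        ∀ i z, ∃ (t : C'.R) (m : ℕ), (e i * g z * e i - t • e i) ^ m = 0 := by
  classical
  obtain ⟨m, f, hm, hf, hfz⟩ := exists_linearIndependent_smul_mem_span (R := C.R) (H := Λ)
  let F := C.FunctionField
  obtain ⟨k, N, e, he, J, hJ, hc⟩ := exists_primitive_idempotents F (F ⊗[C.R] Λ)
  have hf' : algebraMap C.R F f ≠ 0 := by
    rw [IsScalarTower.algebraMap_apply C.R (FractionRing C.R) F]
    exact (map_ne_zero _).2 ((map_ne_zero_iff _ (IsFractionRing.injective _ _)).2 hf)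
  have hcoord : ∀ z : Λ, ∃ r : Fin (Module.finrank C.R Λ) → C.R, f • z = ∑ j, r j • m j := by
    intro z
    obtain ⟨r, hr⟩ := (Submodule.mem_span_range_iff_exists_fun _).1 (hfz z)
    exact ⟨r, hr.symm⟩
  have hexp : ∀ w : F ⊗[C.R] Λ, ∃ a : Fin (Module.finrank C.R Λ) → F, w = ∑ j, a j ⊗ₜ m j := by
    intro w
    induction w with
    | zero => exact ⟨0, by simp⟩
    | tmul q z =>
      obtain ⟨r, hr⟩ := hcoord z
      refine ⟨fun j => r j • (q * (algebraMap C.R F f)⁻¹), ?_⟩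
      simp only [TensorProduct.smul_tmul]
      rw [← TensorProduct.tmul_sum, ← hr, ← TensorProduct.smul_tmul, Algebra.smul_def,
        mul_left_comm, mul_inv_cancel₀ hf', mul_one]
    | add u v hu hv =>
      obtain ⟨a, ha⟩ := hu
      obtain ⟨b, hb⟩ := hv
      exact ⟨a + b, by simp [ha, hb, TensorProduct.add_tmul, Finset.sum_add_distrib]⟩
  choose a ha using fun i => hexp (e i)
  choose l hl using fun i j => hc i (1 ⊗ₜ m j)
  -- Finitely many algebraic functions describe the whole decomposition: the coordinates of the
  -- idempotents, the scalars giving their corners on the elements m j, and the inverse of f.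
  let W : Finset F := Finset.univ.image (fun p : Fin k × Fin _ => a p.1 p.2) ∪
    Finset.univ.image (fun p : Fin k × Fin _ => l p.1 p.2) ∪ {(algebraMap C.R F f)⁻¹}
  obtain ⟨C', φ, ι, hι, hφ, hW⟩ := C.exists_cover W
  have ha' : ∀ i j, ∃ r, ι r = a i j := fun i j => hW _ (by
    simp only [W, Finset.mem_union, Finset.mem_image]
    exact Or.inl (Or.inl ⟨(i, j), Finset.mem_univ _, rfl⟩))
  have hl' : ∀ i j, ∃ r, ι r = l i j := fun i j => hW _ (by
    simp only [W, Finset.mem_union, Finset.mem_image]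
    exact Or.inl (Or.inr ⟨(i, j), Finset.mem_univ _, rfl⟩))
  obtain ⟨f', hf1⟩ := hW (algebraMap C.R F f)⁻¹ (by simp [W])
  choose a' ha' using ha'
  choose l' hl' using hl'
  have hff' : φ.hom f * f' = 1 := hι (by rw [map_mul, hφ, hf1, mul_inv_cancel₀ hf', map_one])
  let _ : Algebra C.R C'.R := φ.hom.toRingHom.toAlgebra
  have halg : ∀ r : C.R, algebraMap C.R C'.R r = φ.hom r := fun r => rfl
  let ι' : C'.R →ₐ[C.R] F := { ι with commutes' := fun r => hφ r }
  have hι' : ∀ r, ι' r = ι r := fun r => rfl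
  let θ : C'.R ⊗[C.R] Λ →ₐ[C.R] F ⊗[C.R] Λ := Algebra.TensorProduct.map ι' (AlgHom.id C.R Λ)
  have hθ : ∀ r z, θ (r ⊗ₜ z) = ι r ⊗ₜ z := fun r z => Algebra.TensorProduct.map_tmul _ _ _ _
  have hθs : ∀ r w, θ (r • w) = ι r • θ w := by
    intro r w
    induction w with
    | zero => simp
    | tmul q z => rw [TensorProduct.smul_tmul', hθ, hθ, TensorProduct.smul_tmul', smul_eq_mul,
        map_mul, smul_eq_mul]
    | add u v hu hv => rw [smul_add, map_add, hu, hv, map_add, smul_add]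
  have hexp' : ∀ w : C'.R ⊗[C.R] Λ, ∃ b : Fin (Module.finrank C.R Λ) → C'.R,
      w = ∑ j, b j ⊗ₜ m j := by
    intro w
    induction w with
    | zero => exact ⟨0, by simp⟩
    | tmul q z =>
      obtain ⟨r, hr⟩ := hcoord z
      refine ⟨fun j => r j • (q * f'), ?_⟩
      simp only [TensorProduct.smul_tmul]
      rw [← TensorProduct.tmul_sum, ← hr, ← TensorProduct.smul_tmul, Algebra.smul_def,
        mul_left_comm, halg, hff', mul_one]
    | add u v hu hv =>
      obtain ⟨a, ha⟩ := hu
      obtain ⟨b, hb⟩ := hv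
      exact ⟨a + b, by simp [ha, hb, TensorProduct.add_tmul, Finset.sum_add_distrib]⟩
  have hmF : LinearIndependent F fun j => (1 : F) ⊗ₜ[C.R] m j := by
    have h1 : Module.Flat C.R (FractionRing C.R) := IsLocalization.flat _ (nonZeroDivisors C.R)
    have h2 : Module.Flat C.R F := Module.Flat.trans C.R (FractionRing C.R) F
    exact Module.Flat.linearIndependent_one_tmul hm
  -- Over the covering f is invertible, so the m j span, and they stay independent over F.
  -- Identities between the idempotents can therefore be checked over F.
  have hθinj : Function.Injective θ := by
    rw [injective_iff_map_eq_zero]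
    intro w hw
    obtain ⟨b, rfl⟩ := hexp' w
    rw [map_sum] at hw
    simp only [hθ] at hw
    have h1 : ∑ j, ι (b j) • ((1 : F) ⊗ₜ[C.R] m j) = 0 := by
      rw [← hw]
      exact Finset.sum_congr rfl fun j _ => by
        rw [TensorProduct.smul_tmul', smul_eq_mul, mul_one]
    have h2 := Fintype.linearIndependent_iff.1 hmF _ h1
    have h3 : ∀ j, b j = 0 := fun j => hι (by rw [h2 j, map_zero])
    simp [h3]
  let ε : Fin k → C'.R ⊗[C.R] Λ := fun i => ∑ j, a' i j ⊗ₜ m j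
  have hε : ∀ i, θ (ε i) = e i := by
    intro i
    rw [ha i, map_sum]
    simp only [hθ, ha']
  have hε1 : CompleteOrthogonalIdempotents ε := by
    refine ⟨⟨fun i => ?_, fun i j hij => ?_⟩, ?_⟩
    · exact hθinj (by rw [map_mul, hε]; exact he.idem i)
    · exact hθinj (by rw [map_mul, hε, hε, map_zero]; exact he.ortho hij)
    · exact hθinj (by rw [map_sum, map_one, ← he.complete]; simp only [hε])
  -- Modulo J the corner condition is linear in z, so the scalars for the m j determine t for every
  -- z; then J^N = 0 is used.
  have hε2 : ∀ i z, ∃ t : C'.R, (ε i * (1 ⊗ₜ z) * ε i - t • ε i) ^ N = 0 := by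
    intro i z
    obtain ⟨r, hr⟩ := hcoord z
    refine ⟨f' * ∑ j, φ.hom (r j) * l' i j, hθinj ?_⟩
    rw [map_zero, map_pow]
    have h1 : θ (ε i * (1 ⊗ₜ z) * ε i - (f' * ∑ j, φ.hom (r j) * l' i j) • ε i) ∈ J := by
      have h2 : (1 : F) ⊗ₜ[C.R] z = (algebraMap C.R F f)⁻¹ •
          ∑ j, algebraMap C.R F (r j) • ((1 : F) ⊗ₜ[C.R] m j) := by
        have h3 : ∑ j, algebraMap C.R F (r j) • ((1 : F) ⊗ₜ[C.R] m j) =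
            algebraMap C.R F f • ((1 : F) ⊗ₜ[C.R] z) := by
          simp only [algebraMap_smul, ← TensorProduct.tmul_smul, ← TensorProduct.tmul_sum, ← hr]
        rw [h3, inv_smul_smul₀ hf']
      have h4 : θ (ε i * (1 ⊗ₜ z) * ε i - (f' * ∑ j, φ.hom (r j) * l' i j) • ε i) =
          (algebraMap C.R F f)⁻¹ • ∑ j, algebraMap C.R F (r j) •
            (e i * ((1 : F) ⊗ₜ[C.R] m j) * e i - l i j • e i) := by
        rw [map_sub, map_mul, map_mul, hθs, hε, hθ, map_one, h2, map_mul, hf1, map_sum]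
        simp only [map_mul, hφ, hl', smul_sub, Finset.sum_sub_distrib, mul_smul_comm,
          smul_mul_assoc, Finset.mul_sum, Finset.sum_mul, mul_smul, Finset.sum_smul,
          Finset.smul_sum]
        rfl
      rw [h4]
      exact (J.restrictScalars F).smul_mem _ (Submodule.sum_mem _ fun j _ =>
        (J.restrictScalars F).smul_mem _ (hl i j))
    have h5 := Ideal.pow_mem_pow h1 N
    rw [hJ] at h5
    simpa using h5
  -- The tensor product C'.R ⊗ Λ is the universal case: it maps to every such Γ and carries its
  -- idempotents along.
  refine ⟨C', φ, k, fun Γ _ _ g hg => ?_⟩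
  let _ : Algebra C.R Γ := Algebra.compHom Γ φ.hom.toRingHom
  have hcomp : ∀ (r : C.R) (z : Γ), r • z = φ.hom r • z := fun r z => rfl
  have : IsScalarTower C.R C'.R Γ := ⟨fun r s z => by
    rw [hcomp, ← mul_smul, Algebra.smul_def r s, halg]⟩
  let g' : Λ →ₐ[C.R] Γ := AlgHom.ofLinearMap
    { toFun := g, map_add' := map_add g, map_smul' := fun r z => hg r z } (map_one g) (map_mul g)
  let Θ : C'.R ⊗[C.R] Λ →ₐ[C'.R] Γ := Algebra.TensorProduct.lift (Algebra.ofId C'.R Γ) g'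
    fun r z => Algebra.commutes r (g' z)
  have hΘ : ∀ z, Θ (1 ⊗ₜ z) = g z := fun z =>
    (Algebra.TensorProduct.lift_tmul _ _ _ _ _).trans (by rw [map_one, one_mul]; rfl)
  refine ⟨Θ ∘ ε, hε1.map Θ.toRingHom, fun i z => ?_⟩
  obtain ⟨t, ht⟩ := hε2 i z
  refine ⟨t, N, ?_⟩
  have := congrArg Θ ht
  rw [map_pow, map_sub, map_mul, map_mul, map_smul, hΘ, map_zero] at this
  exact this

end SmoothCurve

end SurfaceCM

namespace SurfaceCM

open Ser

/-! ### Families of modules given by matrices -/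

section MatrixFamily

variable (K A : Type u) [Field K] [CommRing A] [Algebra (Ser K) A]

/-- A family of `A`-modules, free of rank `d` over the power series ring, over an affine base. -/
structure MatrixFamily (R : Type u) [CommRing R] [Algebra K R] (d : ℕ) where
  /-- the action of `A` -/
  hom : A →+* Matrix (Fin d) (Fin d) (Ser R)
  hom_algebraMap : ∀ s, hom (algebraMap (Ser K) A s) =
    Matrix.scalar (Fin d) (MvPowerSeries.map (algebraMap K R) s)

variable {K A} {R R' R'' : Type u} [CommRing R] [Algebra K R] [CommRing R'] [Algebra K R']
  [CommRing R''] [Algebra K R''] {d : ℕ}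

theorem MvPowerSeries_map_map {R R' R'' : Type*} [CommRing R] [CommRing R'] [CommRing R'']
    (f : R →+* R') (g : R' →+* R'') (s : Ser R) :
    MvPowerSeries.map g (MvPowerSeries.map f s) = MvPowerSeries.map (g.comp f) s := by
  ext n; simp

/-- The endomorphisms of matrix rings induced by homomorphisms of coefficients. -/
noncomputable def matMap {R R' : Type*} [CommRing R] [CommRing R'] (d : ℕ) (c : R →+* R') :
    Matrix (Fin d) (Fin d) (Ser R) →+* Matrix (Fin d) (Fin d) (Ser R') :=
  (MvPowerSeries.map c : Ser R →+* Ser R').mapMatrix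

theorem matMap_apply {R R' : Type*} [CommRing R] [CommRing R'] (c : R →+* R')
    (M : Matrix (Fin d) (Fin d) (Ser R)) (i j : Fin d) :
    matMap d c M i j = MvPowerSeries.map c (M i j) := rfl

theorem matMap_scalar {R R' : Type*} [CommRing R] [CommRing R'] (c : R →+* R') (s : Ser R) :
    matMap d c (Matrix.scalar (Fin d) s) = Matrix.scalar (Fin d) (MvPowerSeries.map c s) := by
  ext1 i j
  rw [matMap_apply, Matrix.scalar_apply, Matrix.scalar_apply]
  by_cases h : i = j
  · subst h; simp
  · rw [Matrix.diagonal_apply_ne _ h, Matrix.diagonal_apply_ne _ h, map_zero]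

theorem matMap_smul {R R' : Type*} [CommRing R] [CommRing R'] (c : R →+* R') (s : Ser R)
    (M : Matrix (Fin d) (Fin d) (Ser R)) :
    matMap d c (s • M) = MvPowerSeries.map c s • matMap d c M := by
  ext1 i j
  rw [matMap_apply, Matrix.smul_apply, Matrix.smul_apply, smul_eq_mul, map_mul]; rfl

theorem matMap_matMap (f : R →+* R') (g : R' →+* R'') (M : Matrix (Fin d) (Fin d) (Ser R)) :
    matMap d g (matMap d f M) = matMap d (g.comp f) M := by
  ext1 i j
  simp only [matMap_apply, MvPowerSeries_map_map]

namespace MatrixFamily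

/-- Base change of families. -/
noncomputable def map (ρ : MatrixFamily K A R d) (c : R →ₐ[K] R') : MatrixFamily K A R' d where
  hom := (matMap d (c : R →+* R')).comp ρ.hom
  hom_algebraMap s := by
    rw [RingHom.comp_apply, ρ.hom_algebraMap, matMap_scalar, MvPowerSeries_map_map, c.comp_algebraMap]

theorem map_hom (ρ : MatrixFamily K A R d) (c : R →ₐ[K] R') (a : A) :
    (ρ.map c).hom a = matMap d (c : R →+* R') (ρ.hom a) := rfl

theorem map_map (ρ : MatrixFamily K A R d) (c : R →ₐ[K] R') (c' : R' →ₐ[K] R'') :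
    (ρ.map c).map c' = ρ.map (c'.comp c) := by
  rw [map, mk.injEq]
  ext1 a
  exact matMap_matMap _ _ _

/-- The endomorphism algebra of a family. -/
noncomputable abbrev centralizer (ρ : MatrixFamily K A R d) :
    Subalgebra (Ser R) (Matrix (Fin d) (Fin d) (Ser R)) :=
  Subalgebra.centralizer (Ser R) (Set.range ρ.hom)

theorem mem_centralizer {ρ : MatrixFamily K A R d} {z : Matrix (Fin d) (Fin d) (Ser R)} :
    z ∈ ρ.centralizer ↔ ∀ a, ρ.hom a * z = z * ρ.hom a := by
  rw [Subalgebra.mem_centralizer_iff]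
  simp

/-- Base change of endomorphisms. -/
noncomputable def centralizerMap (ρ : MatrixFamily K A R d) (c : R →ₐ[K] R') :
    ρ.centralizer →+* (ρ.map c).centralizer :=
  ((matMap d (c : R →+* R')).comp ρ.centralizer.val.toRingHom).codRestrict
    (ρ.map c).centralizer fun z => mem_centralizer.2 fun a => by
      have := mem_centralizer.1 z.2 a
      rw [map_hom]
      change _ * matMap d (c : R →+* R') z = matMap d (c : R →+* R') z * _
      rw [← map_mul, ← map_mul, this]

theorem centralizerMap_coe (ρ : MatrixFamily K A R d) (c : R →ₐ[K] R') (z : ρ.centralizer) :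
    (ρ.centralizerMap c z : Matrix (Fin d) (Fin d) (Ser R')) = matMap d (c : R →+* R') z := rfl

theorem centralizerMap_smul (ρ : MatrixFamily K A R d) (c : R →ₐ[K] R') (s : Ser R)
    (z : ρ.centralizer) : ρ.centralizerMap c (s • z) =
      MvPowerSeries.map (c : R →+* R') s • ρ.centralizerMap c z :=
  Subtype.ext (matMap_smul _ _ _)

theorem centralizerMap_mem_smulIdeal (ρ : MatrixFamily K A R d) (c : R →ₐ[K] R')
    {z : ρ.centralizer} (hz : z ∈ smulIdeal ρ.centralizer (vars R)) :
    ρ.centralizerMap c z ∈ smulIdeal (ρ.map c).centralizer (vars R') := by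
  rw [mem_smulIdeal] at hz ⊢
  induction hz using Submodule.smul_induction_on' with
  | smul t ht w _ =>
    rw [centralizerMap_smul]
    exact Submodule.smul_mem_smul (map_mem_vars ht) Submodule.mem_top
  | add u _ v _ hu hv => rw [map_add]; exact Submodule.add_mem _ hu hv

instance [IsNoetherianRing R] (ρ : MatrixFamily K A R d) : Module.Finite (Ser R) ρ.centralizer :=
  Module.Finite.of_fg (IsNoetherian.noetherian (Subalgebra.toSubmodule ρ.centralizer))

variable [Module.Finite (Ser K) A]

-- Power series act by scalar matrices, so commuting with generators of A as a K[[x,y]]-module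
-- suffices. Thus the centralizer is the kernel of a linear map to a finite free module.
variable (K A) in
theorem exists_generators_centralizer (d : ℕ) :
    ∃ (n : ℕ) (a : Fin n → A), ∀ (R' : Type u) [CommRing R'] [Algebra K R']
      (ρ' : MatrixFamily K A R' d) (z : Matrix (Fin d) (Fin d) (Ser R')),
      (∀ k, ρ'.hom (a k) * z = z * ρ'.hom (a k)) → z ∈ ρ'.centralizer := by
  obtain ⟨n, a, ha⟩ := Module.Finite.exists_fin (R := Ser K) (M := A)
  refine ⟨n, a, fun R' _ _ ρ' z hz => mem_centralizer.2 fun b => ?_⟩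
  have hb : b ∈ Submodule.span (Ser K) (Set.range a) := by rw [ha]; trivial
  induction hb using Submodule.span_induction with
  | mem b hb => obtain ⟨k, rfl⟩ := hb; exact hz k
  | zero => rw [map_zero, zero_mul, mul_zero]
  | add u v _ _ hu hv => rw [map_add, add_mul, mul_add, hu, hv]
  | smul s b _ hb =>
    rw [Algebra.smul_def, map_mul, hom_algebraMap, mul_assoc, hb, ← mul_assoc, ← mul_assoc]
    congr 1
    exact (Matrix.scalar_commute _ (fun r => Commute.all _ r) z).eq

/-- Endomorphisms of almost all members of a family lift to the family. -/
theorem exists_forall_exists_lift [IsDomain R] [IsNoetherianRing R] (hR : IsLocallyPrincipal K R)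
    (ρ : MatrixFamily K A R d) :
    ∃ f : R, f ≠ 0 ∧ ∀ c : R →ₐ[K] K, c f ≠ 0 → ∀ z : Matrix (Fin d) (Fin d) (Ser K),
      z ∈ (ρ.map c).centralizer → ∃ Z ∈ ρ.centralizer, matMap d (c : R →+* K) Z = z := by
  obtain ⟨n, a, ha⟩ := exists_generators_centralizer K A d
  let M : (Fin d × Fin d → Ser R) → Matrix (Fin d) (Fin d) (Ser R) := fun Z =>
    Matrix.of fun i j => Z (i, j)
  -- The map L takes the commutators with the generators a k. Its kernel is the endomorphism algebra
  -- of the family, and the same holds for its specializations.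
  let L : (Fin d × Fin d → Ser R) →ₗ[Ser R] (Fin n × Fin d × Fin d → Ser R) :=
    { toFun := fun Z p => (ρ.hom (a p.1) * M Z - M Z * ρ.hom (a p.1)) p.2.1 p.2.2
      map_add' := by
        intro Z W
        funext p
        have : M (Z + W) = M Z + M W := rfl
        simp only [this, mul_add, add_mul, Pi.add_apply, Matrix.sub_apply, Matrix.add_apply]
        ring
      map_smul' := by
        intro s Z
        funext p
        have : M (s • Z) = s • M Z := rfl
        simp only [this, mul_smul_comm, smul_mul_assoc, Pi.smul_apply, Matrix.sub_apply,
          Matrix.smul_apply, smul_sub, RingHom.id_apply] }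
  have hL : ∀ Z p, L Z p = (ρ.hom (a p.1) * M Z - M Z * ρ.hom (a p.1)) p.2.1 p.2.2 :=
    fun _ _ => rfl
  obtain ⟨f, hf, hfc⟩ := exists_forall_specialize_kernel L hR
  refine ⟨f, hf, fun c hc z hz => ?_⟩
  obtain ⟨Z₀, hZ₀⟩ : ∃ Z₀, matMap d (c : R →+* K) (M Z₀) = z := by
    choose g hg using Ser.map_surjective (c := (c : R →+* K)) fun k => ⟨algebraMap K R k, by simp⟩
    exact ⟨fun p => g (z p.1 p.2), by ext1 i j; exact hg _⟩
  obtain ⟨Z, hZ, hZc⟩ := hfc c hc Z₀ (by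
    funext p
    change MvPowerSeries.map (c : R →+* K) (L Z₀ p) = 0
    rw [hL, ← matMap_apply, map_sub, map_mul, map_mul, hZ₀, ← map_hom, mem_centralizer.1 hz, sub_self]
    rfl)
  refine ⟨M Z, ha R ρ _ fun k => ?_, ?_⟩
  · rw [← sub_eq_zero]
    ext1 i j
    have := congrFun hZ (k, i, j)
    rw [hL] at this
    exact this
  · rw [← hZ₀]
    ext1 i j
    exact congrFun hZc (i, j)

end MatrixFamily

end MatrixFamily

end SurfaceCM

namespace SurfaceCM

open Ser

/-! ### Primitive decompositions of families -/

section ClosedFiber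

variable {R : Type u} [CommRing R] {E : Type u} [Ring E] [Algebra (Ser R) E]

/-- The restriction of an algebra to the zero locus of the variables. -/
def ClosedFiber (R E : Type u) [CommRing R] [Ring E] [Algebra (Ser R) E] : Type u :=
  E ⧸ smulIdeal E (vars R)

namespace ClosedFiber

noncomputable instance : Ring (ClosedFiber R E) :=
  inferInstanceAs (Ring (E ⧸ smulIdeal E (vars R)))

noncomputable instance algebraSer : Algebra (Ser R) (ClosedFiber R E) :=
  inferInstanceAs (Algebra (Ser R) (E ⧸ smulIdeal E (vars R)))

noncomputable instance algebraBase : Algebra R (ClosedFiber R E) :=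
  Algebra.compHom (ClosedFiber R E) (MvPowerSeries.C : R →+* Ser R)

/-- The restriction map. -/
noncomputable def mk (R E : Type u) [CommRing R] [Ring E] [Algebra (Ser R) E] :
    E →+* ClosedFiber R E := Ideal.Quotient.mk (smulIdeal E (vars R))

theorem mk_surjective : Function.Surjective (mk R E) := Ideal.Quotient.mk_surjective

theorem mk_eq_zero_iff {z : E} : mk R E z = 0 ↔ z ∈ smulIdeal E (vars R) :=
  Ideal.Quotient.eq_zero_iff_mem

theorem smul_mk (t : R) (z : E) :
    t • mk R E z = mk R E ((MvPowerSeries.C t : Ser R) • z) := rfl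

/-- The homomorphism of closed fibres induced by a homomorphism. -/
noncomputable def lift {Γ : Type u} [Ring Γ] (β : E →+* Γ)
    (h : ∀ z ∈ smulIdeal E (vars R), β z = 0) : ClosedFiber R E →+* Γ :=
  Ideal.Quotient.lift (smulIdeal E (vars R)) β h

theorem smul_eq (t : Ser R) (z : ClosedFiber R E) :
    t • z = MvPowerSeries.constantCoeff t • z := by
  have h : (t - MvPowerSeries.C (MvPowerSeries.constantCoeff t)) • z = 0 :=
    smul_quotient_smulIdeal (E := E) (C_constantCoeff_sub_mem t) z
  rw [sub_smul, sub_eq_zero] at h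
  exact h

instance [Module.Finite (Ser R) E] : Module.Finite R (ClosedFiber R E) := by
  have : Module.Finite (Ser R) (ClosedFiber R E) := finite_quotient_smulIdeal (E := E) (vars R)
  obtain ⟨s, hs⟩ := Module.Finite.fg_top (R := Ser R) (M := ClosedFiber R E)
  refine ⟨s, ?_⟩
  rw [eq_top_iff]
  intro z _
  have hz : z ∈ Submodule.span (Ser R) (s : Set (ClosedFiber R E)) := by rw [hs]; trivial
  induction hz using Submodule.span_induction with
  | mem z hz => exact Submodule.subset_span hz
  | zero => exact Submodule.zero_mem _
  | add a b _ _ ha hb => exact Submodule.add_mem _ (ha trivial) (hb trivial)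
  | smul t z _ hz =>
    rw [smul_eq]
    exact Submodule.smul_mem _ _ (hz trivial)

end ClosedFiber

end ClosedFiber

section

variable {K A : Type u} [Field K] [IsAlgClosed K] [CommRing A] [Algebra (Ser K) A] {d : ℕ}

/-- Endomorphisms modulo (x, y) form a finite algebra over the curve, to which `exists_spread`
applies; the idempotents then lift by completeness. Corners are controlled only for endomorphisms
coming from the original family, which will suffice since those of almost all members extend to it.
-/
theorem MatrixFamily.exists_idempotents (C : SmoothCurve K) (ρ : MatrixFamily K A C.R d) :
    ∃ (C' : SmoothCurve K) (φ : C.Cover C') (k : ℕ) (e : Fin k → (ρ.map φ.hom).centralizer),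
      CompleteOrthogonalIdempotents e ∧ ∀ (i : Fin k) (Z : ρ.centralizer),
        ∃ (t : C'.R) (m : ℕ), (e i * ρ.centralizerMap φ.hom Z * e i -
          (MvPowerSeries.C t : Ser C'.R) • e i) ^ m ∈
            smulIdeal (ρ.map φ.hom).centralizer (vars C'.R) := by
  obtain ⟨C', φ, k, H⟩ := C.exists_spread (ClosedFiber C.R ρ.centralizer)
  let E' := (ρ.map φ.hom).centralizer
  let g : ClosedFiber C.R ρ.centralizer →+* ClosedFiber C'.R E' :=
    ClosedFiber.lift ((ClosedFiber.mk C'.R E').comp (ρ.centralizerMap φ.hom)) fun z hz =>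
      ClosedFiber.mk_eq_zero_iff.2 (ρ.centralizerMap_mem_smulIdeal φ.hom hz)
  have hg : ∀ z, g (ClosedFiber.mk _ _ z) = ClosedFiber.mk C'.R E' (ρ.centralizerMap φ.hom z) :=
    fun z => rfl
  obtain ⟨ε, hε, hε'⟩ := H (ClosedFiber C'.R E') g (by
    intro r z
    obtain ⟨z, rfl⟩ := ClosedFiber.mk_surjective z
    rw [ClosedFiber.smul_mk, hg, hg, MatrixFamily.centralizerMap_smul, ClosedFiber.smul_mk,
      MvPowerSeries.map_C]
    rfl)
  have : IsAdicComplete (vars C'.R) E' := isAdicComplete_of_finite _ _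
  obtain ⟨e, he, heε⟩ := exists_lift_idempotents_of_surjective (E := E') (vars C'.R)
    (ClosedFiber.mk C'.R E') ClosedFiber.mk_surjective (fun z => ClosedFiber.mk_eq_zero_iff) hε
  refine ⟨C', φ, k, e, he, fun i Z => ?_⟩
  obtain ⟨t, m, h⟩ := hε' i (ClosedFiber.mk _ _ Z)
  refine ⟨t, m, ClosedFiber.mk_eq_zero_iff.1 ?_⟩
  rw [← h, hg, ← heε, ClosedFiber.smul_mk, map_pow, map_sub, map_mul, map_mul]

/-- Almost all members of a family decompose compatibly into indecomposables, after a covering. -/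
theorem MatrixFamily.exists_primitive_decomposition [Module.Finite (Ser K) A] (C : SmoothCurve K)
    (ρ : MatrixFamily K A C.R d) :
    ∃ (C' : SmoothCurve K) (φ : C.Cover C') (k : ℕ) (e : Fin k → (ρ.map φ.hom).centralizer),
      CompleteOrthogonalIdempotents e ∧
      {c : C.R →ₐ[K] K | ¬ ∃ c' : C'.R →ₐ[K] K, c'.comp φ.hom = c ∧
        ∀ i, IsPrimitiveMod (vars K) ((ρ.map φ.hom).centralizerMap c' (e i))}.Finite := by
  obtain ⟨C', φ, k, e, he, h⟩ := ρ.exists_idempotents C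
  obtain ⟨f, hf, hfc⟩ := ρ.exists_forall_exists_lift
    (isLocallyPrincipal_of_smooth K C.R C.ringKrullDim_eq)
  refine ⟨C', φ, k, e, he, (φ.finite.union (C.finite_zeros hf)).subset ?_⟩
  intro c hc
  by_contra hn
  rw [Set.mem_union, not_or, Set.mem_ofPred_eq, Set.mem_ofPred_eq, not_not, not_not] at hn
  obtain ⟨⟨c', rfl⟩, hcf⟩ := hn
  refine hc ⟨c', rfl, fun i z => ?_⟩
  -- The member at c' of the pulled back family is the member of ρ at the image point, so its
  -- endomorphism z extends to ρ itself.
  obtain ⟨Z, hZ, hZz⟩ := hfc _ hcf z (by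
    have h0 : ∀ w, w ∈ ((ρ.map φ.hom).map c').centralizer →
        w ∈ (ρ.map (c'.comp φ.hom)).centralizer := by
      rw [MatrixFamily.map_map]; exact fun _ h => h
    exact h0 _ z.2)
  obtain ⟨t, m, ht⟩ := h i ⟨Z, hZ⟩
  refine ⟨MvPowerSeries.C (c' t), m, ?_⟩
  have h1 := (ρ.map φ.hom).centralizerMap_mem_smulIdeal c' ht
  have h2 : (ρ.map φ.hom).centralizerMap c' (ρ.centralizerMap φ.hom ⟨Z, hZ⟩) = z := by
    apply Subtype.ext
    rw [MatrixFamily.centralizerMap_coe, MatrixFamily.centralizerMap_coe, matMap_matMap]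
    exact hZz
  rw [map_pow, map_sub, map_mul, map_mul, h2, MatrixFamily.centralizerMap_smul,
    MvPowerSeries.map_C] at h1
  exact h1

end

end SurfaceCM

namespace SurfaceCM

open Ser

/-! ### The modules defined by matrices -/

theorem IsPrimitiveMod.map {T E E' : Type*} [CommRing T] [Ring E] [Algebra T E] [Ring E']
    [Algebra T E'] {I : Ideal T} {e : E} (h : IsPrimitiveMod I e) (φ : E ≃ₐ[T] E') :
    IsPrimitiveMod I (φ e) := by
  intro z
  obtain ⟨t, m, ht⟩ := h (φ.symm z)
  refine ⟨t, m, ?_⟩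
  have h1 : φ ((e * φ.symm z * e - t • e) ^ m) ∈ smulIdeal E' I := by
    rw [mem_smulIdeal] at ht ⊢
    have h2 := Submodule.mem_map_of_mem (f := φ.toLinearMap) ht
    rw [Submodule.map_smul''] at h2
    exact Submodule.smul_mono le_rfl le_top h2
  rwa [map_pow, map_sub, map_mul, map_mul, map_smul, φ.apply_symm_apply] at h1

namespace MatrixFamily

section Mod

variable {K A : Type u} [Field K] [CommRing A] [Algebra (Ser K) A] {d : ℕ}

/-- The `A`-module defined by a homomorphism to matrices over power series. -/
def Mod (_ρ : MatrixFamily K A K d) : Type u := Fin d → Ser K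

variable (ρ : MatrixFamily K A K d)

noncomputable instance : AddCommGroup ρ.Mod := inferInstanceAs (AddCommGroup (Fin d → Ser K))

noncomputable instance moduleSer : Module (Ser K) ρ.Mod :=
  inferInstanceAs (Module (Ser K) (Fin d → Ser K))

instance : Module.Finite (Ser K) ρ.Mod := inferInstanceAs (Module.Finite (Ser K) (Fin d → Ser K))

instance : Module.Free (Ser K) ρ.Mod := inferInstanceAs (Module.Free (Ser K) (Fin d → Ser K))

noncomputable instance : Module A ρ.Mod :=
  Module.compHom (Fin d → Ser K) ((Matrix.toLinAlgEquiv' : Matrix (Fin d) (Fin d) (Ser K) ≃ₐ[Ser K]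
    Module.End (Ser K) (Fin d → Ser K)).toRingEquiv.toRingHom.comp ρ.hom)

theorem smul_def (a : A) (v : ρ.Mod) : a • v = (ρ.hom a).mulVec v := rfl

theorem scalar_mulVec (s : Ser K) (v : Fin d → Ser K) :
    (Matrix.scalar (Fin d) s).mulVec v = s • v := by
  funext i
  rw [Matrix.scalar_apply, Matrix.mulVec_diagonal]; rfl

theorem map_id_algebraMap (s : Ser K) : MvPowerSeries.map (algebraMap K K) s = s := by
  ext n; simp

instance : IsScalarTower (Ser K) A ρ.Mod := ⟨fun s a v => by
  rw [Algebra.smul_def, mul_smul, smul_def ρ (algebraMap (Ser K) A s), hom_algebraMap,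
    map_id_algebraMap]
  exact scalar_mulVec s _⟩

theorem algebraMap_smul_mod (s : Ser K) (v : ρ.Mod) : algebraMap (Ser K) A s • v = s • v :=
  algebraMap_smul A s v

/-- Matrices commuting with the action act as endomorphisms. -/
noncomputable def toEndHom : ρ.centralizer →ₐ[Ser K] Module.End A ρ.Mod where
  toFun z :=
    { toFun := fun v => (z : Matrix (Fin d) (Fin d) (Ser K)).mulVec v
      map_add' := fun v w => Matrix.mulVec_add _ v w
      map_smul' := fun a v => by
        refine (Matrix.mulVec_mulVec (M := z.1) (N := ρ.hom a) (v := (v : Fin d → Ser K))).trans ?_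
        rw [← mem_centralizer.1 z.2]
        exact (Matrix.mulVec_mulVec (M := ρ.hom a) (N := z.1) (v := (v : Fin d → Ser K))).symm }
  map_one' := LinearMap.ext fun v => Matrix.one_mulVec (v : Fin d → Ser K)
  map_mul' z w := LinearMap.ext fun v => (Matrix.mulVec_mulVec (v : Fin d → Ser K) z.1 w.1).symm
  map_zero' := LinearMap.ext fun v => Matrix.zero_mulVec (v : Fin d → Ser K)
  map_add' z w := LinearMap.ext fun v => Matrix.add_mulVec z.1 w.1 (v : Fin d → Ser K)
  commutes' s := LinearMap.ext fun v => by
    rw [Module.algebraMap_end_apply]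
    exact scalar_mulVec s v

theorem toEndHom_bijective : Function.Bijective ρ.toEndHom := by
  constructor
  · intro z w h
    apply Subtype.ext
    apply Matrix.mulVec_injective
    funext v
    exact LinearMap.congr_fun h v
  · intro f
    let f' : (Fin d → Ser K) →ₗ[Ser K] (Fin d → Ser K) :=
      (f.restrictScalars (Ser K) : ρ.Mod →ₗ[Ser K] ρ.Mod)
    have h1 : ∀ v, (LinearMap.toMatrix' f').mulVec v = f' v := fun v =>
      LinearMap.toMatrix'_mulVec f' v
    refine ⟨⟨LinearMap.toMatrix' f', mem_centralizer.2 fun a => ?_⟩, LinearMap.ext h1⟩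
    apply Matrix.mulVec_injective
    funext v
    rw [← Matrix.mulVec_mulVec, ← Matrix.mulVec_mulVec, h1, h1]
    exact (f.map_smul a v).symm

/-- The endomorphisms of the module are the matrices commuting with the action. -/
noncomputable def toEnd : ρ.centralizer ≃ₐ[Ser K] Module.End A ρ.Mod :=
  AlgEquiv.ofBijective ρ.toEndHom ρ.toEndHom_bijective

/-- The summand of the module defined by an idempotent. -/
noncomputable abbrev Summand (e : ρ.centralizer) : Submodule A ρ.Mod := LinearMap.range (ρ.toEnd e)

variable {ρ}

theorem isCohenMacaulay_mod [Algebra K A] [IsLocalRing A] (h : IsFiniteOverSer K A) :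
    IsCohenMacaulay A ρ.Mod :=
  h.isCohenMacaulay_iff.2 ⟨inferInstance, inferInstance⟩

theorem isCohenMacaulay_summand [Algebra K A] [IsLocalRing A] (h : IsFiniteOverSer K A)
    {e : ρ.centralizer} (he : e * e = e) : IsCohenMacaulay A (ρ.Summand e) :=
  h.isCohenMacaulay_of_isSummand (isCohenMacaulay_mod h)
    (isSummand_range (by rw [← map_mul, he]))

theorem exists_equiv_summand [IsAlgClosed K] [Algebra K A] [IsLocalRing A]
    (h : IsFiniteOverSer K A) {k : ℕ}
    {e : Fin k → ρ.centralizer} (he : CompleteOrthogonalIdempotents e)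
    (hp : ∀ i, IsPrimitiveMod (vars K) (e i)) {N : Type u} [AddCommGroup N] [Module A N]
    (hN : IsCohenMacaulay A N) (hN' : IsIndecomposable A N) (hNM : IsSummand A N ρ.Mod) :
    ∃ i, Nonempty (N ≃ₗ[A] ρ.Summand (e i)) := by
  have := h.finite_end (isCohenMacaulay_mod (ρ := ρ) h)
  have := isHausdorff_maximalIdeal K (Module.End A ρ.Mod)
  refine h.exists_equiv_range hN hN' hNM (he.map ρ.toEnd.toRingEquiv.toRingHom) fun i f hf => ?_
  have h1 := (hp i).map ρ.toEnd
  rw [vars_eq_maximalIdeal] at h1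
  exact h1.range_idempotents (by rw [← map_mul, (he.idem i).eq]) f hf

end Mod

end MatrixFamily

end SurfaceCM

namespace SurfaceCM

open Ser

/-! ### Expansions in two variables -/

section Expansion

/-- Multiplication by a variable raises degrees, so u(r + xf + yg) is determined in degrees up to k
by f and g in degrees below k. -/
theorem Ser.ext_of_coeff_lt {R : Type*} [CommRing R] {f g f' g' : Ser R} {u r : R} {k : ℕ}
    (hf : ∀ n : Fin 2 →₀ ℕ, n.degree < k → MvPowerSeries.coeff n f = MvPowerSeries.coeff n f')
    (hg : ∀ n : Fin 2 →₀ ℕ, n.degree < k → MvPowerSeries.coeff n g = MvPowerSeries.coeff n g')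
    (n : Fin 2 →₀ ℕ) (hn : n.degree < k + 1) :
    MvPowerSeries.coeff n (MvPowerSeries.C u * (MvPowerSeries.C r + x * f + y * g)) =
      MvPowerSeries.coeff n (MvPowerSeries.C u * (MvPowerSeries.C r + x * f' + y * g')) := by
  have key : ∀ (i : Fin 2) (f f' : Ser R), (∀ n : Fin 2 →₀ ℕ, n.degree < k →
      MvPowerSeries.coeff n f = MvPowerSeries.coeff n f') →
      MvPowerSeries.coeff n (MvPowerSeries.X i * f) =
        MvPowerSeries.coeff n (MvPowerSeries.X i * f') := by
    intro i f f' h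
    by_cases h0 : n i = 0
    · rw [coeff_X_mul_of_eq_zero i _ n h0, coeff_X_mul_of_eq_zero i _ n h0]
    · obtain ⟨n', rfl⟩ := exists_eq_single_add h0
      rw [coeff_X_mul_add, coeff_X_mul_add]
      refine h n' ?_
      rw [map_add, Finsupp.degree_single] at hn
      lia
  rw [MvPowerSeries.coeff_C_mul, MvPowerSeries.coeff_C_mul, map_add, map_add, map_add, map_add,
    key 0 f f' hf, key 1 g g' hg]

/-- The recursion is contracting, and Φ is its fixed point. In the application f h = Σ r(h, i) m_i +
x p(h) + y q(h) and u is the inverse of f, so Φ h gives the coordinates of h with respect to the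
m_i. No linearity of p, q or r is needed. -/
theorem Ser.exists_expansion {R : Type*} [CommRing R] {H ι : Type*} (p q : H → H) (r : H → ι → R)
    (u : R) : ∃ Φ : H → ι → Ser R, ∀ h i, Φ h i =
      MvPowerSeries.C u * (MvPowerSeries.C (r h i) + x * Φ (p h) i + y * Φ (q h) i) := by
  let T : (H → ι → Ser R) → H → ι → Ser R := fun Φ h i =>
    MvPowerSeries.C u * (MvPowerSeries.C (r h i) + x * Φ (p h) i + y * Φ (q h) i)
  let a : ℕ → H → ι → Ser R := fun k => T^[k] 0
  have ha : ∀ k, a (k + 1) = T (a k) := fun k => Function.iterate_succ_apply' T k 0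
  have h1 : ∀ k h i, ∀ n : Fin 2 →₀ ℕ, n.degree < k →
      MvPowerSeries.coeff n (a k h i) = MvPowerSeries.coeff n (a (k + 1) h i) := by
    intro k
    induction k with
    | zero => intro h i n hn; exact absurd hn (Nat.not_lt_zero _)
    | succ k ih =>
      intro h i n hn
      rw [ha k, ha (k + 1)]
      exact ext_of_coeff_lt (ih (p h) i) (ih (q h) i) n hn
  let Φ : H → ι → Ser R := fun h i =>
    Ser.mk fun n => MvPowerSeries.coeff n (a (n.degree + 1) h i)
  have h2 : ∀ k h i, ∀ n : Fin 2 →₀ ℕ, n.degree < k →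
      MvPowerSeries.coeff n (a k h i) = MvPowerSeries.coeff n (Φ h i) := by
    intro k h i n hn
    induction k, hn using Nat.le_induction with
    | base => rfl
    | succ k hk ih => rw [← h1 k h i n hk, ih]
  refine ⟨Φ, fun h i => ?_⟩
  ext n
  rw [← h2 (n.degree + 1) h i n (Nat.lt_succ_self _), ha]
  exact ext_of_coeff_lt (fun n hn => h2 _ (p h) i n hn) (fun n hn => h2 _ (q h) i n hn) n
    (Nat.lt_succ_self _)

variable {K : Type u} [Field K] {N : Type u} [AddCommGroup N] [Module (Ser K) N]

/-- Each use of the recursion gains a factor in (x, y), and finite modules are separated. This is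
the uniqueness belonging to `exists_expansion`. -/
theorem Ser.eq_zero_of_eq_add [Module.Finite (Ser K) N] {H : Type*} (p q : H → H) (D : H → N) (u : Ser K)
    (h : ∀ h, D h = u • ((x : Ser K) • D (p h) + (y : Ser K) • D (q h))) (z : H) : D z = 0 := by
  have h1 : IsHausdorff (vars K) N := (isAdicComplete_of_finite (vars K) N).toIsHausdorff
  have h2 : ∀ n z, D z ∈ ((vars K) ^ n • ⊤ : Submodule (Ser K) N) := by
    intro n
    induction n with
    | zero => intro z; simp
    | succ n ih =>
      intro z
      rw [h, pow_succ', Submodule.mul_smul]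
      exact Submodule.smul_mem _ _ (add_mem (Submodule.smul_mem_smul (X_mem_vars 0) (ih _))
        (Submodule.smul_mem_smul (X_mem_vars 1) (ih _)))
  exact h1.haus _ fun n => by rw [SModEq.zero]; exact h2 n z

theorem Ser.mem_vars_smul_top {w : N} : w ∈ (vars K • ⊤ : Submodule (Ser K) N) ↔
    ∃ u v : N, w = (x : Ser K) • u + (y : Ser K) • v := by
  constructor
  · intro h
    induction h using Submodule.smul_induction_on' with
    | smul r hr n _ =>
      obtain ⟨s, t, rfl⟩ := mem_vars_iff_exists.1 hr
      exact ⟨s • n, t • n, by rw [add_smul, mul_smul, mul_smul]⟩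
    | add a _ b _ ha hb =>
      obtain ⟨u, v, rfl⟩ := ha
      obtain ⟨u', v', rfl⟩ := hb
      exact ⟨u + u', v + v', by rw [smul_add, smul_add]; abel⟩
  · rintro ⟨u, v, rfl⟩
    exact add_mem (Submodule.smul_mem_smul (X_mem_vars 0) Submodule.mem_top)
      (Submodule.smul_mem_smul (X_mem_vars 1) Submodule.mem_top)

/-- A basis of the reduction modulo the variables lifts to a basis. -/
theorem Ser.exists_basis [Module.Finite (Ser K) N] [Module.Free (Ser K) N] {d : ℕ} (b : Fin d → N)
    (hspan : ∀ w, ∃ t : Fin d → Ser K, ∃ u v : N,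
      w = ∑ i, t i • b i + ((x : Ser K) • u + (y : Ser K) • v))
    (hind : ∀ t : Fin d → K, (∃ u v : N, ∑ i, (MvPowerSeries.C (t i) : Ser K) • b i =
      (x : Ser K) • u + (y : Ser K) • v) → t = 0) :
    ∃ B : Module.Basis (Fin d) (Ser K) N, ∀ i, B i = b i := by
  let g : (Fin d → Ser K) →ₗ[Ser K] N := Fintype.linearCombination (Ser K) b
  have hg : ∀ t, g t = ∑ i, t i • b i := fun t => Fintype.linearCombination_apply _ _ _
  have hsurj : Function.Surjective g := by
    rw [← LinearMap.range_eq_top, eq_top_iff]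
    refine Submodule.le_of_le_smul_of_le_jacobson_bot (I := vars K) Module.Finite.fg_top ?_ ?_
    · rw [vars_eq_maximalIdeal]; exact IsLocalRing.maximalIdeal_le_jacobson _
    · intro w _
      obtain ⟨t, u, v, rfl⟩ := hspan w
      refine Submodule.add_mem_sup ⟨t, hg t⟩ (mem_vars_smul_top.2 ⟨u, v, rfl⟩)
  let B := Module.finBasis (Ser K) N
  -- Surjectivity bounds the rank by d, and independence modulo the variables bounds d by the rank.
  -- A surjection between free modules of the same finite rank is injective.
  have h1 : Module.finrank (Ser K) N ≤ d := by
    have := g.finrank_range_le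
    rwa [LinearMap.range_eq_top.2 hsurj, finrank_top, Module.finrank_fin_fun] at this
  have h2 : d ≤ Module.finrank (Ser K) N := by
    let φ : (Fin d → K) →ₗ[K] (Fin (Module.finrank (Ser K) N) → K) :=
      { toFun := fun t j =>
          MvPowerSeries.constantCoeff (B.repr (∑ i, (MvPowerSeries.C (t i) : Ser K) • b i) j)
        map_add' := fun t t' => by
          funext j
          simp [add_smul, Finset.sum_add_distrib]
        map_smul' := fun s t => by
          funext j
          simp [Finset.mul_sum, mul_assoc] }
    have hφ : Function.Injective φ := by
      rw [injective_iff_map_eq_zero]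
      intro t ht
      refine hind t (mem_vars_smul_top.1 ?_)
      rw [← B.sum_repr (∑ i, (MvPowerSeries.C (t i) : Ser K) • b i)]
      refine sum_mem fun j _ => Submodule.smul_mem_smul ?_ Submodule.mem_top
      exact mem_vars_iff.2 (congrFun ht j)
    simpa using LinearMap.finrank_le_finrank_of_injective hφ
  let e : (Fin d → Ser K) ≃ₗ[Ser K] N := by
    refine LinearEquiv.ofBijective g ⟨?_, hsurj⟩
    exact OrzechProperty.injective_of_surjective_of_injective
      (B.equivFun.symm.toLinearMap ∘ₗ (LinearEquiv.funCongrLeft (Ser K) (Ser K)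
        (finCongr (le_antisymm h1 h2))).toLinearMap) g
      (B.equivFun.symm.injective.comp (LinearEquiv.injective _)) hsurj
  refine ⟨Module.Basis.ofEquivFun e.symm, fun i => ?_⟩
  rw [Module.Basis.coe_ofEquivFun, LinearEquiv.symm_symm]
  change g (Pi.single i 1) = b i
  simp [g]

end Expansion

end SurfaceCM

namespace SurfaceCM

open Ser

/-! ### Families given by modules -/

theorem SmoothCurve.exists_ne_zero_of_point {K : Type u} [Field K] (C : SmoothCurve K)
    (c : C.R →ₐ[K] K) : ∃ f : C.R, f ≠ 0 ∧ c f = 0 := by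
  by_contra! hc
  have h2 : IsField C.R := by
    have h3 := isMaximal_ker_point c
    refine Ring.isField_iff_maximal_bot.2 ?_
    rwa [(RingHom.ker_eq_bot_iff_eq_zero c).2 fun r hr => by_contra fun h => hc r h hr] at h3
  have h4 := C.ringKrullDim_eq
  rw [ringKrullDim_eq_zero_of_isField h2] at h4
  exact zero_ne_one h4

/-- The excluded points are the zeros of some nonzero function or lie among them, and functions on a
curve are determined by their values where such a function does not vanish. -/
theorem SmoothCurve.eq_of_forall_point {K : Type u} [Field K] [IsAlgClosed K] (C : SmoothCurve K)
    {P : (C.R →ₐ[K] K) → Prop} (hP : {c | ¬ P c}.Finite) {r s : C.R}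
    (h : ∀ c, P c → c r = c s) : r = s := by
  choose f hf hfc using C.exists_ne_zero_of_point
  have hf' : ∏ c ∈ hP.toFinset, f c ≠ 0 := Finset.prod_ne_zero_iff.2 fun c _ => hf c
  rw [← sub_eq_zero]
  refine eq_zero_of_forall_point (K := K) hf' fun c hc => ?_
  rw [map_sub, sub_eq_zero]
  refine h c (by_contra fun hPc => hc ?_)
  rw [map_prod]
  exact Finset.prod_eq_zero (hP.mem_toFinset.2 hPc) (hfc c)

theorem SmoothCurve.Cover.injective {K : Type u} [Field K] [IsAlgClosed K] {C C' : SmoothCurve K}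
    (φ : C.Cover C') : Function.Injective φ.hom := by
  rw [injective_iff_map_eq_zero]
  intro r hr
  refine C.eq_of_forall_point φ.finite ?_
  rintro _ ⟨c', rfl⟩
  rw [AlgHom.comp_apply, hr, map_zero, map_zero]

theorem SmoothCurve.Cover.finite_preimage {K : Type u} [Field K] [IsAlgClosed K]
    {C C' : SmoothCurve K} (φ : C.Cover C') {P : (C.R →ₐ[K] K) → Prop} (hP : {c | ¬ P c}.Finite) :
    {c' : C'.R →ₐ[K] K | ¬ P (c'.comp φ.hom)}.Finite := by
  refine (hP.biUnion (t := fun c => {c' : C'.R →ₐ[K] K | c'.comp φ.hom = c})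
    fun c _ => ?_).subset fun c' hc' => Set.mem_biUnion hc' rfl
  obtain ⟨f, hf, hcf⟩ := C.exists_ne_zero_of_point c
  refine (C'.finite_zeros ((map_ne_zero_iff _ φ.injective).2 hf)).subset ?_
  rintro c' rfl
  exact not_not.2 hcf

section IsFiber

variable {K A R : Type u} [Field K] [CommRing A] [Algebra K A] [CommRing R] [Algebra K R]

variable (A) in
/-- `N` is the restriction of `H` to the point `c`. -/
def IsFiber (H : Type u) [AddCommGroup H] [Module A H] [Module R H] (c : R →ₐ[K] K) (N : Type u) [AddCommGroup N] [Module A N] : Prop :=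
  ∃ q : H →ₗ[A] N, Function.Surjective q ∧ (∀ r h, q (r • h) = algebraMap K A (c r) • q h) ∧
    ∀ h, q h = 0 → h ∈ (RingHom.ker c • ⊤ : Submodule R H)

variable {H : Type u} [AddCommGroup H] [Module A H] [Module R H] {c : R →ₐ[K] K} {N N' : Type u} [AddCommGroup N] [Module A N]
  [AddCommGroup N'] [Module A N']

theorem IsFiber.of_equiv (h : IsFiber A H c N) (e : N ≃ₗ[A] N') : IsFiber A H c N' := by
  obtain ⟨q, h1, h2, h3⟩ := h
  exact ⟨e.toLinearMap ∘ₗ q, e.surjective.comp h1, fun r z => by simp [h2], fun z hz =>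
    h3 z (e.injective (hz.trans (map_zero e).symm))⟩

theorem IsFiber.nonempty_equiv (h : IsFiber A H c N) (h' : IsFiber A H c N') :
    Nonempty (N ≃ₗ[A] N') := by
  obtain ⟨q, h1, h2, h3⟩ := h
  obtain ⟨q', h1', h2', h3'⟩ := h'
  have key : ∀ {N N' : Type u} [AddCommGroup N] [Module A N] [AddCommGroup N'] [Module A N']
      (q : H →ₗ[A] N) (q' : H →ₗ[A] N')
      (_ : ∀ r h, q' (r • h) = algebraMap K A (c r) • q' h)
      (_ : ∀ h, q h = 0 → h ∈ (RingHom.ker c • ⊤ : Submodule R H)),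
      LinearMap.ker q ≤ LinearMap.ker q' := by
    intro N N' _ _ _ _ q q' h2 h3 z hz
    exact Submodule.smul_induction_on (p := fun z => q' z = 0) (h3 z hz)
      (fun r hr n _ => by rw [h2, show c r = 0 from hr, map_zero, zero_smul])
      fun a b ha hb => by rw [map_add, ha, hb, add_zero]
  have h4 := le_antisymm (key q q' h2' h3) (key q' q h2 h3')
  exact ⟨(q.quotKerEquivOfSurjective h1).symm.trans
    ((Submodule.quotEquivOfEq _ _ h4).trans (q'.quotKerEquivOfSurjective h1'))⟩

end IsFiber

section

variable (K A R H : Type u) [Field K] [CommRing A] [Algebra (Ser K) A] [CommRing R]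
  [AddCommGroup H] [Module A H] [Module R H] [SMulCommClass A R H]

/-- The multiples of the two variables. -/
noncomputable def varsMultiples : Submodule R H :=
  LinearMap.range (DistribSMul.toLinearMap R H (algebraMap (Ser K) A x)) ⊔
    LinearMap.range (DistribSMul.toLinearMap R H (algebraMap (Ser K) A y))

variable {K A R H}

theorem mem_varsMultiples {h : H} : h ∈ varsMultiples K A R H ↔
    ∃ u v : H, h = algebraMap (Ser K) A x • u + algebraMap (Ser K) A y • v := by
  rw [varsMultiples, Submodule.mem_sup]
  constructor
  · rintro ⟨_, ⟨u, rfl⟩, _, ⟨v, rfl⟩, rfl⟩; exact ⟨u, v, rfl⟩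
  · rintro ⟨u, v, rfl⟩; exact ⟨_, ⟨u, rfl⟩, _, ⟨v, rfl⟩, rfl⟩

-- The m i lift a maximal independent family of the finite R-module H/(x,y)H, and f kills the
-- quotient by its span. The functions p and q record the remainders in the form needed for
-- `exists_expansion`.
variable (K A R H) in
theorem exists_generic_basis [IsDomain R] [Module.Finite R (H ⧸ varsMultiples K A R H)] :
    ∃ (d : ℕ) (m : Fin d → H) (f : R) (r : H → Fin d → R) (p q : H → H), f ≠ 0 ∧
      (∀ h, f • h = ∑ i, r h i • m i +
        (algebraMap (Ser K) A x • p h + algebraMap (Ser K) A y • q h)) ∧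
      ∀ t : Fin d → R, ∑ i, t i • m i ∈ varsMultiples K A R H → t = 0 := by
  obtain ⟨m, f, hm, hf, hz⟩ := exists_linearIndependent_smul_mem_span (R := R)
    (H := H ⧸ varsMultiples K A R H)
  choose n hn using fun i => Submodule.mkQ_surjective (varsMultiples K A R H) (m i)
  have h1 : ∀ h : H, ∃ (t : Fin (Module.finrank R (H ⧸ varsMultiples K A R H)) → R) (u v : H),
      f • h = ∑ i, t i • n i + (algebraMap (Ser K) A x • u + algebraMap (Ser K) A y • v) := by
    intro h
    obtain ⟨t, ht⟩ := (Submodule.mem_span_range_iff_exists_fun R).1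
      (hz (Submodule.mkQ (varsMultiples K A R H) h))
    have h2 : f • h - ∑ i, t i • n i ∈ varsMultiples K A R H := by
      refine (Submodule.Quotient.mk_eq_zero _).1 ?_
      change Submodule.mkQ (varsMultiples K A R H) _ = 0
      rw [map_sub, map_smul, ← ht, map_sum, sub_eq_zero]
      simp only [map_smul, hn]
    obtain ⟨u, v, huv⟩ := mem_varsMultiples.1 h2
    exact ⟨t, u, v, by rw [← huv]; abel⟩
  choose r p q h2 using h1
  refine ⟨_, n, f, r, p, q, hf, h2, fun t ht => ?_⟩
  have ht : Submodule.mkQ (varsMultiples K A R H) _ = 0 := (Submodule.Quotient.mk_eq_zero _).2 ht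
  rw [map_sum] at ht
  simp only [map_smul, hn] at ht
  exact funext (Fintype.linearIndependent_iff.1 hm t ht)

end

end SurfaceCM

namespace SurfaceCM

open Ser

section

variable {K A : Type u} [Field K] [CommRing A] [IsLocalRing A] [Algebra K A] [Algebra (Ser K) A]
  {R H : Type u} [CommRing R] [Algebra K R] [AddCommGroup H] [Module A H] [Module R H]
  [SMulCommClass A R H] {c : R →ₐ[K] K} {N : Type u} [AddCommGroup N] [Module A N]
  [Module (Ser K) N] [IsScalarTower (Ser K) A N]

theorem IsFiniteOverSer.algebraMap_smul_eq (hA : IsFiniteOverSer K A) (t : K) (w : N) :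
    algebraMap K A t • w = (MvPowerSeries.C t : Ser K) • w := by
  have := hA.tower
  rw [IsScalarTower.algebraMap_apply K (Ser K) A, algebraMap_smul]; rfl

/-- A generic basis of a module over a curve restricts to bases of its fibres. -/
theorem IsFiniteOverSer.exists_basis_fiber (hA : IsFiniteOverSer K A) (hN : IsCohenMacaulay A N)
    {q : H →ₗ[A] N} (hq : Function.Surjective q)
    (hqr : ∀ r h, q (r • h) = algebraMap K A (c r) • q h)
    (hqk : ∀ h, q h = 0 → h ∈ (RingHom.ker c • ⊤ : Submodule R H))
    {d : ℕ} {m : Fin d → H} {f : R} {r : H → Fin d → R} {p p' : H → H} (hcf : c f ≠ 0)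
    (hm : ∀ h, f • h = ∑ i, r h i • m i +
        (algebraMap (Ser K) A x • p h + algebraMap (Ser K) A y • p' h))
    (hm' : ∀ t : Fin d → R, ∑ i, t i • m i ∈ varsMultiples K A R H → t = 0) :
    ∃ B : Module.Basis (Fin d) (Ser K) N, ∀ i, B i = q (m i) := by
  obtain ⟨h1, h2⟩ := hA.isCohenMacaulay_iff.1 hN
  refine Ser.exists_basis (fun i => q (m i)) (fun w => ?_) fun t ht => ?_
  · obtain ⟨w, rfl⟩ := hq w
    have h3 := congrArg q (hm w)
    rw [hqr, hA.algebraMap_smul_eq, map_add, map_sum, map_add, map_smul, map_smul, algebraMap_smul,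
      algebraMap_smul] at h3
    simp only [hqr, hA.algebraMap_smul_eq] at h3
    refine ⟨fun i => MvPowerSeries.C (c f)⁻¹ * MvPowerSeries.C (c (r w i)),
      (MvPowerSeries.C (c f)⁻¹ : Ser K) • q (p w), (MvPowerSeries.C (c f)⁻¹ : Ser K) • q (p' w), ?_⟩
    have h4 := congrArg (fun w => (MvPowerSeries.C (c f)⁻¹ : Ser K) • w) h3
    rw [smul_smul, ← map_mul, inv_mul_cancel₀ hcf, map_one, one_smul] at h4
    rw [h4, smul_add, smul_add, Finset.smul_sum]
    simp only [smul_smul, mul_comm]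
  · obtain ⟨u, v, huv⟩ := ht
    obtain ⟨u, rfl⟩ := hq u
    obtain ⟨v, rfl⟩ := hq v
    have h3 : q (∑ i, algebraMap K R (t i) • m i -
        (algebraMap (Ser K) A x • u + algebraMap (Ser K) A y • v)) = 0 := by
      rw [map_sub, sub_eq_zero, map_add, map_smul, map_smul, algebraMap_smul, algebraMap_smul,
        ← huv, map_sum]
      refine Finset.sum_congr rfl fun i _ => ?_
      rw [hqr, AlgHom.commutes, Algebra.algebraMap_self_apply, hA.algebraMap_smul_eq]
    -- A relation modulo (x, y) in the fibre lifts to an element of (ker c)H. After multiplication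
    -- by f that element has coordinates a i vanishing at c; independence gives f t_i = a_i, hence
    -- c(f) t_i = 0.
    have h4 : ∀ w ∈ (RingHom.ker c • ⊤ : Submodule R H), ∃ a : Fin d → R, (∀ i, c (a i) = 0) ∧
        f • w - ∑ i, a i • m i ∈ varsMultiples K A R H := by
      intro w hw
      induction hw using Submodule.smul_induction_on' with
      | smul s hs w _ =>
        refine ⟨fun i => s * r w i, fun i => by rw [map_mul, show c s = 0 from hs, zero_mul], ?_⟩
        rw [smul_comm, hm, smul_add, Finset.smul_sum]
        simp only [smul_smul, add_sub_cancel_left]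
        exact Submodule.smul_mem _ _ (mem_varsMultiples.2 ⟨_, _, rfl⟩)
      | add w _ w' _ hw hw' =>
        obtain ⟨a, ha, ha'⟩ := hw
        obtain ⟨b, hb, hb'⟩ := hw'
        refine ⟨a + b, fun i => by rw [Pi.add_apply, map_add, ha, hb, add_zero], ?_⟩
        convert add_mem ha' hb' using 1
        simp only [Pi.add_apply, add_smul, Finset.sum_add_distrib, smul_add]
        abel
    obtain ⟨a, ha, ha'⟩ := h4 _ (hqk _ h3)
    have h5 := hm' (fun i => f * algebraMap K R (t i) - a i) (by
      have h6 := add_mem ha' (Submodule.smul_mem (varsMultiples K A R H) f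
        (mem_varsMultiples.2 ⟨u, v, rfl⟩))
      convert h6 using 1
      simp only [sub_smul, Finset.sum_sub_distrib, smul_sub, Finset.smul_sum, smul_smul]
      abel)
    funext i
    have h6 := congrArg c (congrFun h5 i)
    simp only [map_sub, map_mul, ha, AlgHom.commutes, Algebra.algebraMap_self_apply, sub_zero,
      Pi.zero_apply, map_zero] at h6
    exact (mul_eq_zero.1 h6).resolve_left hcf

end

/-- A module over a curve with Cohen-Macaulay fibres is generically given by matrices. -/
theorem IsFiniteOverSer.exists_matrixFamily {K A : Type u} [Field K] [IsAlgClosed K] [CommRing A]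
    [IsLocalRing A] [Algebra K A] [Algebra (Ser K) A] (hA : IsFiniteOverSer K A)
    (C : SmoothCurve K) (H : Type u) [AddCommGroup H] [Module A H] [Module C.R H]
    [SMulCommClass A C.R H] [Module.Finite C.R (H ⧸ varsMultiples K A C.R H)]
    (hH : {c : C.R →ₐ[K] K | ¬ ∃ N : ModuleCat.{u} A,
      IsFiber A H c N ∧ IsCohenMacaulay A N}.Finite) :
    ∃ (C' : SmoothCurve K) (φ : C.Cover C') (d : ℕ) (ρ : MatrixFamily K A C'.R d),
      {c' : C'.R →ₐ[K] K | ¬ IsFiber A H (c'.comp φ.hom) (ρ.map c').Mod}.Finite := by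
  obtain ⟨d, m, f, r, p, p', hf, hm, hm'⟩ := exists_generic_basis K A C.R H
  obtain ⟨C', φ, u, hu⟩ := C.exists_cover_isUnit hf
  obtain ⟨Φ, hΦ⟩ := Ser.exists_expansion p p' (fun h i => φ.hom (r h i)) (↑u⁻¹ : C'.R)
  -- Column j of μ a is the expansion of a m_j. Additivity and multiplicativity are not visible from
  -- the choices made, but at almost all points μ a specializes to the matrix of a in a basis of the
  -- fibre, and this determines series over C'.
  let μ : A → Matrix (Fin d) (Fin d) (Ser C'.R) := fun a => Matrix.of fun i j => Φ (a • m j) i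
  have key : ∀ c' : C'.R →ₐ[K] K, (∃ N : ModuleCat.{u} A,
      IsFiber A H (c'.comp φ.hom) N ∧ IsCohenMacaulay A N) →
      ∃ (N : ModuleCat.{u} A) (_ : Module (Ser K) N) (_ : IsScalarTower (Ser K) A N)
        (B : Module.Basis (Fin d) (Ser K) N), IsFiber A H (c'.comp φ.hom) N ∧
        ∀ a, matMap d (c' : C'.R →+* K) (μ a) =
          LinearMap.toMatrixAlgEquiv B (Algebra.lsmul (Ser K) (Ser K) N a) := by
    rintro c' ⟨N, hN, hN'⟩
    let _ : Module (Ser K) N := Module.compHom N (algebraMap (Ser K) A)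
    have : IsScalarTower (Ser K) A N := ⟨fun s a w => by
      rw [Algebra.smul_def, mul_smul]; rfl⟩
    have h0 := hN
    obtain ⟨q, hq, hqr, hqk⟩ := h0
    have hcf : c'.comp φ.hom f ≠ 0 := by
      change c' (φ.hom f) ≠ 0
      rw [← hu]
      exact (u.isUnit.map c').ne_zero
    obtain ⟨B, hB⟩ := hA.exists_basis_fiber hN' hq hqr hqk hcf hm hm'
    refine ⟨N, inferInstance, inferInstance, B, hN, fun a => ?_⟩
    have : Module.Finite (Ser K) N := (hA.isCohenMacaulay_iff.1 hN').1
    have h1 : ∀ z, q z = ∑ i, MvPowerSeries.map (c' : C'.R →+* K) (Φ z i) • B i := by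
      intro z
      rw [← sub_eq_zero]
      -- The value q z and its proposed expansion satisfy the same recursion, so their difference
      -- satisfies the homogeneous one.
      refine Ser.eq_zero_of_eq_add p p'
        (fun z => q z - ∑ i, MvPowerSeries.map (c' : C'.R →+* K) (Φ z i) • B i)
        (MvPowerSeries.C (c' ↑u⁻¹)) (fun z => ?_) z
      have hg : ∀ i, MvPowerSeries.map (c' : C'.R →+* K) (Φ z i) = MvPowerSeries.C (c' ↑u⁻¹) *
          (MvPowerSeries.C (c' (φ.hom (r z i))) +
            x * MvPowerSeries.map (c' : C'.R →+* K) (Φ (p z) i) +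
            y * MvPowerSeries.map (c' : C'.R →+* K) (Φ (p' z) i)) := by
        intro i
        rw [hΦ]
        simp
      have hqz : q z = (MvPowerSeries.C (c' ↑u⁻¹) : Ser K) •
          (∑ i, (MvPowerSeries.C (c' (φ.hom (r z i))) : Ser K) • B i +
            ((x : Ser K) • q (p z) + (y : Ser K) • q (p' z))) := by
        have h3 := congrArg (fun w => (MvPowerSeries.C (c' ↑u⁻¹) : Ser K) • q w) (hm z)
        have h4 : c' ↑u⁻¹ * c' (φ.hom f) = 1 := by
          rw [← hu, ← map_mul, Units.inv_mul, map_one]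
        rw [hqr, hA.algebraMap_smul_eq, smul_smul, ← map_mul, AlgHom.comp_apply, h4, map_one,
          one_smul, map_add, map_sum, map_add, map_smul, map_smul, algebraMap_smul,
          algebraMap_smul] at h3
        simp only [hqr, hA.algebraMap_smul_eq, ← hB] at h3
        exact h3
      rw [hqz]
      simp only [hg, mul_smul, add_smul, smul_add, Finset.sum_add_distrib, smul_sub,
        Finset.smul_sum]
      abel
    ext1 i j
    rw [LinearMap.toMatrixAlgEquiv_apply, Algebra.lsmul_apply, hB, ← map_smul, h1,
      Module.Basis.repr_sum_self]
    rfl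
  have hfin : {c' : C'.R →ₐ[K] K | ¬ ∃ N : ModuleCat.{u} A,
      IsFiber A H (c'.comp φ.hom) N ∧ IsCohenMacaulay A N}.Finite := φ.finite_preimage hH
  have hext : ∀ M M' : Matrix (Fin d) (Fin d) (Ser C'.R), (∀ c' : C'.R →ₐ[K] K,
      (∃ N : ModuleCat.{u} A, IsFiber A H (c'.comp φ.hom) N ∧ IsCohenMacaulay A N) →
      matMap d (c' : C'.R →+* K) M = matMap d (c' : C'.R →+* K) M') → M = M' := by
    intro M M' h
    ext i j n
    refine C'.eq_of_forall_point hfin fun c' hc' => ?_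
    have := congrArg (MvPowerSeries.coeff n) (congrFun (congrFun (h c' hc') i) j)
    rwa [matMap_apply, matMap_apply, MvPowerSeries.coeff_map, MvPowerSeries.coeff_map] at this
  let ρ : MatrixFamily K A C'.R d :=
    { hom :=
        { toFun := μ
          map_one' := hext _ _ fun c' hc' => by
            obtain ⟨N, _, _, B, hN, h⟩ := key c' hc'
            rw [h, map_one, map_one, map_one]
          map_mul' := fun a b => hext _ _ fun c' hc' => by
            obtain ⟨N, _, _, B, hN, h⟩ := key c' hc'
            rw [map_mul (matMap d (c' : C'.R →+* K)), h, h, h, map_mul, map_mul]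
          map_zero' := hext _ _ fun c' hc' => by
            obtain ⟨N, _, _, B, hN, h⟩ := key c' hc'
            rw [h, map_zero, map_zero, map_zero]
          map_add' := fun a b => hext _ _ fun c' hc' => by
            obtain ⟨N, _, _, B, hN, h⟩ := key c' hc'
            rw [map_add (matMap d (c' : C'.R →+* K)), h, h, h, map_add, map_add] }
      hom_algebraMap := fun s => hext _ _ fun c' hc' => by
        obtain ⟨N, _, _, B, hN, h⟩ := key c' hc'
        refine (h _).trans ?_
        rw [matMap_scalar, MvPowerSeries_map_map, c'.comp_algebraMap,
          MatrixFamily.map_id_algebraMap]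
        have h1 : Algebra.lsmul (Ser K) (Ser K) N (algebraMap (Ser K) A s) =
            algebraMap (Ser K) (Module.End (Ser K) N) s := by
          ext w
          rw [Algebra.lsmul_apply, algebraMap_smul, Module.algebraMap_end_apply]
        rw [h1, AlgEquiv.commutes]
        rfl }
  refine ⟨C', φ, d, ρ, hfin.subset fun c' hc' hN => hc' ?_⟩
  obtain ⟨N, _, _, B, hN, h⟩ := key c' hN
  refine hN.of_equiv (AddEquiv.toLinearEquiv (M₂ := (ρ.map c').Mod) B.equivFun.toAddEquiv
    fun a w => ?_)
  refine Eq.trans ?_ (MatrixFamily.smul_def _ a _).symm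
  rw [MatrixFamily.map_hom]
  change _ = (matMap d (c' : C'.R →+* K) (μ a)).mulVec (B.equivFun w)
  rw [h]
  exact (LinearMap.toMatrix_mulVec_repr B B (Algebra.lsmul (Ser K) (Ser K) N a) w).symm

end SurfaceCM

namespace SurfaceCM

open Ser

/-! ### Summands of families -/

section

variable {K A R : Type u} [Field K] [CommRing A] [Algebra (Ser K) A] [CommRing R]
  {H : Type u} [AddCommGroup H] [Module A H] [Module R H] [SMulCommClass A R H] [Module (Ser R) H]

theorem finite_quotient_varsMultiples [Module.Finite (Ser R) H]
    (hx : ∀ h : H, algebraMap (Ser K) A x • h = (x : Ser R) • h)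
    (hy : ∀ h : H, algebraMap (Ser K) A y • h = (y : Ser R) • h)
    (hr : ∀ (r : R) (h : H), (MvPowerSeries.C r : Ser R) • h = r • h) :
    Module.Finite R (H ⧸ varsMultiples K A R H) := by
  obtain ⟨n, g, hg⟩ := Module.Finite.exists_fin (R := Ser R) (M := H)
  refine ⟨?_⟩
  rw [Submodule.fg_iff_exists_fin_generating_family]
  refine ⟨n, fun i => Submodule.mkQ (varsMultiples K A R H) (g i), ?_⟩
  rw [eq_top_iff]
  rintro z -
  obtain ⟨z, rfl⟩ := Submodule.mkQ_surjective _ z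
  have hz : z ∈ Submodule.span (Ser R) (Set.range g) := by rw [hg]; exact Submodule.mem_top
  obtain ⟨s, rfl⟩ := (Submodule.mem_span_range_iff_exists_fun _).1 hz
  rw [map_sum]
  refine sum_mem fun i _ => ?_
  obtain ⟨u, v, huv⟩ := mem_vars_iff_exists.1 (C_constantCoeff_sub_mem (s i))
  have h1 : Submodule.mkQ (varsMultiples K A R H) (s i • g i) =
      MvPowerSeries.constantCoeff (s i) • Submodule.mkQ _ (g i) := by
    rw [← map_smul, ← sub_eq_zero, ← map_sub]
    refine (Submodule.Quotient.mk_eq_zero _).2 (mem_varsMultiples.2 ⟨u • g i, v • g i, ?_⟩)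
    rw [hx, hy, ← hr, ← sub_smul, huv, add_smul, mul_smul, mul_smul]
  rw [h1]
  exact Submodule.smul_mem _ _ (Submodule.subset_span ⟨i, rfl⟩)

theorem exists_sum_of_specialize_eq_zero {ι : Type*} [IsNoetherianRing R] {c : R →+* K}
    {Z : ι → Ser R} (hZ : specialize c Z = 0) :
    ∃ (n : ℕ) (p : Fin n → R) (g : Fin n → ι → Ser R), (∀ i, c (p i) = 0) ∧
      Z = ∑ i, p i • g i := by
  obtain ⟨n, p, hp, h⟩ := exists_sum_of_map_eq_zero (c := c) (IsNoetherian.noetherian _)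
  choose g hg using fun j => h (Z j) (congrFun hZ j)
  refine ⟨n, p, fun i j => g j i, hp, ?_⟩
  funext j
  rw [hg j, Finset.sum_apply]
  rfl

end

theorem specialize_mulVec {R K : Type*} [CommRing R] [Field K] {d : ℕ}
    (c : R →+* K) (M : Matrix (Fin d) (Fin d) (Ser R)) (v : Fin d → Ser R) :
    specialize c (M.mulVec v) = (matMap d c M).mulVec (specialize c v) := by
  funext i
  exact RingHom.map_mulVec (MvPowerSeries.map c) M v i

namespace MatrixFamily

section Total

variable {K A R : Type u} [Field K] [CommRing A] [Algebra (Ser K) A] [CommRing R] [Algebra K R]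
  {d : ℕ} (ρ : MatrixFamily K A R d)

/-- The module of all sections of the summand of a family defined by an idempotent. -/
def Range (e : ρ.centralizer) : Type u := LinearMap.range (Matrix.mulVecLin e.1)

variable {ρ} (e : ρ.centralizer)

noncomputable instance : AddCommGroup (ρ.Range e) :=
  inferInstanceAs (AddCommGroup (LinearMap.range (Matrix.mulVecLin e.1)))

noncomputable instance moduleSerRange : Module (Ser R) (ρ.Range e) :=
  inferInstanceAs (Module (Ser R) (LinearMap.range (Matrix.mulVecLin e.1)))

noncomputable instance moduleBaseRange : Module R (ρ.Range e) :=
  inferInstanceAs (Module R (LinearMap.range (Matrix.mulVecLin e.1)))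

instance [IsNoetherianRing R] : Module.Finite (Ser R) (ρ.Range e) :=
  inferInstanceAs (Module.Finite (Ser R) (LinearMap.range (Matrix.mulVecLin e.1)))

/-- The coordinates of a section. -/
noncomputable def Range.val : ρ.Range e →ₗ[Ser R] (Fin d → Ser R) :=
  (LinearMap.range (Matrix.mulVecLin e.1)).subtype

theorem Range.val_injective : Function.Injective (Range.val e) := Subtype.val_injective

/-- The section with given coordinates. -/
noncomputable def Range.mk : (Fin d → Ser R) →ₗ[Ser R] ρ.Range e :=
  (Matrix.mulVecLin e.1).rangeRestrict

theorem Range.val_mk (v : Fin d → Ser R) : Range.val e (Range.mk e v) = e.1.mulVec v := rfl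

theorem Range.val_smul_base (r : R) (v : ρ.Range e) :
    Range.val e (r • v) = r • Range.val e v := rfl

theorem mulVec_comm (a : A) (v : Fin d → Ser R) :
    (ρ.hom a).mulVec (e.1.mulVec v) = e.1.mulVec ((ρ.hom a).mulVec v) := by
  rw [Matrix.mulVec_mulVec, Matrix.mulVec_mulVec, mem_centralizer.1 e.2]

noncomputable instance : SMul A (ρ.Range e) where
  smul a v := ⟨(ρ.hom a).mulVec (Range.val e v), by
    obtain ⟨_, w, rfl⟩ := v
    exact ⟨(ρ.hom a).mulVec w, (mulVec_comm e a w).symm⟩⟩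

theorem Range.val_smul (a : A) (v : ρ.Range e) :
    Range.val e (a • v) = (ρ.hom a).mulVec (Range.val e v) := rfl

noncomputable instance : Module A (ρ.Range e) where
  one_smul v := Range.val_injective e (by rw [Range.val_smul, map_one, Matrix.one_mulVec])
  mul_smul a b v := Range.val_injective e (by
    rw [Range.val_smul, Range.val_smul, Range.val_smul, map_mul, Matrix.mulVec_mulVec])
  smul_zero a := Range.val_injective e (by rw [Range.val_smul, map_zero, Matrix.mulVec_zero])
  smul_add a v w := Range.val_injective e (by
    rw [Range.val_smul, map_add, map_add, Range.val_smul, Range.val_smul, Matrix.mulVec_add])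
  add_smul a b v := Range.val_injective e (by
    rw [map_add, Range.val_smul, Range.val_smul, Range.val_smul, map_add, Matrix.add_mulVec])
  zero_smul v := Range.val_injective e (by
    rw [Range.val_smul, map_zero, map_zero, Matrix.zero_mulVec])

instance : SMulCommClass A R (ρ.Range e) := ⟨fun a r v => Range.val_injective e (by
  rw [Range.val_smul, Range.val_smul_base, Range.val_smul_base, Range.val_smul, Matrix.mulVec_smul])⟩

theorem Range.algebraMap_smul (s : Ser K) (v : ρ.Range e) :
    algebraMap (Ser K) A s • v = MvPowerSeries.map (algebraMap K R) s • v :=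
  Range.val_injective e (by
    rw [Range.val_smul, map_smul, hom_algebraMap]
    funext i
    rw [Matrix.scalar_apply, Matrix.mulVec_diagonal]; rfl)

instance [IsNoetherianRing R] : Module.Finite R (ρ.Range e ⧸ varsMultiples K A R (ρ.Range e)) :=
  finite_quotient_varsMultiples
    (fun h => by rw [Range.algebraMap_smul, MvPowerSeries.map_X])
    (fun h => by rw [Range.algebraMap_smul, MvPowerSeries.map_X])
    (fun r h => Range.val_injective e (by
      rw [map_smul, Range.val_smul_base, smul_eq_C_smul]))

variable [Algebra K A] [IsScalarTower K (Ser K) A]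

/-- A section vanishing at c is a finite sum of vectors multiplied by functions vanishing at c.
Applying e to these vectors brings them into the image of e without changing the section. -/
theorem isFiber_range [IsNoetherianRing R] {e : ρ.centralizer} (he : e * e = e) (c : R →ₐ[K] K) :
    IsFiber A (ρ.Range e) c ((ρ.map c).Summand (ρ.centralizerMap c e)) := by
  have he' : ∀ v, e.1.mulVec (e.1.mulVec v) = e.1.mulVec v := fun v => by
    rw [Matrix.mulVec_mulVec]
    exact congrArg (fun z : ρ.centralizer => z.1.mulVec v) he
  have hval : ∀ v : ρ.Range e, e.1.mulVec (Range.val e v) = Range.val e v := by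
    rintro ⟨_, w, rfl⟩
    exact he' w
  let q : ρ.Range e →ₗ[A] (ρ.map c).Summand (ρ.centralizerMap c e) :=
    { toFun := fun v => ⟨specialize (c : R →+* K) (Range.val e v),
        specialize (c : R →+* K) (Range.val e v), by
          refine (specialize_mulVec (c : R →+* K) e.1 (Range.val e v)).symm.trans ?_
          rw [hval]⟩
      map_add' := fun v w => Subtype.ext
        ((congrArg (specialize (c : R →+* K)) (map_add (Range.val e) v w)).trans
          (specialize_add _ _ _))
      map_smul' := fun a v => Subtype.ext
        ((congrArg (specialize (c : R →+* K)) (Range.val_smul e a v)).trans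
          (specialize_mulVec _ _ _)) }
  refine ⟨q, ?_, ?_, ?_⟩
  · rintro ⟨_, w, rfl⟩
    choose g hg using Ser.map_surjective (c := (c : R →+* K)) fun k => ⟨algebraMap K R k, by simp⟩
    refine ⟨Range.mk e fun i => g (w i), Subtype.ext ?_⟩
    change specialize (c : R →+* K) (e.1.mulVec _) = _
    rw [specialize_mulVec]
    have : specialize (c : R →+* K) (fun i => g (w i)) = w := funext fun i => hg _
    rw [this]
    rfl
  · intro r v
    apply Subtype.ext
    change specialize (c : R →+* K) (Range.val e (r • v)) = algebraMap K A (c r) • (q v).1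
    rw [IsScalarTower.algebraMap_apply K (Ser K) A, algebraMap_smul_mod, Range.val_smul_base,
      smul_eq_C_smul, specialize_smul, MvPowerSeries.map_C]
    rfl
  · intro v hv
    obtain ⟨n, p, g, hp, hg⟩ := exists_sum_of_specialize_eq_zero (congrArg Subtype.val hv)
    have : v = ∑ i, p i • Range.mk e (g i) := by
      apply Range.val_injective
      rw [← hval, hg, map_sum, Matrix.mulVec_sum]
      refine Finset.sum_congr rfl fun i _ => ?_
      rw [Range.val_smul_base, Range.val_mk, Matrix.mulVec_smul]
    rw [this]
    exact sum_mem fun i _ => Submodule.smul_mem_smul (hp i) Submodule.mem_top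

end Total

end MatrixFamily

end SurfaceCM

namespace SurfaceCM

open Ser

/-! ### Indecomposable summands of the members of a family -/

section

variable {K A : Type u} [Field K] [IsAlgClosed K] [CommRing A] [IsLocalRing A] [Algebra K A]
  [Algebra (Ser K) A] {d : ℕ}

/-- A summand of a family is generically a family. -/
theorem MatrixFamily.exists_summand (hA : IsFiniteOverSer K A) (C : SmoothCurve K)
    (ρ : MatrixFamily K A C.R d) {e : ρ.centralizer} (he : e * e = e) :
    ∃ (C' : SmoothCurve K) (φ : C.Cover C') (d' : ℕ) (ρ' : MatrixFamily K A C'.R d'),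
      {c' : C'.R →ₐ[K] K | ¬ Nonempty ((ρ.map (c'.comp φ.hom)).Summand
        (ρ.centralizerMap (c'.comp φ.hom) e) ≃ₗ[A] (ρ'.map c').Mod)}.Finite := by
  have := hA.tower
  obtain ⟨C', φ, d', ρ', h⟩ := hA.exists_matrixFamily C (ρ.Range e) (by
    convert Set.finite_empty
    rw [Set.eq_empty_iff_forall_notMem]
    intro c hc
    exact hc ⟨ModuleCat.of A ((ρ.map c).Summand (ρ.centralizerMap c e)), isFiber_range he c,
      isCohenMacaulay_summand hA (by rw [← map_mul, he])⟩)
  exact ⟨C', φ, d', ρ', h.subset fun c' hc' hn => hc' ((isFiber_range he _).nonempty_equiv hn)⟩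

theorem SmoothCurve.exists_point_of_finite (C : SmoothCurve K) {P : (C.R →ₐ[K] K) → Prop}
    (hP : {c | ¬ P c}.Finite) : ∃ c, P c := by
  by_contra! h
  exact one_ne_zero (C.eq_of_forall_point hP fun c hc => absurd hc (h c))

/-- A nonzero vector from each image gives an independent family. -/
theorem card_le_of_orthogonalIdempotents {R : Type*} [CommRing R] [IsDomain R] {ι : Type*} [Fintype ι]
    {e : ι → Matrix (Fin d) (Fin d) R} (he : OrthogonalIdempotents e) (h0 : ∀ i, e i ≠ 0) :
    Fintype.card ι ≤ d := by
  have h1 : ∀ i, ∃ v, (e i).mulVec v ≠ 0 := by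
    intro i
    by_contra! h
    exact h0 i (Matrix.mulVec_injective (funext fun v => by rw [h, Matrix.zero_mulVec]))
  choose v hv using h1
  have h2 : LinearIndependent R fun i => (e i).mulVec (v i) := by
    rw [Fintype.linearIndependent_iff]
    intro t ht j
    have h3 := congrArg (e j).mulVec ht
    rw [Matrix.mulVec_sum, Matrix.mulVec_zero, Finset.sum_eq_single j] at h3
    · rw [Matrix.mulVec_smul, Matrix.mulVec_mulVec, (he.idem j).eq] at h3
      exact (smul_eq_zero.1 h3).resolve_right (hv j)
    · intro i _ hij
      rw [Matrix.mulVec_smul, Matrix.mulVec_mulVec, he.ortho hij.symm, Matrix.zero_mulVec, smul_zero]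
    · exact fun h => absurd (Finset.mem_univ _) h
  simpa using h2.fintype_card_le_finrank

/-- The indecomposable summands of almost all members of a family of rank `d` over the power series
are members of at most `d` families. -/
theorem MatrixFamily.exists_indecomposable_families (hA : IsFiniteOverSer K A) (C : SmoothCurve K)
    (ρ : MatrixFamily K A C.R d) :
    ∃ (n : ℕ) (D : Fin n → SmoothCurve K) (δ : Fin n → ℕ)
      (τ : ∀ i, MatrixFamily K A (D i).R (δ i)), n ≤ d ∧
      {c : C.R →ₐ[K] K | ¬ ∀ N : ModuleCat.{u} A, IsIndecomposableCM A N →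
        IsSummand A N (ρ.map c).Mod → ∃ (i : Fin n) (c' : (D i).R →ₐ[K] K),
          Nonempty (N ≃ₗ[A] ((τ i).map c').Mod)}.Finite := by
  have := hA.finite
  obtain ⟨C₁, φ, k, e, he, hfin⟩ := ρ.exists_primitive_decomposition C
  choose D ψ δ τ hτ using fun i => (ρ.map φ.hom).exists_summand hA C₁ (he.idem i).eq
  have h1 : {c : C₁.R →ₐ[K] K | ¬ ∀ i, ∃ c' : (D i).R →ₐ[K] K,
      Nonempty (((ρ.map φ.hom).map c).Summand ((ρ.map φ.hom).centralizerMap c (e i)) ≃ₗ[A]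
        ((τ i).map c').Mod)}.Finite := by
    refine (Set.finite_iUnion fun i => (ψ i).finite_of_finite (hτ i)).subset ?_
    intro c hc
    rw [Set.mem_ofPred_eq, not_forall] at hc
    obtain ⟨i, hi⟩ := hc
    refine Set.mem_iUnion.2 ⟨i, fun ⟨c', hc', h⟩ => hi ⟨c', ?_⟩⟩
    subst hc'
    exact h
  -- Summands of rank zero are dropped. The remaining idempotents are nonzero at a suitable point,
  -- so there are at most d of them.
  let J := {i : Fin k // δ i ≠ 0}
  have hJ : Fintype.card J ≤ d := by
    obtain ⟨c, hc⟩ := C₁.exists_point_of_finite h1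
    refine card_le_of_orthogonalIdempotents (R := Ser K)
      (e := fun i : J => (((ρ.map φ.hom).centralizerMap c (e i)) : Matrix (Fin d) (Fin d) (Ser K))) ?_ ?_
    · exact ((he.toOrthogonalIdempotents.map ((ρ.map φ.hom).centralizerMap c)).map
        ((ρ.map φ.hom).map c).centralizer.val.toRingHom).embedding ⟨Subtype.val, Subtype.val_injective⟩
    · rintro ⟨i, hi⟩ h0
      obtain ⟨c', ⟨f⟩⟩ := hc i
      have : Subsingleton (((ρ.map φ.hom).map c).Summand ((ρ.map φ.hom).centralizerMap c (e i))) := by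
        rw [Summand, show (ρ.map φ.hom).centralizerMap c (e i) = 0 from Subtype.ext h0, map_zero,
          LinearMap.range_zero]
        infer_instance
      have h2 : Subsingleton (Fin (δ i) → Ser K) := f.symm.toEquiv.subsingleton
      have h3 : Nonempty (Fin (δ i)) := ⟨⟨0, Nat.pos_of_ne_zero hi⟩⟩
      exact not_subsingleton _ h2
  let f := (Fintype.equivFin J).symm
  refine ⟨Fintype.card J, fun i => D (f i), fun i => δ (f i), fun i => τ (f i), hJ,
    (hfin.union (h1.image fun c => c.comp φ.hom)).subset ?_⟩
  intro c hc
  by_contra hn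
  rw [Set.mem_union, not_or, Set.mem_ofPred_eq, not_not] at hn
  obtain ⟨⟨c₁, rfl, hp⟩, hn⟩ := hn
  have h2 : ∀ i, ∃ c' : (D i).R →ₐ[K] K,
      Nonempty (((ρ.map φ.hom).map c₁).Summand ((ρ.map φ.hom).centralizerMap c₁ (e i)) ≃ₗ[A]
        ((τ i).map c').Mod) := by_contra fun h => hn ⟨c₁, h, rfl⟩
  refine hc fun N hN hNs => ?_
  have hNs : IsSummand A N ((ρ.map φ.hom).map c₁).Mod := by rw [map_map]; exact hNs
  obtain ⟨i, ⟨g⟩⟩ := exists_equiv_summand hA (he.map ((ρ.map φ.hom).centralizerMap c₁)) hp hN.1 hN.2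
    hNs
  obtain ⟨c', ⟨g'⟩⟩ := h2 i
  have hi : δ i ≠ 0 := by
    intro h0
    have := hN.2.1
    have h3 : Nontrivial (Fin (δ i) → Ser K) := (g.trans g').symm.toEquiv.nontrivial
    rw [h0] at h3
    exact not_subsingleton (Fin 0 → Ser K) inferInstance
  obtain ⟨j, hj⟩ := f.surjective ⟨i, hi⟩
  have hj' : i = (f j).1 := by rw [hj]
  subst hj'
  exact ⟨j, c', ⟨g.trans g'⟩⟩

end

end SurfaceCM

namespace SurfaceCM

open Ser

/-! ### Modules on the product and their fibres -/

theorem IsFiber.congr {K A R : Type u} [Field K] [CommRing A] [Algebra K A] [CommRing R]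
    [Algebra K R] {H H' : Type u} [AddCommGroup H] [Module A H] [Module R H]
    [AddCommGroup H'] [Module A H'] [Module R H'] {c : R →ₐ[K] K} {N : Type u} [AddCommGroup N]
    [Module A N] (h : IsFiber A H c N) (g : H' ≃ₗ[A] H) (hg : ∀ (r : R) z, g (r • z) = r • g z) :
    IsFiber A H' c N := by
  obtain ⟨q, h1, h2, h3⟩ := h
  let g' : H' ≃ₗ[R] H := { g with map_smul' := hg }
  refine ⟨q ∘ₗ g.toLinearMap, h1.comp g.surjective, fun r z => ?_, fun z hz => ?_⟩
  · change q (g (r • z)) = _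
    rw [hg, h2]; rfl
  · have h4 := Submodule.mem_map_of_mem (f := g'.symm.toLinearMap) (h3 _ hz)
    rw [Submodule.map_smul''] at h4
    have h5 : g'.symm (g z) = z := g.symm_apply_apply z
    rw [← h5]
    exact Submodule.smul_mono le_rfl le_top h4

section

variable {A R P : Type u} [CommRing A] [CommRing R] [CommRing P]

/-- A module over a ring `P` with maps from `A` and `R`, regarded with the actions of `A` and `R`. -/
def Sections (_l : A →+* P) (_r : R →+* P) (M : Type u) : Type u := M

namespace Sections

variable (l : A →+* P) (r : R →+* P) (M : Type u) [AddCommGroup M] [Module P M]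

instance : AddCommGroup (Sections l r M) := inferInstanceAs (AddCommGroup M)

instance : Module P (Sections l r M) := inferInstanceAs (Module P M)

instance moduleLeft : Module A (Sections l r M) := Module.compHom M l

instance moduleRight : Module R (Sections l r M) := Module.compHom M r

variable {M}

theorem left_smul_def (a : A) (m : Sections l r M) : a • m = l a • m := rfl

theorem right_smul_def (t : R) (m : Sections l r M) : t • m = r t • m := rfl

instance : SMulCommClass A R (Sections l r M) := ⟨fun a t m => by
  rw [left_smul_def, right_smul_def, right_smul_def, left_smul_def, smul_comm]⟩

end Sections

/-- The closed point given by a homomorphism to the ground field. -/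
def pointOfHom {K : Type u} [Field K] [Algebra K R] (c : R →ₐ[K] K) : MaximalSpectrum R :=
  ⟨RingHom.ker c, isMaximal_ker_point c⟩

open Sections in
theorem isFiber_sections {K : Type u} [Field K] [Algebra K R] [Algebra K A] {l : A →+* P}
    {r : R →+* P} (hlr : ∀ k, l (algebraMap K A k) = r (algebraMap K R k)) (M : Type u)
    [AddCommGroup M] [Module P M] (c : R →ₐ[K] K) :
    IsFiber A (Sections l r M) c ((ModuleCat.restrictScalars l).obj (ModuleCat.of P
      (M ⧸ ((RingHom.ker c).map r • (⊤ : Submodule P M))))) := by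
  let q : Sections l r M →ₗ[A] (ModuleCat.restrictScalars l).obj (ModuleCat.of P
      (M ⧸ ((RingHom.ker c).map r • (⊤ : Submodule P M)))) :=
    { toFun := fun m => (Submodule.Quotient.mk (p := (RingHom.ker c).map r •
        (⊤ : Submodule P M)) m)
      map_add' := fun _ _ => rfl
      map_smul' := fun _ _ => rfl }
  have hq : ∀ m, q m = 0 ↔ (m : M) ∈ ((RingHom.ker c).map r • (⊤ : Submodule P M)) :=
    fun m => Submodule.Quotient.mk_eq_zero _
  refine ⟨q, Submodule.Quotient.mk_surjective ((RingHom.ker c).map r • (⊤ : Submodule P M)),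
    fun t m => ?_, fun m hm => ?_⟩
  · rw [← map_smul, ← sub_eq_zero, ← map_sub, hq]
    have h1 : t • m - algebraMap K A (c t) • m = r (t - algebraMap K R (c t)) • m := by
      rw [left_smul_def, right_smul_def, hlr, map_sub, sub_smul]
    rw [h1]
    refine Submodule.smul_mem_smul (M := M) (Ideal.mem_map_of_mem _ ?_) Submodule.mem_top
    change c _ = 0
    simp
  · rw [hq] at hm
    refine Submodule.smul_induction_on (p := fun m : M =>
      (m : Sections l r M) ∈ (RingHom.ker c • ⊤ : Submodule R (Sections l r M))) hm ?_
      fun a b => add_mem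
    intro s hs m _
    have h1 : ∀ m : Sections l r M, s • m ∈ (RingHom.ker c • ⊤ : Submodule R (Sections l r M)) := by
      refine Submodule.span_induction (p := fun s _ => ∀ m : Sections l r M,
        s • m ∈ (RingHom.ker c • ⊤ : Submodule R (Sections l r M))) ?_ ?_ ?_ ?_ hs
      · rintro _ ⟨t, ht, rfl⟩ m
        exact Submodule.smul_mem_smul (r := t) ht (Submodule.mem_top (x := m))
      · intro m; rw [zero_smul]; exact zero_mem _
      · intro s t _ _ hs ht m; rw [add_smul]; exact add_mem (hs m) (ht m)
      · intro t s _ hs m; rw [smul_eq_mul, mul_comm, mul_smul]; exact hs _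
    exact h1 m

/-- A module is finite over the base if the functions on the zero locus of the variables are. -/
theorem finite_quotient_sections {K : Type u} [Field K] [Algebra (Ser K) A] {l : A →+* P}
    {r : R →+* P} {n : ℕ} (g : Fin n → P) (hg : ∀ s : P, ∃ (t : Fin n → R) (u v : P),
      s = ∑ i, r (t i) * g i + (l (algebraMap (Ser K) A x) * u + l (algebraMap (Ser K) A y) * v))
    (M : Type u) [AddCommGroup M] [Module P M] [Module.Finite P M] :
    Module.Finite R (Sections l r M ⧸ varsMultiples K A R (Sections l r M)) := by
  obtain ⟨k, m, hm⟩ := Module.Finite.exists_fin (R := P) (M := M)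
  let m' : Fin k → Sections l r M := m
  have h1 : ∀ z : Sections l r M, z ∈ Submodule.span R (Set.range fun p : Fin n × Fin k =>
      g p.1 • m' p.2) ⊔ varsMultiples K A R (Sections l r M) := by
    intro z
    have hz : z ∈ Submodule.span P (Set.range m') :=
      hm.ge (Submodule.mem_top (R := P) (M := M) (x := z))
    obtain ⟨s, rfl⟩ := (Submodule.mem_span_range_iff_exists_fun _).1 hz
    refine sum_mem fun i _ => ?_
    obtain ⟨t, u, v, h⟩ := hg (s i)
    rw [h, add_smul, Finset.sum_smul]
    refine Submodule.add_mem_sup (sum_mem fun j _ => ?_) (mem_varsMultiples.2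
      ⟨u • m' i, v • m' i, ?_⟩)
    · rw [mul_smul, ← Sections.right_smul_def]
      exact Submodule.smul_mem _ _ (Submodule.subset_span ⟨(j, i), rfl⟩)
    · rw [add_smul, mul_smul, mul_smul]; rfl
  refine ⟨Submodule.fg_def.2 ⟨Submodule.mkQ _ '' (Set.range fun p : Fin n × Fin k =>
      g p.1 • m' p.2), (Set.finite_range _).image _, ?_⟩⟩
  rw [← Submodule.map_span, eq_top_iff]
  rintro w -
  obtain ⟨z, rfl⟩ := Submodule.mkQ_surjective _ w
  obtain ⟨z1, hz1, z2, hz2, rfl⟩ := Submodule.mem_sup.1 (h1 z)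
  refine ⟨z1, hz1, ?_⟩
  rw [map_add, left_eq_add]
  exact (Submodule.Quotient.mk_eq_zero _).2 hz2

end

section

variable {K A : Type u} [Field K] [CommRing A] [IsLocalRing A] [Algebra K A]
  {R : Type u} [CommRing R] [Algebra K R]

variable (A R) in
theorem leftMap_algebraMap (k : K) :
    leftMap K A R (algebraMap K A k) = rightMap K A R (algebraMap K R k) := by
  change algebraMap (A ⊗[K] R) (ProductRing K A R) (algebraMap K A k ⊗ₜ 1) =
    algebraMap (A ⊗[K] R) (ProductRing K A R) (1 ⊗ₜ algebraMap K R k)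
  rw [Algebra.algebraMap_eq_smul_one (A := A), Algebra.algebraMap_eq_smul_one (A := R),
    TensorProduct.smul_tmul]

/-- A module on the product, with its two actions. -/
abbrev ProductSections (M : ModuleCat.{u} (ProductRing K A R)) : Type u :=
  Sections (leftMap K A R) (rightMap K A R) M

theorem isFiber_fiberModule (M : ModuleCat.{u} (ProductRing K A R)) (c : R →ₐ[K] K) :
    IsFiber A (ProductSections M) c (fiberModule K A M (pointOfHom c)) :=
  isFiber_sections (leftMap_algebraMap A R) M c

variable [Algebra (Ser K) A]

/-- Modulo (x, y), generators of A over K[[x,y]] generate A ⊗ R over R. An element of the completion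
differs from one of A ⊗ R by an element of I^k times the completion, where finite generation of I is
used, and I^k ⊆ (x, y). -/
theorem exists_generators_productRing (hA : IsFiniteOverSer K A) :
    ∃ (n : ℕ) (g : Fin n → ProductRing K A R), ∀ s, ∃ (t : Fin n → R) (u v : ProductRing K A R),
      s = ∑ i, rightMap K A R (t i) * g i + (leftMap K A R (algebraMap (Ser K) A x) * u +
        leftMap K A R (algebraMap (Ser K) A y) * v) := by
  have := hA.finite
  have := hA.tower
  have := hA.sing.isNoetherianRing
  obtain ⟨n, a, ha⟩ := Module.Finite.exists_fin (R := Ser K) (M := A)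
  obtain ⟨k, hk⟩ := hA.exists_pow_le
  let l := leftMap K A R
  let r := rightMap K A R
  let Q : ProductRing K A R → Prop := fun s => ∃ (t : Fin n → R) (u v : ProductRing K A R),
      s = ∑ i, r (t i) * l (a i) + (l (algebraMap (Ser K) A x) * u + l (algebraMap (Ser K) A y) * v)
  have hadd : ∀ s s', Q s → Q s' → Q (s + s') := by
    rintro _ _ ⟨t, u, v, rfl⟩ ⟨t', u', v', rfl⟩
    refine ⟨t + t', u + u', v + v', ?_⟩
    simp only [Pi.add_apply, map_add, add_mul, Finset.sum_add_distrib, mul_add]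
    abel
  have hmul : ∀ (b : R) s, Q s → Q (r b * s) := by
    rintro b _ ⟨t, u, v, rfl⟩
    refine ⟨fun i => b * t i, r b * u, r b * v, ?_⟩
    simp only [map_mul, mul_add, Finset.mul_sum]
    congr 1
    · exact Finset.sum_congr rfl fun i _ => by ring
    · ring
  have hl : ∀ b : A, Q (l b) := by
    intro b
    have hb : b ∈ Submodule.span (Ser K) (Set.range a) := by rw [ha]; exact Submodule.mem_top
    obtain ⟨s, rfl⟩ := (Submodule.mem_span_range_iff_exists_fun _).1 hb
    have h1 : ∀ i, ∃ u v, s i = MvPowerSeries.C (MvPowerSeries.constantCoeff (s i)) +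
        (x * u + y * v) := fun i => by
      obtain ⟨u, v, h⟩ := mem_vars_iff_exists.1 (C_constantCoeff_sub_mem (s i))
      exact ⟨u, v, by rw [← h]; ring⟩
    choose u v huv using h1
    refine ⟨fun i => algebraMap K R (MvPowerSeries.constantCoeff (s i)),
      ∑ i, l (algebraMap (Ser K) A (u i) * a i), ∑ i, l (algebraMap (Ser K) A (v i) * a i), ?_⟩
    rw [Finset.mul_sum, Finset.mul_sum, ← Finset.sum_add_distrib, ← Finset.sum_add_distrib, map_sum]
    refine Finset.sum_congr rfl fun i _ => ?_
    have h2 : r (algebraMap K R (MvPowerSeries.constantCoeff (s i))) =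
        l (algebraMap (Ser K) A (MvPowerSeries.C (MvPowerSeries.constantCoeff (s i)))) := by
      rw [← leftMap_algebraMap A R, IsScalarTower.algebraMap_apply K (Ser K) A]; rfl
    rw [h2, Algebra.smul_def]
    conv_lhs => rw [huv i]
    simp only [map_add, map_mul]
    ring
  have hT : ∀ t : A ⊗[K] R, Q (algebraMap (A ⊗[K] R) (ProductRing K A R) t) := by
    intro t
    induction t using TensorProduct.induction_on with
    | zero => rw [map_zero, ← map_zero l]; exact hl 0
    | tmul b b' =>
      have : algebraMap (A ⊗[K] R) (ProductRing K A R) (b ⊗ₜ b') = r b' * l b := by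
        change _ = algebraMap (A ⊗[K] R) (ProductRing K A R) (1 ⊗ₜ b') *
          algebraMap (A ⊗[K] R) (ProductRing K A R) (b ⊗ₜ 1)
        rw [← map_mul, Algebra.TensorProduct.tmul_mul_tmul, one_mul, mul_one]
      rw [this]
      exact hmul _ _ (hl b)
    | add t t' ht ht' => rw [map_add]; exact hadd _ _ ht ht'
  refine ⟨n, fun i => l (a i), fun s => ?_⟩
  have hI : (extendedMaximalIdeal K A R).FG :=
    Ideal.FG.map (IsNoetherian.noetherian (IsLocalRing.maximalIdeal A)) _
  obtain ⟨t, ht⟩ := Submodule.Quotient.mk_surjective _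
    (AdicCompletion.eval (extendedMaximalIdeal K A R) (A ⊗[K] R) k s)
  have h1 : s - algebraMap (A ⊗[K] R) (ProductRing K A R) t ∈
      (extendedMaximalIdeal K A R ^ k • ⊤ : Submodule (A ⊗[K] R) (ProductRing K A R)) := by
    rw [AdicCompletion.pow_smul_top_eq_ker_eval hI, LinearMap.mem_ker, map_sub, ← ht, sub_eq_zero]
    rfl
  have h2 : extendedMaximalIdeal K A R ^ k ≤ Ideal.span {algebraMap (Ser K) A x ⊗ₜ 1,
      algebraMap (Ser K) A y ⊗ₜ 1} := by
    rw [← Ideal.map_pow]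
    refine (Ideal.map_mono hk).trans ?_
    rw [Ideal.map_span, Set.image_pair]
    exact le_rfl
  have h3 : ∃ u v : ProductRing K A R, s - algebraMap (A ⊗[K] R) (ProductRing K A R) t =
      l (algebraMap (Ser K) A x) * u + l (algebraMap (Ser K) A y) * v := by
    refine Submodule.smul_induction_on h1 (fun w hw z _ => ?_) ?_
    · obtain ⟨p, q, rfl⟩ := Ideal.mem_span_pair.1 (h2 hw)
      refine ⟨algebraMap (A ⊗[K] R) (ProductRing K A R) p * z,
        algebraMap (A ⊗[K] R) (ProductRing K A R) q * z, ?_⟩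
      rw [Algebra.smul_def, map_add, map_mul, map_mul]
      change _ = algebraMap (A ⊗[K] R) (ProductRing K A R) (algebraMap (Ser K) A x ⊗ₜ 1) * _ +
        algebraMap (A ⊗[K] R) (ProductRing K A R) (algebraMap (Ser K) A y ⊗ₜ 1) * _
      ring
    · rintro _ _ ⟨u, v, rfl⟩ ⟨u', v', rfl⟩
      exact ⟨u + u', v + v', by ring⟩
  obtain ⟨u, v, h⟩ := h3
  obtain ⟨b, u', v', h'⟩ := hT t
  refine ⟨b, u' + u, v' + v, ?_⟩
  rw [sub_eq_iff_eq_add] at h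
  rw [h, h']
  ring

/-- A coherent module on the product is finite over the base modulo the variables. -/
theorem finite_quotient_productSections (hA : IsFiniteOverSer K A)
    (M : ModuleCat.{u} (ProductRing K A R)) [Module.Finite (ProductRing K A R) M] :
    Module.Finite R (ProductSections M ⧸ varsMultiples K A R (ProductSections M)) := by
  obtain ⟨n, g, hg⟩ := exists_generators_productRing (R := R) hA
  exact finite_quotient_sections g hg M

end

end SurfaceCM

namespace SurfaceCM

open Ser

/-! ### Families of Cohen-Macaulay modules defined by matrices -/

section

variable {T S H : Type*} [CommRing T] [CommRing S] [AddCommGroup H] [Module T H] [Module S H]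
  {a b : T} {x y : S}

theorem mem_span_pair_pow_smul (hx : ∀ h : H, a • h = x • h) (hy : ∀ h : H, b • h = y • h) {n : ℕ}
    {h : H} (hh : h ∈ ((Ideal.span {a, b}) ^ n • ⊤ : Submodule T H)) :
    h ∈ ((Ideal.span {x, y}) ^ n • ⊤ : Submodule S H) := by
  induction n generalizing h with
  | zero => simp
  | succ n ih =>
    rw [pow_succ', Submodule.mul_smul] at hh ⊢
    refine Submodule.smul_induction_on hh (fun w hw z hz => ?_) fun _ _ => add_mem
    obtain ⟨p, q, rfl⟩ := Ideal.mem_span_pair.1 hw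
    rw [add_smul, mul_comm, mul_comm q, mul_smul, mul_smul, hx, hy]
    exact add_mem
      (Submodule.smul_mem_smul (Ideal.subset_span (by simp)) (ih (Submodule.smul_mem _ _ hz)))
      (Submodule.smul_mem_smul (Ideal.subset_span (by simp)) (ih (Submodule.smul_mem _ _ hz)))

/-- The ideals I and (a, b) define the same topology on H, and a, b act as x, y. -/
theorem isAdicComplete_of_span_pair (hx : ∀ h : H, a • h = x • h) (hy : ∀ h : H, b • h = y • h)
    [IsAdicComplete (Ideal.span {x, y}) H] {I : Ideal T} {k : ℕ} (hk : I ^ k ≤ Ideal.span {a, b})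
    (hI : Ideal.span {a, b} ≤ I) : IsAdicComplete I H := by
  have h1 : ∀ n, ∀ h ∈ (I ^ (k * n) • ⊤ : Submodule T H),
      h ∈ ((Ideal.span {x, y}) ^ n • ⊤ : Submodule S H) := fun n h hh =>
    mem_span_pair_pow_smul hx hy (Submodule.smul_mono_left
      (by rw [pow_mul]; exact Ideal.pow_right_mono hk n) hh)
  have h2 : ∀ n, ∀ h ∈ ((Ideal.span {x, y}) ^ n • ⊤ : Submodule S H),
      h ∈ (I ^ n • ⊤ : Submodule T H) := fun n h hh =>
    Submodule.smul_mono_left (Ideal.pow_right_mono hI n)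
      (mem_span_pair_pow_smul (fun h => (hx h).symm) (fun h => (hy h).symm) hh)
  -- Passing from k to k + 1 makes this inequality hold also if k = 0.
  have hk0 : ∀ n, n ≤ (k + 1) * n := fun n => Nat.le_mul_of_pos_left n (Nat.succ_pos k)
  have h1 : ∀ n, ∀ h ∈ (I ^ ((k + 1) * n) • ⊤ : Submodule T H),
      h ∈ ((Ideal.span {x, y}) ^ n • ⊤ : Submodule S H) := fun n h hh => h1 n h
    (Submodule.smul_mono_left (Ideal.pow_le_pow_right (Nat.mul_le_mul_right n (Nat.le_succ k))) hh)
  refine { haus' := fun h hh => ?_, prec' := fun f hf => ?_ }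
  · refine IsHausdorff.haus (I := Ideal.span {x, y}) inferInstance h fun n => ?_
    rw [SModEq.zero]
    exact h1 n h (SModEq.zero.1 (hh _))
  · obtain ⟨L, hL⟩ := IsPrecomplete.prec (I := Ideal.span {x, y}) inferInstance
      (f := fun n => f ((k + 1) * n)) fun {m n} hmn => by
        rw [SModEq.sub_mem]
        exact h1 m _ (SModEq.sub_mem.1 (hf (Nat.mul_le_mul_left (k + 1) hmn)))
    refine ⟨L, fun n => (hf (hk0 n)).trans ?_⟩
    rw [SModEq.sub_mem]
    exact h2 n _ (SModEq.sub_mem.1 (hL n))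

theorem finite_adicCompletion {I : Ideal T} {n : ℕ} (g : Fin n → H)
    (hg : ∀ h, ∃ t : Fin n → T, h - ∑ i, t i • g i ∈ (I • ⊤ : Submodule T H)) :
    Module.Finite (AdicCompletion I T) (AdicCompletion I H) := by
  let f : (Fin n → T) →ₗ[T] H := Fintype.linearCombination T g
  have hf : Function.Surjective (AdicCompletion.map I f) := by
    apply AdicCompletion.map_surjective_of_mkQ_comp_surjective
    intro z
    obtain ⟨z, rfl⟩ := Submodule.mkQ_surjective _ z
    obtain ⟨t, ht⟩ := hg z
    refine ⟨t, ?_⟩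
    rw [LinearMap.comp_apply, Fintype.linearCombination_apply, eq_comm, ← sub_eq_zero, ← map_sub]
    exact (Submodule.Quotient.mk_eq_zero _).2 ht
  have := Module.Finite.equiv (AdicCompletion.piEquivFin I n).symm
  exact Module.Finite.of_surjective _ hf

end

section

variable {K A : Type u} [Field K] [IsAlgClosed K] [CommRing A] [IsLocalRing A] [Algebra K A]
  [Algebra (Ser K) A]

-- Finite over R[[x,y]], the module H is already complete for the ideal generated by the maximal
-- ideal of A, so it equals its completion and becomes a module on the product. Finiteness is
-- checked modulo (x, y), while flatness and fibres are those of H. Closed points are homomorphisms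
-- to K since K is algebraically closed.
attribute [local instance] TensorProduct.Algebra.module in
theorem IsFiniteOverSer.exists_cmFamily (hA : IsFiniteOverSer K A) (C : SmoothCurve K)
    (H : Type u) [AddCommGroup H] [Module A H] [Module C.R H] [SMulCommClass A C.R H]
    [Module (Ser C.R) H] [Module.Finite (Ser C.R) H] [Module.Flat C.R H]
    (hs : ∀ (s : Ser K) (h : H), algebraMap (Ser K) A s • h =
      MvPowerSeries.map (algebraMap K C.R) s • h)
    (hr : ∀ (r : C.R) (h : H), (MvPowerSeries.C r : Ser C.R) • h = r • h)
    (hH : ∀ c : C.R →ₐ[K] K, ∃ N : ModuleCat.{u} A, IsFiber A H c N ∧ IsCohenMacaulay A N) :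
    ∃ (F : CMFamily K A) (p : MaximalSpectrum F.R ≃ (C.R →ₐ[K] K)), ∀ m, ∀ N : ModuleCat.{u} A,
      IsFiber A H (p m) N → Nonempty (N ≃ₗ[A] F.fiber m) := by
  have := hA.tower
  have hKA : ∀ (k : K) (h : H), algebraMap K A k • h = algebraMap K C.R k • h := by
    intro k h
    rw [IsScalarTower.algebraMap_apply K (Ser K) A, hs, ← hr]
    congr 1
    exact MvPowerSeries.map_C _ _
  let _ : Module K H := Module.compHom H (algebraMap K A)
  have : IsScalarTower K A H := ⟨fun k a h => by rw [Algebra.smul_def, mul_smul]; rfl⟩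
  have : IsScalarTower K C.R H := ⟨fun k r h => by
    rw [Algebra.smul_def, mul_smul, ← hKA]; rfl⟩
  let I := extendedMaximalIdeal K A C.R
  have hx : ∀ h : H, (algebraMap (Ser K) A x ⊗ₜ[K] (1 : C.R)) • h = (x : Ser C.R) • h := fun h => by
    rw [TensorProduct.Algebra.smul_def, one_smul, hs, MvPowerSeries.map_X]
  have hy : ∀ h : H, (algebraMap (Ser K) A y ⊗ₜ[K] (1 : C.R)) • h = (y : Ser C.R) • h := fun h => by
    rw [TensorProduct.Algebra.smul_def, one_smul, hs, MvPowerSeries.map_X]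
  have hspan : Ideal.span {algebraMap (Ser K) A x ⊗ₜ[K] (1 : C.R),
      algebraMap (Ser K) A y ⊗ₜ[K] (1 : C.R)} =
      (Ideal.span {algebraMap (Ser K) A x, algebraMap (Ser K) A y}).map
        (algebraMap A (A ⊗[K] C.R)) := by
    rw [Ideal.map_span, Set.image_pair]; rfl
  have hspanI : Ideal.span {algebraMap (Ser K) A x ⊗ₜ[K] (1 : C.R),
      algebraMap (Ser K) A y ⊗ₜ[K] (1 : C.R)} ≤ I := by
    rw [hspan]
    refine Ideal.map_mono (Ideal.span_le.2 ?_)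
    rintro _ (rfl | rfl)
    exacts [hA.algebraMap_X_mem 0, hA.algebraMap_X_mem 1]
  have hI : IsAdicComplete I H := by
    obtain ⟨k, hk⟩ := hA.exists_pow_le
    have h1 : IsAdicComplete (Ideal.span {x, y} : Ideal (Ser C.R)) H := by
      rw [← vars_eq]
      exact isAdicComplete_of_finite _ _
    refine isAdicComplete_of_span_pair hx hy (k := k) ?_ hspanI
    rw [← Ideal.map_pow, hspan]
    exact Ideal.map_mono hk
  let g : H ≃ₗ[A ⊗[K] C.R] AdicCompletion I H := AdicCompletion.ofLinearEquiv I H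
  let M : ModuleCat.{u} (ProductRing K A C.R) := ModuleCat.of (ProductRing K A C.R)
    (AdicCompletion I H)
  let gA : ProductSections M ≃ₗ[A] H := AddEquiv.toLinearEquiv g.symm.toAddEquiv fun a z => by
    obtain ⟨h, rfl⟩ := g.surjective z
    have h1 : leftMap K A C.R a • g h = g (a • h) := by
      have h2 := g.map_smul (a ⊗ₜ[K] (1 : C.R)) h
      rw [TensorProduct.Algebra.smul_def, one_smul] at h2
      rw [h2]
      exact algebraMap_smul (ProductRing K A C.R) (a ⊗ₜ[K] (1 : C.R)) (g h)
    change g.symm (leftMap K A C.R a • g h) = a • g.symm (g h)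
    rw [h1, g.symm_apply_apply, g.symm_apply_apply]
  have hgR : ∀ (r : C.R) z, gA (r • z) = r • gA z := by
    intro r z
    obtain ⟨h, rfl⟩ := g.surjective z
    have h1 : rightMap K A C.R r • g h = g (r • h) := by
      have h2 := g.map_smul ((1 : A) ⊗ₜ[K] r) h
      rw [TensorProduct.Algebra.smul_def, one_smul] at h2
      rw [h2]
      exact algebraMap_smul (ProductRing K A C.R) ((1 : A) ⊗ₜ[K] r) (g h)
    change g.symm (rightMap K A C.R r • g h) = r • g.symm (g h)
    rw [h1, g.symm_apply_apply, g.symm_apply_apply]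
  have hfib : ∀ (c : C.R →ₐ[K] K) (N : ModuleCat.{u} A), IsFiber A H c N →
      Nonempty (N ≃ₗ[A] fiberModule K A M (pointOfHom c)) := fun c N hN =>
    (hN.congr gA hgR).nonempty_equiv (isFiber_fiberModule M c)
  let p' : (C.R →ₐ[K] K) ≃ MaximalSpectrum C.R := Equiv.ofBijective pointOfHom (by
    refine ⟨fun c c' h => point_ext fun r hr => ?_, fun m => ?_⟩
    · have h1 : RingHom.ker c = RingHom.ker c' := congrArg MaximalSpectrum.asIdeal h
      have h2 : r ∈ RingHom.ker c := hr
      rwa [h1] at h2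
    · have := m.isMaximal
      obtain ⟨c, hc⟩ := exists_point_of_isMaximal (K := K) m.asIdeal
      exact ⟨c, MaximalSpectrum.ext hc⟩)
  let p := p'.symm
  have hp : ∀ m, pointOfHom (p m) = m := fun m => p'.apply_symm_apply m
  refine ⟨⟨C.R, C.smooth, C.isDomain, C.ringKrullDim_eq, M, ?_, ?_, fun m => ?_⟩, p,
    fun m N hN => ?_⟩
  · have h1 := finite_quotient_varsMultiples (K := K) (A := A) (R := C.R) (H := H)
      (fun h => by rw [hs, MvPowerSeries.map_X]) (fun h => by rw [hs, MvPowerSeries.map_X]) hr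
    obtain ⟨n, w, hw⟩ := Module.Finite.exists_fin (R := C.R) (M := H ⧸ varsMultiples K A C.R H)
    choose v hv using fun i => Submodule.mkQ_surjective (varsMultiples K A C.R H) (w i)
    refine finite_adicCompletion v fun h => ?_
    have h2 : Submodule.mkQ (varsMultiples K A C.R H) h ∈ Submodule.span C.R (Set.range w) := by
      rw [hw]; exact Submodule.mem_top
    obtain ⟨t, ht⟩ := (Submodule.mem_span_range_iff_exists_fun _).1 h2
    have h3 : Submodule.mkQ (varsMultiples K A C.R H) (h - ∑ i, t i • v i) = 0 := by
      rw [map_sub, map_sum, ← ht, sub_eq_zero]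
      exact Finset.sum_congr rfl fun i _ => by rw [map_smul, hv]
    obtain ⟨u, u', h4⟩ := mem_varsMultiples.1 ((Submodule.Quotient.mk_eq_zero _).1 h3)
    refine ⟨fun i => 1 ⊗ₜ t i, ?_⟩
    simp only [TensorProduct.Algebra.smul_def, one_smul]
    rw [h4]
    have h5 : ∀ (a : A) (z : H), a • z = (a ⊗ₜ[K] (1 : C.R)) • z := fun a z => by
      rw [TensorProduct.Algebra.smul_def, one_smul]
    rw [h5, h5]
    exact add_mem
      (Submodule.smul_mem_smul (hspanI (Ideal.subset_span (by simp))) Submodule.mem_top)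
      (Submodule.smul_mem_smul (hspanI (Ideal.subset_span (by simp))) Submodule.mem_top)
  · let gR : ProductSections M ≃ₗ[C.R] H := AddEquiv.toLinearEquiv gA.toAddEquiv hgR
    exact Module.Flat.of_linearEquiv gR
  · obtain ⟨N, hN, hN'⟩ := hH (p m)
    obtain ⟨e⟩ := hfib _ _ hN
    rw [hp] at e
    exact hA.isCohenMacaulay_congr hN' e.symm
  · obtain ⟨e⟩ := hfib _ _ hN
    rw [hp] at e
    exact ⟨e⟩

theorem MatrixFamily.exists_cmFamily (hA : IsFiniteOverSer K A) (C : SmoothCurve K) {d : ℕ}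
    (ρ : MatrixFamily K A C.R d) :
    ∃ (F : CMFamily K A) (p : MaximalSpectrum F.R ≃ (C.R →ₐ[K] K)), ∀ m,
      Nonempty ((ρ.map (p m)).Mod ≃ₗ[A] F.fiber m) := by
  have := hA.tower
  have h1 : ∀ c : C.R →ₐ[K] K, IsFiber A (ρ.Range 1) c (ρ.map c).Mod := fun c => by
    have h2 := isFiber_range (ρ := ρ) (e := 1) (one_mul 1) c
    rw [map_one, Summand, map_one] at h2
    exact h2.of_equiv (LinearEquiv.ofTop _ LinearMap.range_id)
  have : Module.Flat C.R (ρ.Range 1) := by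
    have h2 : Module.Flat C.R (Ser C.R) := Ser.flat
    have h3 : Module.Flat C.R (Fin d → Ser C.R) :=
      Module.Flat.of_linearEquiv ((Finsupp.linearEquivFunOnFinite C.R (Ser C.R) (Fin d)).symm.trans
        (finsuppLEquivDirectSum C.R (Ser C.R) (Fin d)))
    let g : ρ.Range 1 ≃ₗ[C.R] (Fin d → Ser C.R) :=
      LinearEquiv.ofBijective (
        { toFun := Range.val 1
          map_add' := map_add _
          map_smul' := Range.val_smul_base 1 } : ρ.Range 1 →ₗ[C.R] (Fin d → Ser C.R))
        ⟨Range.val_injective _, fun v => ⟨Range.mk 1 v, Matrix.one_mulVec v⟩⟩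
    exact Module.Flat.of_linearEquiv g
  obtain ⟨F, p, hp⟩ := hA.exists_cmFamily C (ρ.Range 1)
    (fun s h => Range.algebraMap_smul _ s h)
    (fun r h => Range.val_injective _ (by rw [map_smul, Range.val_smul_base, smul_eq_C_smul]))
    fun c => ⟨ModuleCat.of A (ρ.map c).Mod, h1 c, isCohenMacaulay_mod hA⟩
  exact ⟨F, p, fun m => hp m (ModuleCat.of A (ρ.map (p m)).Mod) (h1 _)⟩

end

end SurfaceCM

namespace SurfaceCM

open Ser

/-! ### Noether normalization -/

section

variable {K B : Type u} [Field K] [CommRing B] [IsLocalRing B] [Algebra K B]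

/-- An ideal of height two contains an ideal with two generators and height at least two, which is
here primary to the maximal ideal. If a were zero, the principal ideal (b) would have height two,
against Krull's principal ideal theorem. -/
theorem IsNormalSurfaceSingularity.exists_parameters (hB : IsNormalSurfaceSingularity K B) :
    ∃ (a b : B) (k : ℕ), a ∈ IsLocalRing.maximalIdeal B ∧ b ∈ IsLocalRing.maximalIdeal B ∧
      IsLocalRing.maximalIdeal B ^ k ≤ Ideal.span {a, b} ∧ a ≠ 0 := by
  have := hB.isNoetherianRing
  have hht : (IsLocalRing.maximalIdeal B).height = 2 := by
    have h1 := IsLocalRing.maximalIdeal_height_eq_ringKrullDim (R := B)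
    rw [hB.ringKrullDim_eq] at h1
    exact WithBot.coe_injective h1
  obtain ⟨J, hJm, hJs, hJh⟩ := exists_spanRank_le_and_le_height_of_le_height
    (IsLocalRing.maximalIdeal B) 2 (by rw [hht]; rfl)
  have hrad : IsLocalRing.maximalIdeal B ≤ J.radical := by
    rw [Ideal.radical_eq_sInf]
    refine le_sInf ?_
    rintro q ⟨hq1, hq2⟩
    have h1 : q.height = 2 := le_antisymm
      (by rw [← hht]; exact Ideal.height_mono (IsLocalRing.le_maximalIdeal hq2.ne_top))
      (hJh.trans (Ideal.height_mono hq1))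
    have h2 := Ideal.isMaximal_of_height_eq_ringKrullDim (I := q) (by
      rw [h1, hB.ringKrullDim_eq]; rfl)
    rw [IsLocalRing.eq_maximalIdeal h2]
  obtain ⟨k, hk⟩ := Ideal.exists_pow_le_of_le_radical_of_fg hrad (IsNoetherian.noetherian _)
  obtain ⟨t, ht, rfl⟩ := (Submodule.FG.spanRank_le_iff_exists_span_set_card_le J).1 hJs
  obtain ⟨a, b, hab⟩ : ∃ a b : B, t ⊆ {a, b} ∧ a ∈ Ideal.span t ∧ b ∈ Ideal.span t := by
    have hfin : t.Finite := by
      rw [← Cardinal.lt_aleph0_iff_set_finite]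
      exact ht.trans_lt (by exact_mod_cast Cardinal.natCast_lt_aleph0 (n := 2))
    have hcard : t.ncard ≤ 2 := by
      rw [← Nat.cast_le (α := Cardinal), Set.cast_ncard hfin]
      exact_mod_cast ht
    rcases Nat.lt_or_ge t.ncard 2 with h | h
    · rcases Nat.lt_or_ge t.ncard 1 with h | h
      · rw [Nat.lt_one_iff, Set.ncard_eq_zero hfin] at h
        exact ⟨0, 0, by simp [h], zero_mem _, zero_mem _⟩
      · obtain ⟨a, rfl⟩ := Set.ncard_eq_one.1 (by lia : t.ncard = 1)
        have := Ideal.subset_span (Set.mem_singleton a)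
        exact ⟨a, a, by simp, this, this⟩
    · obtain ⟨a, b, -, rfl⟩ := Set.ncard_eq_two.1 (by lia : t.ncard = 2)
      exact ⟨a, b, subset_rfl, Ideal.subset_span (by simp), Ideal.subset_span (by simp)⟩
  obtain ⟨htab, ha, hb⟩ := hab
  refine ⟨a, b, k, hJm ha, hJm hb, hk.trans (Ideal.span_mono htab), ?_⟩
  rintro rfl
  have h1 : Ideal.span t ≤ Ideal.span {b} := by
    refine (Ideal.span_mono htab).trans (Ideal.span_le.2 ?_)
    rintro _ (rfl | rfl)
    exacts [zero_mem _, Ideal.subset_span rfl]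
  have h2 : Ideal.span {b} ≠ ⊤ := by
    intro h
    have := (Ideal.span_singleton_le_iff_mem (IsLocalRing.maximalIdeal B)).2 (hJm hb)
    rw [h, top_le_iff] at this
    exact Ideal.IsPrime.ne_top' this
  have h3 := (hJh.trans (Ideal.height_mono h1)).trans (Ideal.height_le_spanRank_toENat _ h2)
  have h4 : (Ideal.span {b} : Ideal B).spanRank ≤ 1 :=
    (Submodule.FG.spanRank_le_iff_exists_span_set_card_le _).2 ⟨{b}, by simp, rfl⟩
  have h5 := h3.trans (Cardinal.toENat.monotone' h4)
  simp at h5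

theorem exists_algHom_quotient {C : Type u} [CommRing C] [Algebra K C] (J : Ideal C) (n : ℕ)
    (e : MvPolynomial (Fin 2) K →ₐ[K] C) (he : MvPolynomial.idealOfVars (Fin 2) K ^ n ≤ J.comap e) :
    ∃ f : Ser K →ₐ[K] C ⧸ J, (∀ s, f s = Ideal.Quotient.mk J (e (MvPowerSeries.truncTotal n s))) ∧
      ∀ p : MvPolynomial (Fin 2) K, f p = Ideal.Quotient.mk J (e p) := by
  refine ⟨(Ideal.quotientMapₐ J e he).comp
    ((MvPowerSeries.truncTotalAlgHom (Fin 2) K n).restrictScalars K), fun s => rfl, fun p => ?_⟩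
  have h2 := (MvPowerSeries.truncTotalAlgHom (Fin 2) K n).commutes p
  exact congrArg (Ideal.quotientMapₐ J e he) h2

/-- Evaluation of truncations gives compatible homomorphisms to the quotients B/𝔪^n, and B is their
limit. -/
theorem IsNormalSurfaceSingularity.exists_algHom (hB : IsNormalSurfaceSingularity K B)
    (a : Fin 2 → B) (ha : ∀ i, a i ∈ IsLocalRing.maximalIdeal B) :
    ∃ σ : Ser K →ₐ[K] B, ∀ i, σ (MvPowerSeries.X i) = a i := by
  have := hB.isAdicComplete
  let 𝔪 := IsLocalRing.maximalIdeal B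
  have h1 : ∀ n, MvPolynomial.idealOfVars (Fin 2) K ^ n ≤
      (𝔪 ^ n).comap (MvPolynomial.aeval a : MvPolynomial (Fin 2) K →ₐ[K] B) := by
    intro n
    refine le_trans ?_ (Ideal.le_comap_pow _ n)
    refine Ideal.pow_right_mono (Ideal.span_le.2 ?_) n
    rintro _ ⟨i, rfl⟩
    change MvPolynomial.aeval a (MvPolynomial.X i) ∈ 𝔪
    rw [MvPolynomial.aeval_X]
    exact ha i
  choose f hf hf' using fun n => exists_algHom_quotient (𝔪 ^ n) n _ (h1 n)
  have hcomp : ∀ {m n : ℕ} (hmn : m ≤ n),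
      (Ideal.Quotient.factorₐ K (Ideal.pow_le_pow_right hmn)).comp (f n) = f m := by
    intro m n hmn
    ext s
    rw [AlgHom.comp_apply, hf, hf, Ideal.Quotient.factorₐ_apply_mk,
      Ideal.Quotient.mk_eq_mk_iff_sub_mem, ← map_sub]
    exact h1 m (MvPowerSeries.truncTotal_sub_truncTotal_mem_pow_idealOfVars hmn le_rfl s)
  refine ⟨IsAdicComplete.liftAlgHom 𝔪 f hcomp, fun i => ?_⟩
  rw [← sub_eq_zero]
  refine IsHausdorff.haus (I := 𝔪) inferInstance _ fun n => ?_
  rw [SModEq.zero, smul_eq_mul, Ideal.mul_top, ← Ideal.Quotient.eq_zero_iff_mem, map_sub,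
    IsAdicComplete.mk_liftAlgHom, sub_eq_zero, ← MvPolynomial.coe_X, hf', MvPolynomial.aeval_X]

/-- The quotient B/𝔪^k is finite-dimensional over K: its layers 𝔪^j/𝔪^(j+1) are finitely generated
over the residue field K. -/
theorem IsNormalSurfaceSingularity.exists_generators (hB : IsNormalSurfaceSingularity K B) (k : ℕ) :
    ∃ s : Finset B, ∀ b : B, ∃ v ∈ Submodule.span K (s : Set B),
      b - v ∈ IsLocalRing.maximalIdeal B ^ k := by
  classical
  have := hB.isNoetherianRing
  have hres : ∀ b : B, ∃ t : K, b - algebraMap K B t ∈ IsLocalRing.maximalIdeal B := by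
    intro b
    obtain ⟨t, ht⟩ := hB.residue_bijective.2 (IsLocalRing.residue B b)
    refine ⟨t, ?_⟩
    rw [← IsLocalRing.residue_eq_zero_iff, map_sub, ← ht, sub_eq_zero]
    rfl
  induction k with
  | zero => exact ⟨∅, fun b => ⟨0, zero_mem _, by simp⟩⟩
  | succ k ih =>
    obtain ⟨s, hs⟩ := ih
    obtain ⟨g, hg⟩ : (IsLocalRing.maximalIdeal B ^ k).FG := IsNoetherian.noetherian _
    have h1 : ∀ w ∈ IsLocalRing.maximalIdeal B ^ k, ∃ v ∈ Submodule.span K (g : Set B),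
        w - v ∈ IsLocalRing.maximalIdeal B ^ (k + 1) := by
      intro w hw
      rw [← hg] at hw
      induction hw using Submodule.span_induction with
      | mem z hz => exact ⟨z, Submodule.subset_span hz, by simp⟩
      | zero => exact ⟨0, zero_mem _, by simp⟩
      | add w w' _ _ h h' =>
        obtain ⟨v, hv, h⟩ := h
        obtain ⟨v', hv', h'⟩ := h'
        exact ⟨v + v', add_mem hv hv', by rw [add_sub_add_comm]; exact add_mem h h'⟩
      | smul b w hw h =>
        obtain ⟨v, hv, h⟩ := h
        obtain ⟨t, ht⟩ := hres b
        refine ⟨t • v, Submodule.smul_mem _ _ hv, ?_⟩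
        have h2 : b • w - t • v = (b - algebraMap K B t) * w + algebraMap K B t * (w - v) := by
          rw [smul_eq_mul, Algebra.smul_def]; ring
        rw [h2]
        refine add_mem ?_ (Ideal.mul_mem_left _ _ h)
        rw [pow_succ']
        refine Ideal.mul_mem_mul ht ?_
        rw [← hg]; exact hw
    refine ⟨s ∪ g, fun b => ?_⟩
    obtain ⟨v, hv, h⟩ := hs b
    obtain ⟨v', hv', h'⟩ := h1 _ h
    refine ⟨v + v', add_mem (Submodule.span_mono (by simp) hv)
      (Submodule.span_mono (by simp) hv'), by rwa [← sub_sub]⟩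

/-- Sending x, y to parameters a, b makes B separated in the (x, y)-adic topology and finite modulo
(x, y), as 𝔪^k ⊆ (a, b). By completeness of K[[x,y]], generators modulo (x, y) generate B. -/
theorem IsNormalSurfaceSingularity.exists_isFiniteOverSer (hB : IsNormalSurfaceSingularity K B) :
    ∃ _ : Algebra (Ser K) B, IsFiniteOverSer K B := by
  obtain ⟨a, b, k, ha, hb, hk, ha0⟩ := hB.exists_parameters
  obtain ⟨σ, hσ⟩ := hB.exists_algHom ![a, b] (by
    intro i
    fin_cases i
    exacts [ha, hb])
  let _ : Algebra (Ser K) B := σ.toRingHom.toAlgebra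
  have hx : algebraMap (Ser K) B x = a := hσ 0
  have hy : algebraMap (Ser K) B y = b := hσ 1
  have htower : IsScalarTower K (Ser K) B := IsScalarTower.of_algebraMap_eq fun t => (σ.commutes t).symm
  obtain ⟨s, hs⟩ := hB.exists_generators k
  have hhaus : IsHausdorff (vars K) B := by
    have := hB.isAdicComplete
    refine ⟨fun z hz => IsHausdorff.haus (I := IsLocalRing.maximalIdeal B) inferInstance z fun n => ?_⟩
    have h1 := hz n
    rw [SModEq.zero] at h1 ⊢
    rw [smul_eq_mul, Ideal.mul_top]
    have h2 : (vars K).map (algebraMap (Ser K) B) ≤ IsLocalRing.maximalIdeal B := by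
      rw [vars_eq, Ideal.map_span, Set.image_pair, hx, hy, Ideal.span_le]
      rintro _ (rfl | rfl)
      exacts [ha, hb]
    rw [Ideal.smul_top_eq_map, Submodule.restrictScalars_mem, Ideal.map_pow] at h1
    exact Ideal.pow_right_mono h2 n h1
  refine ⟨inferInstance, hB, htower, ?_, by rwa [hx]⟩
  let f : (s → Ser K) →ₗ[Ser K] B := Fintype.linearCombination (Ser K) (fun i => (i : B))
  have hprec : IsPrecomplete (vars K) (s → Ser K) :=
    (isAdicComplete_of_finite (vars K) (s → Ser K)).toIsPrecomplete
  have hf : Function.Surjective f := by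
    apply surjective_of_mkQ_comp_surjective (I := vars K)
    intro z
    obtain ⟨z, rfl⟩ := Submodule.mkQ_surjective _ z
    obtain ⟨v, hv, hzv⟩ := hs z
    obtain ⟨t, -, ht⟩ := Submodule.mem_span_finset.1 hv
    refine ⟨fun i => MvPowerSeries.C (t i), ?_⟩
    rw [LinearMap.comp_apply, Submodule.mkQ_apply, Submodule.mkQ_apply, eq_comm,
      Submodule.Quotient.eq]
    have h1 : f (fun i => MvPowerSeries.C (t i)) = v := by
      rw [← ht, Fintype.linearCombination_apply, ← Finset.sum_coe_sort s fun i => t i • i]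
      refine Finset.sum_congr rfl fun i _ => ?_
      rw [Algebra.smul_def, Algebra.smul_def]
      congr 1
      exact σ.commutes (t i)
    rw [h1, Ideal.smul_top_eq_map, Submodule.restrictScalars_mem, vars_eq, Ideal.map_span,
      Set.image_pair, hx, hy]
    exact hk hzv
  exact Module.Finite.of_surjective f hf

end

end SurfaceCM

namespace SurfaceCM

open Ser

/-! ### The Noether different -/

section Different

variable (B A : Type u) [CommRing B] [CommRing A] [Algebra B A]

/-- The elements of `B` whose images in `A` lie in the Noether different of `A` over `B`. -/
def noetherDifferent : Ideal B where
  carrier := {b | ∃ t : A ⊗[B] A, (∀ a : A, a ⊗ₜ[B] 1 * t = 1 ⊗ₜ[B] a * t) ∧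
    Algebra.TensorProduct.lmul' B t = algebraMap B A b}
  zero_mem' := ⟨0, by simp, by simp⟩
  add_mem' := by
    rintro b b' ⟨t, ht, h⟩ ⟨t', ht', h'⟩
    exact ⟨t + t', fun a => by rw [mul_add, mul_add, ht, ht'], by rw [map_add, map_add, h, h']⟩
  smul_mem' := by
    rintro c b ⟨t, ht, h⟩
    exact ⟨c • t, fun a => by rw [mul_smul_comm, mul_smul_comm, ht], by
      rw [map_smul, h, smul_eq_mul, map_mul, Algebra.smul_def]⟩

variable {B A}

theorem mem_noetherDifferent {b : B} : b ∈ noetherDifferent B A ↔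
    ∃ t : A ⊗[B] A, (∀ a : A, a ⊗ₜ[B] 1 * t = 1 ⊗ₜ[B] a * t) ∧
      Algebra.TensorProduct.lmul' B t = algebraMap B A b := Iff.rfl

/-- The kernel of the multiplication A ⊗ A → A annihilates t, so z t depends only on the image of z
in A. -/
theorem mul_eq_tmul_mul {t : A ⊗[B] A} (ht : ∀ a : A, a ⊗ₜ[B] 1 * t = 1 ⊗ₜ[B] a * t)
    (z : A ⊗[B] A) : z * t = Algebra.TensorProduct.lmul' B z ⊗ₜ[B] 1 * t := by
  induction z with
  | zero => simp
  | add z w hz hw => rw [add_mul, hz, hw, map_add, TensorProduct.add_tmul, add_mul]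
  | tmul v w =>
    have h1 : v ⊗ₜ[B] w = (v ⊗ₜ[B] (1 : A)) * ((1 : A) ⊗ₜ[B] w) := by simp
    rw [h1, mul_assoc, ← ht, ← mul_assoc]
    simp

/-- Unramifiedness at P gives s outside P killing the differentials J/J², that is, sJ ⊆ J².
Cayley-Hamilton for multiplication by s on J yields a monic p with lower coefficients in J and p(s)J
= 0. Then p(s) witnesses that a power of s lies in the different, since its image in A is that
power. -/
theorem not_noetherDifferent_le [IsNoetherianRing B] [Module.Finite B A] (P : Ideal B) [P.IsPrime]
    [hu : Algebra.FormallyUnramified P.ResidueField (P.Fiber A)] : ¬ noetherDifferent B A ≤ P := by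
  classical
  let _ : Algebra A (P.ResidueField ⊗[B] A) := Algebra.TensorProduct.rightAlgebra
  have hsub : Subsingleton (Ω[P.Fiber A⁄P.ResidueField]) := hu.subsingleton_kaehlerDifferential
  have hsub' : Subsingleton (P.ResidueField ⊗[B] Ω[A⁄B]) :=
    (KaehlerDifferential.tensorKaehlerEquivBase B P.ResidueField A
      (P.Fiber A)).toEquiv.subsingleton
  have hfin : Module.Finite B (Ω[A⁄B]) := Module.Finite.trans A _
  have h1 : (⟨P, inferInstance⟩ : PrimeSpectrum B) ∉ Module.support B (Ω[A⁄B]) := by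
    rw [Module.mem_support_iff_nontrivial_residueField_tensorProduct]
    exact not_nontrivial_iff_subsingleton.2 hsub'
  rw [Module.support_eq_zeroLocus, PrimeSpectrum.mem_zeroLocus, Set.not_subset] at h1
  obtain ⟨s, hs, hsP⟩ := h1
  have hs' : ∀ ω : Ω[A⁄B], s • ω = 0 := Module.mem_annihilator.1 hs
  let J := KaehlerDifferential.ideal B A
  have : IsNoetherianRing (A ⊗[B] A) := by
    have : IsNoetherian B (A ⊗[B] A) := inferInstance
    exact isNoetherian_of_tower B this
  have hJ : ∀ z ∈ J, s • z ∈ J ^ 2 := by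
    intro z hz
    have h2 : J.toCotangent ((algebraMap B (A ⊗[B] A) s) • ⟨z, hz⟩) = 0 := by
      rw [map_smul]
      have h3 := hs' (KaehlerDifferential.fromIdeal B A ⟨z, hz⟩)
      rw [← algebraMap_smul (A ⊗[B] A)] at h3
      exact h3
    rw [Ideal.toCotangent_eq_zero] at h2
    rw [Algebra.smul_def]
    exact h2
  let f : Module.End (A ⊗[B] A) J := algebraMap (A ⊗[B] A) _ (algebraMap B _ s)
  have hf : LinearMap.range f ≤ J • ⊤ := by
    rintro _ ⟨⟨z, hz⟩, rfl⟩
    have h2 := hJ z hz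
    rw [pow_two, Algebra.smul_def] at h2
    rw [Submodule.mem_smul_top_iff]
    exact h2
  obtain ⟨p, hp, -, hpJ, hpf⟩ :=
    LinearMap.exists_monic_and_natDegree_eq_and_coeff_mem_pow_and_aeval_eq_zero
      (A ⊗[B] A) f J hf
  intro hle
  refine hsP (Ideal.IsPrime.mem_of_pow_mem inferInstance p.natDegree (hle ?_))
  refine mem_noetherDifferent.2 ⟨p.eval (algebraMap B _ s), fun a => ?_, ?_⟩
  · rw [← sub_eq_zero, ← sub_mul]
    have h2 : a ⊗ₜ[B] (1 : A) - 1 ⊗ₜ[B] a ∈ J := by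
      rw [← neg_sub]
      exact neg_mem (KaehlerDifferential.one_smul_sub_smul_one_mem_ideal B a)
    have h3 := LinearMap.congr_fun hpf ⟨_, h2⟩
    rw [Polynomial.aeval_algebraMap_apply] at h3
    rw [mul_comm]
    exact congrArg Subtype.val h3
  · rw [Polynomial.eval_eq_sum_range, Finset.sum_range_succ, hp.coeff_natDegree, one_mul, map_add,
      map_pow, map_pow, AlgHom.commutes, map_sum, Finset.sum_eq_zero, zero_add]
    intro i hi
    rw [map_mul]
    have h4 : p.coeff i ∈ J := Ideal.pow_le_self (by have := Finset.mem_range.1 hi; lia) (hpJ i)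
    rw [show Algebra.TensorProduct.lmul' B (p.coeff i) = 0 from h4, zero_mul]

/-- No prime of height one contains the different, so neither does the zero ideal, which lies in
such a prime. Only the maximal ideal is left. -/
theorem exists_pow_le_noetherDifferent {K : Type u} [Field K] [Algebra K B] [IsLocalRing B]
    (hB : IsNormalSurfaceSingularity K B) [Module.Finite B A] (h : IsUnramifiedInCodimOne B A) :
    ∃ k, IsLocalRing.maximalIdeal B ^ k ≤ noetherDifferent B A := by
  have := hB.isNoetherianRing
  have := hB.isDomain
  refine Ideal.exists_pow_le_of_le_radical_of_fg ?_ (IsNoetherian.noetherian _)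
  rw [Ideal.radical_eq_sInf]
  refine le_sInf ?_
  rintro q ⟨hq1, hq2⟩
  have h1 : ∀ P : Ideal B, P.IsPrime → P.height = 1 → ¬ noetherDifferent B A ≤ P := by
    intro P hP hP1
    have := h P hP1
    exact not_noetherDifferent_le P
  have h0 : q ≠ ⊥ := by
    rintro rfl
    obtain ⟨a, -, k, ha, -, -, ha0⟩ := hB.exists_parameters
    obtain ⟨p, hp⟩ := Ideal.nonempty_minimalPrimes (I := Ideal.span {a}) (by
      intro h
      have := (Ideal.span_singleton_le_iff_mem (IsLocalRing.maximalIdeal B)).2 ha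
      rw [h, top_le_iff] at this
      exact Ideal.IsPrime.ne_top' this)
    have hpp := hp.isPrime
    refine h1 p hpp (le_antisymm
      (Ideal.height_le_one_of_isPrincipal_of_mem_minimalPrimes _ p hp) ?_) (hq1.trans bot_le)
    rw [Order.one_le_iff_ne_zero, Ne, Ideal.height_eq_zero_iff_eq_bot]
    rintro rfl
    exact ha0 (hp.le (Ideal.subset_span rfl))
  have h2 : q.height = 2 := by
    have h3 : q.height ≤ 2 := by
      have := q.height_le_ringKrullDim_of_ne_top hq2.ne_top
      rw [hB.ringKrullDim_eq] at this
      exact WithBot.coe_le_coe.1 this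
    have h4 : q.height ≠ 0 := by rwa [Ne, Ideal.height_eq_zero_iff_eq_bot]
    have h5 : q.height ≠ 1 := fun h5 => h1 q hq2 h5 hq1
    generalize q.height = n at *
    lift n to ℕ using ne_top_of_le_ne_top (by simp) h3
    norm_cast at *
    lia
  have h3 := Ideal.isMaximal_of_height_eq_ringKrullDim (I := q) (by
    rw [h2, hB.ringKrullDim_eq]; rfl)
  rw [IsLocalRing.eq_maximalIdeal h3]

end Different

/-! ### Coinduced modules -/

/-- The coinduced module `Hom_B(A, N)`. -/
def Coind (B A N : Type u) [CommRing B] [CommRing A] [Algebra B A] [AddCommGroup N] [Module B N] :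
    Type u := A →ₗ[B] N

namespace Coind

section

variable {B A N : Type u} [CommRing B] [CommRing A] [Algebra B A] [AddCommGroup N] [Module B N]

noncomputable instance : AddCommGroup (Coind B A N) := inferInstanceAs (AddCommGroup (A →ₗ[B] N))

noncomputable instance : Module B (Coind B A N) := inferInstanceAs (Module B (A →ₗ[B] N))

/-- The element of the coinduced module given by a linear map. -/
def of (f : A →ₗ[B] N) : Coind B A N := f

/-- The linear map underlying an element of the coinduced module. -/
def hom (f : Coind B A N) : A →ₗ[B] N := f

@[ext] theorem ext {f g : Coind B A N} (h : ∀ a, f.hom a = g.hom a) : f = g := LinearMap.ext h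

@[simp] theorem hom_of (f : A →ₗ[B] N) (a : A) : (of f).hom a = f a := rfl

@[simp] theorem hom_add (f g : Coind B A N) (a : A) : (f + g).hom a = f.hom a + g.hom a := rfl

@[simp] theorem hom_zero (a : A) : (0 : Coind B A N).hom a = 0 := rfl

@[simp] theorem hom_smul_base (b : B) (f : Coind B A N) (a : A) : (b • f).hom a = b • f.hom a := rfl

noncomputable instance : SMul A (Coind B A N) where
  smul a f := of (f.hom ∘ₗ LinearMap.mulLeft B a)

@[simp] theorem hom_smul (a a' : A) (f : Coind B A N) : (a • f).hom a' = f.hom (a * a') := rfl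

noncomputable instance : Module A (Coind B A N) where
  one_smul f := by ext; simp
  mul_smul a b f := by ext; simp [mul_left_comm, mul_assoc]
  smul_zero a := by ext; simp
  smul_add a f g := by ext; simp
  add_smul a b f := by ext; simp [add_mul]
  zero_smul f := by ext; simp

instance : IsScalarTower B A (Coind B A N) := ⟨fun b a f => by ext; simp⟩

/-- The map of coinduced modules given by a linear map. -/
def map {N' : Type u} [AddCommGroup N'] [Module B N'] (g : N →ₗ[B] N') :
    Coind B A N →ₗ[A] Coind B A N' where
  toFun f := of (g ∘ₗ f.hom)
  map_add' f f' := by ext; simp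
  map_smul' a f := by ext; simp

@[simp] theorem hom_map {N' : Type u} [AddCommGroup N'] [Module B N'] (g : N →ₗ[B] N')
    (f : Coind B A N) (a : A) : (map g f).hom a = g (f.hom a) := rfl

theorem nonempty_equiv {N' : Type u} [AddCommGroup N'] [Module B N'] (g : N ≃ₗ[B] N') :
    Nonempty (Coind B A N ≃ₗ[A] Coind B A N') :=
  ⟨LinearEquiv.ofLinearMap (map g) (map g.symm) (by ext; simp) (by ext; simp)⟩

/-- Division by a in N is unique, so the pointwise quotients of a linear map form a linear map. -/
theorem isRegularPair {a b : B} (h : IsRegularPair N a b) :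
    IsRegularPair (Coind B A N) (algebraMap B A a) (algebraMap B A b) := by
  rw [IsRegularPair.algebraMap_iff]
  refine ⟨fun f hf => ?_, fun f g hfg => ?_⟩
  · ext t
    exact h.1 _ (congrArg (fun f => hom f t) hf)
  · choose w hw using fun t => h.2 (f.hom t) (g.hom t) (congrArg (fun f => hom f t) hfg)
    refine ⟨of ⟨⟨w, fun t t' => h.eq_of_smul_eq ?_⟩, fun c t => h.eq_of_smul_eq ?_⟩, ?_⟩
    · rw [smul_add, ← hw, ← hw, ← hw, map_add]
    · rw [RingHom.id_apply, smul_comm, ← hw, ← hw, map_smul]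
    · ext t
      exact hw t

instance [IsNoetherianRing B] [Module.Finite B A] [Module.Finite B N] :
    Module.Finite B (Coind B A N) := inferInstanceAs (Module.Finite B (A →ₗ[B] N))

instance finite [IsNoetherianRing B] [Module.Finite B A] [Module.Finite B N] :
    Module.Finite A (Coind B A N) := Module.Finite.of_restrictScalars_finite B A _

/-- The module is a direct summand of the restriction of the coinduced module if the extension
splits. -/
theorem isSummand_of_split (h : IsSplitExtension B A) : IsSummand B N (Coind B A N) := by
  obtain ⟨r, hr⟩ := h
  refine ⟨⟨⟨fun n => of (LinearMap.toSpanSingleton B N n ∘ₗ r), fun n n' => ?_⟩, fun b n => ?_⟩,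
    ⟨⟨fun f => f.hom 1, fun f g => rfl⟩, fun b f => rfl⟩, ?_⟩
  · ext a; simp
  · ext a; exact smul_comm (r a) b n
  · ext n
    have h1 : r 1 = 1 := by simpa using LinearMap.congr_fun hr 1
    change r 1 • n = n
    rw [h1, one_smul]

variable {M : Type u} [AddCommGroup M] [Module A M] [Module B M] [IsScalarTower B A M]

/-- The canonical embedding of an `A`-module into the module coinduced from its restriction. -/
def unit : M →ₗ[A] Coind B A M where
  toFun m := of ((LinearMap.toSpanSingleton A M m).restrictScalars B)
  map_add' m m' := by ext; simp
  map_smul' a m := by ext t; simp [mul_smul, smul_comm a t m]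

@[simp] theorem hom_unit (m : M) (a : A) : (unit (B := B) m).hom a = a • m := rfl

/-- The map sending `∑ uᵢ ⊗ vᵢ` to `∑ uᵢ f(vᵢ)`. -/
noncomputable def contract (f : Coind B A M) : A ⊗[B] A →ₗ[A] M :=
  TensorProduct.AlgebraTensorModule.lift (LinearMap.toSpanSingleton A (A →ₗ[B] M) f.hom)

@[simp] theorem contract_tmul (f : Coind B A M) (u v : A) :
    contract f (u ⊗ₜ v) = u • f.hom v := rfl

theorem contract_add (f g : Coind B A M) (z : A ⊗[B] A) :
    contract (f + g) z = contract f z + contract g z := by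
  induction z with
  | zero => simp
  | add z w hz hw => rw [map_add, map_add, map_add, hz, hw]; abel
  | tmul u v => simp

theorem contract_smul (a : A) (f : Coind B A M) (z : A ⊗[B] A) :
    contract (a • f) z = contract f (1 ⊗ₜ a * z) := by
  induction z with
  | zero => simp
  | add z w hz hw => rw [map_add, mul_add, map_add, hz, hw]
  | tmul u v => simp

theorem contract_mul (a : A) (f : Coind B A M) (z : A ⊗[B] A) :
    contract f (a ⊗ₜ 1 * z) = a • contract f z := by
  rw [← map_smul]
  congr 1
  induction z with
  | zero => simp
  | add z w hz hw => rw [mul_add, smul_add, hz, hw]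
  | tmul u v => rw [Algebra.TensorProduct.tmul_mul_tmul, one_mul, TensorProduct.smul_tmul', smul_eq_mul]

theorem contract_unit (m : M) (z : A ⊗[B] A) :
    contract (unit (B := B) m) z = Algebra.TensorProduct.lmul' B z • m := by
  induction z with
  | zero => simp
  | add z w hz hw => rw [map_add, map_add, hz, hw, add_smul]
  | tmul u v => simp [mul_smul]

/-- An `A`-module is a direct summand of the module coinduced from its restriction to `B` if the
Noether different contains a sequence which is regular on the module. -/
theorem isSummand_of_isRegularPair {a b : B} (ha : a ∈ noetherDifferent B A)
    (hb : b ∈ noetherDifferent B A) (hM : IsRegularPair M a b) :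
    IsSummand A M (Coind B A M) := by
  obtain ⟨s, hs, hsa⟩ := ha
  obtain ⟨t, ht, htb⟩ := hb
  -- The retraction should be `contract f s` divided by a, because contracting `unit m` against s
  -- gives a m. Both sides here contract f against s t, and regularity of a, b then provides the
  -- quotient by a. Linearity over A comes from (1 ⊗ c)s = (c ⊗ 1)s.
  have h1 : ∀ f : Coind B A M, b • contract f s = a • contract f t := by
    intro f
    rw [← algebraMap_smul A b, ← algebraMap_smul A a, ← htb, ← hsa, ← contract_mul, ← contract_mul,
      ← mul_eq_tmul_mul hs, ← mul_eq_tmul_mul ht, mul_comm]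
  choose p hp using fun f => hM.2 _ _ (h1 f)
  refine ⟨unit, ⟨⟨p, fun f g => hM.eq_of_smul_eq ?_⟩, fun c f => hM.eq_of_smul_eq ?_⟩, ?_⟩
  · rw [smul_add, ← hp, ← hp, ← hp, contract_add]
  · rw [RingHom.id_apply, smul_comm, ← hp, ← hp, contract_smul, ← hs, contract_mul]
  · ext m
    refine hM.eq_of_smul_eq ?_
    change a • p (unit m) = a • m
    rw [← hp, contract_unit, hsa, algebraMap_smul]

end

end Coind

end SurfaceCM

namespace SurfaceCM

open Ser

/-! ### Restriction and coinduction of Cohen-Macaulay modules -/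

theorem isSummand_range_of_comp {A M L : Type*} [CommRing A] [AddCommGroup M] [Module A M]
    [AddCommGroup L] [Module A L] {e : Module.End A M} (he : e * e = e) (i : L →ₗ[A] M)
    (p : M →ₗ[A] L) (h : ∀ m, i (p m) = e m) : IsSummand A (LinearMap.range e) L := by
  refine ⟨p ∘ₗ (LinearMap.range e).subtype, LinearMap.rangeRestrict e ∘ₗ i, ?_⟩
  ext ⟨_, w, rfl⟩
  have h1 : ∀ m, e (e m) = e m := LinearMap.congr_fun he
  change e (i (p (e w))) = e w
  rw [h, h1, h1]

theorem IsSummand.nontrivial {A N M : Type*} [CommRing A] [AddCommGroup M] [Module A M]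
    [AddCommGroup N] [Module A N] [Nontrivial N] (h : IsSummand A N M) : Nontrivial M := by
  obtain ⟨i, p, hp⟩ := h
  exact Function.Injective.nontrivial (f := i) (Function.LeftInverse.injective (LinearMap.congr_fun hp))

section

variable {K A : Type u} [Field K] [CommRing A] [IsLocalRing A] [Algebra K A] [Algebra (Ser K) A]
  {M N : Type u} [AddCommGroup M] [Module A M] [Module (Ser K) M] [IsScalarTower (Ser K) A M]
  [AddCommGroup N] [Module A N] [Module (Ser K) N] [IsScalarTower (Ser K) A N]

theorem IsFiniteOverSer.finrank_le (hA : IsFiniteOverSer K A) (hM : IsCohenMacaulay A M) :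
    Module.finrank A M ≤ Module.finrank (Ser K) M := by
  rcases subsingleton_or_nontrivial M with h | h
  · rw [Module.finrank_zero_of_subsingleton]
    exact Nat.zero_le _
  · obtain ⟨h1, h2⟩ := hA.isCohenMacaulay_iff.1 hM
    have h3 : 0 < Module.finrank (Ser K) M := Module.finrank_pos
    rw [hA.finrank_eq hM.1] at h3 ⊢
    exact Nat.le_mul_of_pos_left _ (Nat.pos_of_mul_pos_right h3)

theorem finrank_le_of_isSummand {S : Type*} {M N : Type*} [CommRing S] [Nontrivial S]
    [AddCommGroup M] [Module S M]
    [AddCommGroup N] [Module S N] [Module.Finite S M] (h : IsSummand S N M) :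
    Module.finrank S N ≤ Module.finrank S M := by
  obtain ⟨i, p, hp⟩ := h
  exact LinearMap.finrank_le_finrank_of_injective
    (Function.LeftInverse.injective (LinearMap.congr_fun hp))

theorem IsSummand.restrictScalars (S : Type*) {A M N : Type*} [CommRing S] [CommRing A]
    [Algebra S A] [AddCommGroup M] [Module A M] [Module S M] [IsScalarTower S A M]
    [AddCommGroup N] [Module A N] [Module S N] [IsScalarTower S A N] (h : IsSummand A N M) :
    IsSummand S N M := by
  obtain ⟨i, p, hp⟩ := h
  exact ⟨i.restrictScalars S, p.restrictScalars S, LinearMap.ext fun w => LinearMap.congr_fun hp w⟩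

end

section

variable {K A B : Type u} [Field K] [CommRing A] [IsLocalRing A] [Algebra K A] [Algebra (Ser K) A]
  [CommRing B] [IsLocalRing B] [Algebra K B] [Algebra (Ser K) B] [Algebra B A]
  [IsScalarTower (Ser K) B A]

theorem IsFiniteOverSer.of_finite (hB : IsFiniteOverSer K B) (hA : IsNormalSurfaceSingularity K A)
    [IsScalarTower K B A] [Module.Finite B A] (hinj : Function.Injective (algebraMap B A)) :
    IsFiniteOverSer K A := by
  have := hB.tower
  have := hB.finite
  refine ⟨hA, IsScalarTower.of_algebraMap_eq fun t => ?_, Module.Finite.trans B A, ?_⟩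
  · rw [IsScalarTower.algebraMap_apply K B A, IsScalarTower.algebraMap_apply K (Ser K) B,
      ← IsScalarTower.algebraMap_apply (Ser K) B A]
  · rw [IsScalarTower.algebraMap_apply (Ser K) B A, Ne, map_eq_zero_iff _ hinj]
    exact hB.x_ne_zero

variable [Module.Finite B A]

section Restriction

variable {M : Type u} [AddCommGroup M] [Module A M] [Module B M] [IsScalarTower B A M]

theorem IsFiniteOverSer.isCohenMacaulay_restrictScalars (hA : IsFiniteOverSer K A)
    (hB : IsFiniteOverSer K B) (hM : IsCohenMacaulay A M) : IsCohenMacaulay B M := by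
  have := hM.1
  have : Module.Finite B M := Module.Finite.trans A M
  have h := hA.isRegularPair hM
  rw [IsScalarTower.algebraMap_apply (Ser K) B A, IsScalarTower.algebraMap_apply (Ser K) B A] at h
  exact hB.isCohenMacaulay_of_isRegularPair (IsRegularPair.algebraMap_iff.1 h)

end Restriction

section Coind

variable {N : Type u} [AddCommGroup N] [Module B N]

theorem IsFiniteOverSer.isCohenMacaulay_coind (hA : IsFiniteOverSer K A)
    (hB : IsFiniteOverSer K B) (hN : IsCohenMacaulay B N) : IsCohenMacaulay A (Coind B A N) := by
  have := hN.1
  have := hB.sing.isNoetherianRing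
  refine hA.isCohenMacaulay_of_isRegularPair ?_
  rw [IsScalarTower.algebraMap_apply (Ser K) B A, IsScalarTower.algebraMap_apply (Ser K) B A]
  exact Coind.isRegularPair (hB.isRegularPair hN)

/-- The rank of a coinduced module over the ring of power series is bounded by the rank of the
module. -/
theorem IsFiniteOverSer.exists_finrank_coind_le (K A B : Type u) [Field K] [CommRing A]
    [Algebra (Ser K) A] [CommRing B] [IsLocalRing B] [Algebra K B] [Algebra (Ser K) B] [Algebra B A]
    [IsScalarTower (Ser K) B A] [Module.Finite B A] (hB : IsFiniteOverSer K B) :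
    ∃ n : ℕ, ∀ (N : Type u) [AddCommGroup N] [Module B N] [Module (Ser K) N]
      [IsScalarTower (Ser K) B N] [Module (Ser K) (Coind B A N)]
      [IsScalarTower (Ser K) A (Coind B A N)], IsCohenMacaulay B N →
      Module.finrank (Ser K) (Coind B A N) ≤ n * Module.finrank (Ser K) N := by
  obtain ⟨n, g, hg⟩ := Module.Finite.exists_fin (R := B) (M := A)
  refine ⟨n, fun N _ _ _ _ _ _ hN => ?_⟩
  obtain ⟨h1, h2⟩ := hB.isCohenMacaulay_iff.1 hN
  let φ : Coind B A N →ₗ[Ser K] (Fin n → N) :=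
    { toFun := fun f i => f.hom (g i)
      map_add' := fun _ _ => rfl
      map_smul' := fun s f => funext fun i => by
        rw [← algebraMap_smul A s f, Coind.hom_smul, IsScalarTower.algebraMap_apply (Ser K) B A,
          ← Algebra.smul_def, map_smul, algebraMap_smul]
        rfl }
  have hφ : Function.Injective φ := by
    intro f f' hff
    refine LinearMap.ext_on_range hg fun i => congrFun hff i
  refine (LinearMap.finrank_le_finrank_of_injective hφ).trans ?_
  rw [Module.finrank_pi_fintype, Finset.sum_const, Finset.card_univ, Fintype.card_fin,
    smul_eq_mul]

variable [IsAlgClosed K]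

/-- Every Cohen-Macaulay `B`-module is a summand of the restriction of a Cohen-Macaulay module over
a split extension, and the ranks are comparable. -/
theorem IsFiniteOverSer.exists_isSummand_restrictScalars (hA : IsFiniteOverSer K A)
    (hB : IsFiniteOverSer K B) (h : IsSplitExtension B A) :
    ∃ C : ℕ, ∀ N : ModuleCat.{u} B, IsIndecomposableCM B N → ∃ M : ModuleCat.{u} A,
      IsIndecomposableCM A M ∧
      IsSummand B N ((ModuleCat.restrictScalars (algebraMap B A)).obj M) ∧
      Module.finrank A M ≤ C * Module.finrank B N := by
  obtain ⟨n, hn⟩ := IsFiniteOverSer.exists_finrank_coind_le K A B hB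
  refine ⟨n * Module.finrank (Ser K) B, fun N ⟨hN, hN'⟩ => ?_⟩
  have hcoind := hA.isCohenMacaulay_coind hB hN
  -- N is a B-summand of its coinduced module. As its endomorphism ring is local, it is already a
  -- summand of the restriction of one indecomposable A-summand.
  obtain ⟨k, e, he, hf⟩ := hA.exists_decomposition hcoind
  let e' : Fin k → Module.End B (Coind B A N) := fun i => (e i).restrictScalars B
  have he' : CompleteOrthogonalIdempotents e' := by
    refine ⟨⟨fun i => ?_, fun i j hij => ?_⟩, ?_⟩
    · exact LinearMap.ext fun w => LinearMap.congr_fun (he.idem i) w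
    · exact LinearMap.ext fun w => LinearMap.congr_fun (he.ortho hij) w
    · ext w : 1
      rw [LinearMap.sum_apply]
      refine Eq.trans ?_ (LinearMap.congr_fun he.complete w)
      rw [LinearMap.sum_apply]
      rfl
  have := hN'.1
  obtain ⟨i, hi⟩ := exists_isSummand_range he' (hB.isUnit_or_isUnit_one_sub hN hN')
    (Coind.isSummand_of_split h)
  have hi' : IsSummand B N (LinearMap.range (e i)) := hi.trans
    (isSummand_range_of_comp (he'.idem i) ((LinearMap.range (e i)).subtype.restrictScalars B)
      ((LinearMap.rangeRestrict (e i)).restrictScalars B) fun _ => rfl)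
  have hsum : IsSummand A (LinearMap.range (e i)) (Coind B A N) := isSummand_range (he.idem i)
  have hCM := hA.isCohenMacaulay_of_isSummand hcoind hsum
  refine ⟨ModuleCat.of A (LinearMap.range (e i)),
    ⟨hCM, isIndecomposable_iff.2 ⟨hi'.nontrivial, hf i⟩⟩, ?_, ?_⟩
  · obtain ⟨j, p, hjp⟩ := hi'
    have h1 : ∀ (b : B) (w : LinearMap.range (e i)), algebraMap B A b • w = b • w :=
      fun b w => algebraMap_smul A b w
    exact ⟨⟨⟨j, map_add j⟩, fun b w => (map_smul j b w).trans (h1 b _).symm⟩,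
      ⟨⟨p, map_add p⟩, fun b w => (congrArg p (h1 b w)).trans (p.map_smul b w)⟩, hjp⟩
  · let _ : Module (Ser K) N := Module.compHom N (algebraMap (Ser K) B)
    have : IsScalarTower (Ser K) B N := ⟨fun s a w => by rw [Algebra.smul_def, mul_smul]; rfl⟩
    let _ : Module (Ser K) (Coind B A N) := Module.compHom _ (algebraMap (Ser K) A)
    have : IsScalarTower (Ser K) A (Coind B A N) :=
      ⟨fun s a w => by rw [Algebra.smul_def, mul_smul]; rfl⟩
    have := (hA.isCohenMacaulay_iff.1 hcoind).1
    -- All ranks are compared over K[[x,y]]: rank_A M ≤ rank_S M ≤ rank_S Hom_B(A, N) ≤ n · rank_S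
    -- N, and rank_S N = rank_S B · rank_B N.
    refine (hA.finrank_le hCM).trans ((finrank_le_of_isSummand
      (hsum.restrictScalars (Ser K))).trans ?_)
    rw [mul_assoc, ← hB.finrank_eq hN.1]
    exact hn N hN

/-- If the extension is unramified in codimension one, then every Cohen-Macaulay `A`-module is a
summand of the coinduction of a Cohen-Macaulay `B`-module, and the ranks are comparable. -/
theorem IsFiniteOverSer.exists_isSummand_coind (hA : IsFiniteOverSer K A)
    (hB : IsFiniteOverSer K B) (h : IsUnramifiedInCodimOne B A) :
    ∃ C : ℕ, ∀ M : ModuleCat.{u} A, IsIndecomposableCM A M → ∃ N : ModuleCat.{u} B,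
      IsIndecomposableCM B N ∧ IsSummand A M (Coind B A N) ∧
      Module.finrank B N ≤ C * Module.finrank A M := by
  refine ⟨Module.finrank (Ser K) A, fun M ⟨hM, hM'⟩ => ?_⟩
  let _ : Module B M := Module.compHom M (algebraMap B A)
  have : IsScalarTower B A M := ⟨fun s a w => by rw [Algebra.smul_def, mul_smul]; rfl⟩
  have hMB : IsCohenMacaulay B M := hA.isCohenMacaulay_restrictScalars hB hM
  obtain ⟨k, hk⟩ := exists_pow_le_noetherDifferent hB.sing h
  -- Powers of x and y lie in the different and are regular on M, so M is a summand of its coinduced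
  -- restriction. Coinducing a B-decomposition of M then isolates one indecomposable B-summand.
  have h0 : IsSummand A M (Coind B A M) := Coind.isSummand_of_isRegularPair
    (hk (Ideal.pow_mem_pow (hB.algebraMap_X_mem 0) k))
    (hk (Ideal.pow_mem_pow (hB.algebraMap_X_mem 1) k))
    ((hB.isRegularPair hMB).pow k k)
  obtain ⟨k, e, he, hf⟩ := hB.exists_decomposition hMB
  let e' : Fin k → Module.End A (Coind B A M) := fun i => Coind.map (e i)
  have he' : CompleteOrthogonalIdempotents e' := by
    refine ⟨⟨fun i => ?_, fun i j hij => ?_⟩, ?_⟩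
    · ext w a
      exact LinearMap.congr_fun (he.idem i) (w.hom a)
    · ext w a
      exact LinearMap.congr_fun (he.ortho hij) (w.hom a)
    · ext w a
      refine Eq.trans ?_ (LinearMap.congr_fun he.complete (w.hom a))
      have h2 : ∀ s : Finset (Fin k), ((∑ i ∈ s, e' i) w).hom a = (∑ i ∈ s, e i) (w.hom a) := by
        intro s
        induction s using Finset.cons_induction with
        | empty => rfl
        | cons i s hi ih => rw [Finset.sum_cons, Finset.sum_cons, LinearMap.add_apply,
            LinearMap.add_apply, Coind.hom_add, ih]; rfl
      exact h2 _
  have := hM'.1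
  obtain ⟨i, hi⟩ := exists_isSummand_range he' (hA.isUnit_or_isUnit_one_sub hM hM') h0
  have hi' : IsSummand A M (Coind B A (LinearMap.range (e i))) := hi.trans
    (isSummand_range_of_comp (he'.idem i) (Coind.map (LinearMap.range (e i)).subtype)
      (Coind.map (LinearMap.rangeRestrict (e i))) fun _ => rfl)
  have hsum : IsSummand B (LinearMap.range (e i)) M := isSummand_range (he.idem i)
  have hCM := hB.isCohenMacaulay_of_isSummand hMB hsum
  have hnt : Nontrivial (LinearMap.range (e i)) := by
    by_contra hnt
    rw [not_nontrivial_iff_subsingleton] at hnt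
    have := hi'.nontrivial
    obtain ⟨f, hf⟩ := exists_ne (0 : Coind B A (LinearMap.range (e i)))
    exact hf (by ext; exact congrArg Subtype.val (Subsingleton.elim _ (0 : LinearMap.range (e i))))
  refine ⟨ModuleCat.of B (LinearMap.range (e i)),
    ⟨hCM, isIndecomposable_iff.2 ⟨hnt, hf i⟩⟩, hi', ?_⟩
  let _ : Module (Ser K) M := Module.compHom M (algebraMap (Ser K) A)
  have : IsScalarTower (Ser K) A M := ⟨fun s a w => by rw [Algebra.smul_def, mul_smul]; rfl⟩
  have : IsScalarTower (Ser K) B M := ⟨fun s b w => by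
    rw [Algebra.smul_def, mul_smul]
    change algebraMap B A (algebraMap (Ser K) B s) • (b • w) = algebraMap (Ser K) A s • (b • w)
    rw [IsScalarTower.algebraMap_apply (Ser K) B A]⟩
  have := (hA.isCohenMacaulay_iff.1 hM).1
  rw [← hA.finrank_eq hM.1]
  exact (hB.finrank_le hCM).trans (finrank_le_of_isSummand (hsum.restrictScalars (Ser K)))

end Coind

end

end SurfaceCM

namespace SurfaceCM

open Ser

/-! ### Families of modules and matrix families -/

theorem MatrixFamily.finrank_mod {K A : Type u} [Field K] [CommRing A] [Algebra (Ser K) A] {d : ℕ}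
    (ρ : MatrixFamily K A K d) : Module.finrank (Ser K) ρ.Mod = d := by
  change Module.finrank (Ser K) (Fin d → Ser K) = d
  rw [Module.finrank_fin_fun]

section

variable {K A : Type u} [Field K] [IsAlgClosed K] [CommRing A] [IsLocalRing A] [Algebra K A]
  [Algebra (Ser K) A]

/-- Almost all members of a family of rank `r` are members of a matrix family, at points which avoid
any given finite set. -/
theorem IsFiniteOverSer.exists_matrixFamily_of_cmFamily (hA : IsFiniteOverSer K A)
    (F : CMFamily K A) {r : ℕ} (hF : F.HasRank r) :
    ∃ (C : SmoothCurve K) (ρ : MatrixFamily K A C.R (Module.finrank (Ser K) A * r)),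
      ∀ p : (C.R →ₐ[K] K) → Prop, {c | ¬ p c}.Finite →
        {m : MaximalSpectrum F.R | ¬ ∃ c : C.R →ₐ[K] K, p c ∧
          Nonempty (F.fiber m ≃ₗ[A] (ρ.map c).Mod)}.Finite := by
  have := F.smooth
  have := F.finite
  let C : SmoothCurve K := ⟨F.R, F.smooth, F.isDomain, F.ringKrullDim_eq⟩
  have hq : Module.Finite C.R (ProductSections (R := C.R) F.M ⧸
    varsMultiples K A C.R (ProductSections (R := C.R) F.M)) := finite_quotient_productSections hA F.M
  have hfib : ∀ c : C.R →ₐ[K] K, IsFiber A (ProductSections (R := C.R) F.M) c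
    (F.fiber (pointOfHom c)) := fun c => isFiber_fiberModule F.M c
  have hempty : {c : C.R →ₐ[K] K | ¬ ∃ N : ModuleCat.{u} A,
      IsFiber A (ProductSections (R := C.R) F.M) c N ∧ IsCohenMacaulay A N}.Finite := by
    convert Set.finite_empty
    rw [Set.eq_empty_iff_forall_notMem]
    exact fun c hc => hc ⟨_, hfib c, F.isCohenMacaulay _⟩
  obtain ⟨C', φ, d, ρ, hρ⟩ := hA.exists_matrixFamily C (ProductSections (R := C.R) F.M) hempty
  have h1 : ∀ p : (C'.R →ₐ[K] K) → Prop, {c | ¬ p c}.Finite →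
      {c : C.R →ₐ[K] K | ¬ ∃ c' : C'.R →ₐ[K] K, c'.comp φ.hom = c ∧ p c' ∧
        Nonempty (F.fiber (pointOfHom (R := F.R) (c'.comp φ.hom)) ≃ₗ[A] (ρ.map c').Mod)}.Finite := by
    intro p hp
    refine φ.finite_of_finite (P := fun c' => p c' ∧ Nonempty
      (F.fiber (pointOfHom (R := F.R) (c'.comp φ.hom)) ≃ₗ[A] (ρ.map c').Mod))
      ((hp.union hρ).subset ?_)
    intro c' hc'
    by_cases h : p c'
    · exact Or.inr fun h' => hc' ⟨h, (hfib _).nonempty_equiv h'⟩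
    · exact Or.inl h
  -- Comparing ranks over K[[x,y]] at one general point determines the size of the matrices.
  have hd : d = Module.finrank (Ser K) A * r := by
    obtain ⟨c, c', -, -, ⟨g⟩⟩ := C.exists_point_of_finite (h1 (fun _ => True) (by simp))
    rw [← hF (pointOfHom (R := F.R) (c'.comp φ.hom)), g.finrank_eq,
      ← hA.finrank_eq (MatrixFamily.isCohenMacaulay_mod hA).1, MatrixFamily.finrank_mod]
  subst hd
  refine ⟨C', ρ, fun p hp => ((h1 p hp).image fun c => pointOfHom (R := F.R) c).subset ?_⟩
  intro m hm
  have := m.isMaximal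
  obtain ⟨c, hc⟩ := exists_point_of_isMaximal (K := K) m.asIdeal
  refine ⟨c, ?_, MaximalSpectrum.ext hc⟩
  rintro ⟨c', rfl, hp', hg⟩
  refine hm ⟨c', hp', ?_⟩
  rwa [show pointOfHom (R := F.R) (c'.comp φ.hom) = m from MaximalSpectrum.ext hc] at hg

end

section Restriction

variable {K A B : Type u} [Field K] [CommRing A] [Algebra (Ser K) A]
  [CommRing B] [Algebra (Ser K) B] [Algebra B A] [IsScalarTower (Ser K) B A]

variable (B) in
/-- The restriction of a matrix family along a homomorphism of rings. -/
noncomputable def MatrixFamily.restrict {R : Type u} [CommRing R] [Algebra K R] {d : ℕ}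
    (ρ : MatrixFamily K A R d) : MatrixFamily K B R d where
  hom := ρ.hom.comp (algebraMap B A)
  hom_algebraMap s := by
    rw [RingHom.comp_apply, ← IsScalarTower.algebraMap_apply, ρ.hom_algebraMap]

theorem MatrixFamily.nonempty_equiv_restrict {R : Type u} [CommRing R] [Algebra K R] {d : ℕ}
    (ρ : MatrixFamily K A R d) (c : R →ₐ[K] K) {M : ModuleCat.{u} A} (g : M ≃ₗ[A] (ρ.map c).Mod) :
    Nonempty ((ModuleCat.restrictScalars (algebraMap B A)).obj M ≃ₗ[B] ((ρ.restrict B).map c).Mod) :=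
  ⟨{ g with map_smul' := fun b m => g.map_smul (algebraMap B A b) m }⟩

end Restriction

section Coind

theorem exists_linearMap_of_relations {B A N : Type*} [CommRing B] [AddCommGroup A] [Module B A]
    [AddCommGroup N] [Module B N] {n m : ℕ} {π : (Fin n → B) →ₗ[B] A} (hπ : Function.Surjective π)
    {β : Fin m → Fin n → B} (hβ : Submodule.span B (Set.range β) = LinearMap.ker π) (Z : Fin n → N)
    (hZ : ∀ k, ∑ i, β k i • Z i = 0) : ∃ g : A →ₗ[B] N, ∀ v, g (π v) = ∑ i, v i • Z i := by
  have h1 : LinearMap.ker π ≤ LinearMap.ker (Fintype.linearCombination B Z) := by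
    rw [← hβ, Submodule.span_le]
    rintro _ ⟨k, rfl⟩
    rw [SetLike.mem_coe, LinearMap.mem_ker, Fintype.linearCombination_apply, hZ]
  refine ⟨(LinearMap.ker π).liftQ _ h1 ∘ₗ (π.quotKerEquivOfSurjective hπ).symm, fun v => ?_⟩
  have h2 : (π.quotKerEquivOfSurjective hπ).symm (π v) = Submodule.Quotient.mk v := by
    rw [LinearEquiv.symm_apply_eq]; rfl
  rw [LinearMap.comp_apply, LinearEquiv.coe_coe, h2, Submodule.liftQ_apply,
    Fintype.linearCombination_apply]

namespace Coind

variable {B A N R : Type u} [CommRing B] [CommRing A] [Algebra B A] [AddCommGroup N] [Module B N]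
  [CommRing R] [Module R N] [SMulCommClass B R N]

noncomputable instance moduleBase : Module R (Coind B A N) :=
  inferInstanceAs (Module R (A →ₗ[B] N))

theorem hom_smul_right (r : R) (f : Coind B A N) (a : A) : (r • f).hom a = r • f.hom a := rfl

instance : SMulCommClass A R (Coind B A N) := ⟨fun _ _ _ => rfl⟩

end Coind

end Coind

end SurfaceCM

namespace SurfaceCM

open Ser

/-! ### Coinduction of matrix families -/

namespace MatrixFamily

section

variable {K B R : Type u} [Field K] [CommRing B] [Algebra (Ser K) B] [CommRing R] [Algebra K R]
  {d : ℕ} {ρ : MatrixFamily K B R d}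

theorem Range.val_mk_one (v : Fin d → Ser R) : Range.val (1 : ρ.centralizer) (Range.mk 1 v) = v :=
  Matrix.one_mulVec v

instance (e : ρ.centralizer) : SMulCommClass B (Ser R) (ρ.Range e) :=
  ⟨fun b s v => Range.val_injective e (by
    rw [Range.val_smul, map_smul, map_smul, Range.val_smul, Matrix.mulVec_smul])⟩

variable (ρ) in
/-- The specialization of the sections of a family at a point. -/
noncomputable def specializeSections (c : R →ₐ[K] K) : ρ.Range 1 →ₗ[B] (ρ.map c).Mod where
  toFun v := specialize (c : R →+* K) (Range.val 1 v)
  map_add' v w := (congrArg _ (map_add (Range.val 1) v w)).trans (specialize_add _ _ _)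
  map_smul' b v := (congrArg (specialize (c : R →+* K)) (Range.val_smul 1 b v)).trans
    (specialize_mulVec (c : R →+* K) _ _)

theorem specializeSections_apply (c : R →ₐ[K] K) (v : ρ.Range 1) :
    ρ.specializeSections c v = specialize (c : R →+* K) (Range.val 1 v) := rfl

end

section Coind

variable {K A B R : Type u} [Field K] [CommRing A] [Algebra (Ser K) A]
  [CommRing B] [Algebra (Ser K) B] [Algebra B A] [IsScalarTower (Ser K) B A]
  [CommRing R] [Algebra K R] {d : ℕ} (ρ : MatrixFamily K B R d)

instance [Module.Finite B A] [IsNoetherianRing R] : Module.Finite (Ser R) (Coind B A (ρ.Range 1)) := by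
  obtain ⟨n, g, hg⟩ := Module.Finite.exists_fin (R := B) (M := A)
  let φ : Coind B A (ρ.Range 1) →ₗ[Ser R] (Fin n → ρ.Range 1) :=
    { toFun := fun f i => f.hom (g i)
      map_add' := fun _ _ => rfl
      map_smul' := fun _ _ => rfl }
  refine Module.Finite.of_injective φ fun f f' hff => ?_
  exact LinearMap.ext_on_range hg fun i => congrFun hff i

theorem coind_algebraMap_smul (s : Ser K) (f : Coind B A (ρ.Range 1)) :
    algebraMap (Ser K) A s • f = MvPowerSeries.map (algebraMap K R) s • f := by
  ext a
  rw [Coind.hom_smul, Coind.hom_smul_right, ← Range.algebraMap_smul,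
    IsScalarTower.algebraMap_apply (Ser K) B A, ← Algebra.smul_def, map_smul]

variable [Module.Finite B A]

instance finite_quotient_coind [IsNoetherianRing R] : Module.Finite R
    (Coind B A (ρ.Range 1) ⧸ varsMultiples K A R (Coind B A (ρ.Range 1))) :=
  finite_quotient_varsMultiples
    (fun h => by rw [coind_algebraMap_smul, MvPowerSeries.map_X])
    (fun h => by rw [coind_algebraMap_smul, MvPowerSeries.map_X])
    (fun r h => by
      ext a
      refine Range.val_injective 1 ?_
      rw [Coind.hom_smul_right, Coind.hom_smul_right, map_smul, Range.val_smul_base, smul_eq_C_smul])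

end Coind

section Fiber

variable {K A B R : Type u} [Field K] [CommRing A] [Algebra K A] [CommRing B] [Algebra (Ser K) B]
  [Algebra B A] [Algebra K B] [IsScalarTower K B A] [IsScalarTower K (Ser K) B]
  [Module.Finite B A] [CommRing R] [Algebra K R] {d : ℕ} (ρ : MatrixFamily K B R d)

/-- The coinduction of a family of modules specializes to the coinduction of its members at almost
all points. -/
theorem exists_isFiber_coind [IsNoetherianRing B] [IsNoetherianRing R] [IsDomain R]
    (hR : IsLocallyPrincipal K R) :
    ∃ f : R, f ≠ 0 ∧ ∀ c : R →ₐ[K] K, c f ≠ 0 →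
      IsFiber A (Coind B A (ρ.Range 1)) c (Coind B A (ρ.map c).Mod) := by
  obtain ⟨n, π, hπ⟩ := Module.Finite.exists_fin' B A
  obtain ⟨m, β, hβ⟩ := Submodule.fg_iff_exists_fin_generating_family.1
    (IsNoetherian.noetherian (LinearMap.ker π))
  have hβ0 : ∀ k, π (β k) = 0 := fun k => by
    rw [← LinearMap.mem_ker, ← hβ]; exact Submodule.subset_span ⟨k, rfl⟩
  have hsum : ∀ {N : Type u} [AddCommGroup N] [Module B N] (g : A →ₗ[B] N) (v : Fin n → B),
      g (π v) = ∑ i, v i • g (π (Pi.single i 1)) := by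
    intro N _ _ g v
    conv_lhs => rw [← Finset.univ_sum_single v]
    rw [map_sum, map_sum]
    refine Finset.sum_congr rfl fun i _ => ?_
    rw [← map_smul, ← map_smul, ← Pi.single_smul, smul_eq_mul, mul_one]
  have hext : ∀ {N : Type u} [AddCommGroup N] [Module B N] (g g' : Coind B A N),
      (∀ i, g.hom (π (Pi.single i 1)) = g'.hom (π (Pi.single i 1))) → g = g' := by
    intro N _ _ g g' h
    ext a
    obtain ⟨v, rfl⟩ := hπ a
    rw [hsum g.hom, hsum g'.hom]
    simp_rw [h]
  -- A B-linear map from A is a tuple of n values on generators subject to the relations β. So the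
  -- coinduced module of a family is the kernel of the matrix Λ, and that of a member is the kernel
  -- of its specialization.
  let Λ : Matrix (Fin m × Fin d) (Fin n × Fin d) (Ser R) :=
    Matrix.of fun k i => ρ.hom (β k.1 i.1) k.2 i.2
  let L := Matrix.mulVecLin Λ
  have hL : ∀ (Z : Fin n × Fin d → Ser R) k,
      L Z k = (∑ i, (ρ.hom (β k.1 i)).mulVec fun j => Z (i, j)) k.2 := by
    intro Z k
    rw [Finset.sum_apply]
    change ∑ i, Λ k i * Z i = _
    rw [Fintype.sum_prod_type]
    rfl
  have hLval : ∀ (Z : Fin n × Fin d → Ser R) k, L Z k =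
      Range.val 1 (∑ i, β k.1 i • (Range.mk 1 fun j => Z (i, j) : ρ.Range 1)) k.2 := by
    intro Z k
    rw [hL, map_sum]
    refine congrFun (Finset.sum_congr rfl fun i _ => ?_) k.2
    rw [Range.val_smul, Range.val_mk_one]
  have hval : ∀ (Z : Fin n × Fin d → Ser R), L Z = 0 ↔
      ∀ k, ∑ i, β k i • (Range.mk 1 fun j => Z (i, j) : ρ.Range 1) = 0 := by
    intro Z
    constructor
    · intro h k
      apply Range.val_injective
      rw [map_zero]
      funext j
      rw [← hLval Z (k, j), h]; rfl
    · intro h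
      funext k
      rw [hLval, h, map_zero]; rfl
  let coords : Coind B A (ρ.Range 1) → Fin n × Fin d → Ser R := fun g i =>
    Range.val 1 (g.hom (π (Pi.single i.1 1))) i.2
  have hmk : ∀ (g : Coind B A (ρ.Range 1)) i,
      (Range.mk 1 fun j => coords g (i, j) : ρ.Range 1) = g.hom (π (Pi.single i 1)) :=
    fun g i => Range.val_injective 1 (Range.val_mk_one _)
  have hcoords : ∀ g, L (coords g) = 0 := by
    intro g
    rw [hval]
    intro k
    simp_rw [hmk]
    rw [← hsum g.hom, hβ0, map_zero]
  have hinj : ∀ g g', coords g = coords g' → g = g' := by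
    intro g g' h
    refine hext g g' fun i => ?_
    rw [← hmk, h, hmk]
  have hex : ∀ Z, L Z = 0 → ∃ g, coords g = Z := by
    intro Z hZ
    obtain ⟨g, hg⟩ := exists_linearMap_of_relations hπ hβ _ ((hval Z).1 hZ)
    refine ⟨Coind.of g, funext fun i => ?_⟩
    change Range.val 1 (g (π (Pi.single i.1 1))) i.2 = _
    rw [hg, Finset.sum_eq_single i.1 (fun j _ hj => by rw [Pi.single_eq_of_ne hj, zero_smul])
      (by simp), Pi.single_eq_same, one_smul, Range.val_mk_one]
  obtain ⟨f, hf, hfL⟩ := exists_forall_specialize_kernel L hR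
  refine ⟨f, hf, fun c hc => ⟨Coind.map (ρ.specializeSections c), ?_, ?_, ?_⟩⟩
  · intro g
    choose lift hlift using Ser.map_surjective (c := (c : R →+* K)) fun k => ⟨algebraMap K R k, by simp⟩
    let Z : Fin n × Fin d → Ser R := fun i => lift ((g.hom (π (Pi.single i.1 1)) : Fin d → Ser K) i.2)
    have hZ : ∀ i, specialize (c : R →+* K) (fun j => Z (i, j)) = g.hom (π (Pi.single i 1)) :=
      fun i => funext fun j => hlift _
    have hLZ : specialize (c : R →+* K) (L Z) = 0 := by
      funext k
      have h1 : ρ.specializeSections c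
          (∑ i, β k.1 i • (Range.mk 1 fun j => Z (i, j) : ρ.Range 1)) = 0 := by
        rw [map_sum]
        refine Eq.trans (Finset.sum_congr rfl fun i _ => ?_) ((hsum g.hom (β k.1)).symm.trans
          (by rw [hβ0, map_zero]))
        rw [map_smul, specializeSections_apply, Range.val_mk_one, hZ]
      rw [specialize, hLval]
      exact congrFun h1 k.2
    -- Solutions of the specialized relations lift to solutions over the curve away from the zeros
    -- of f; this gives surjectivity onto the fibre.
    obtain ⟨Z', hLZ', hZ'⟩ := hfL c hc Z hLZ
    obtain ⟨g', rfl⟩ := hex Z' hLZ'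
    refine ⟨g', hext _ _ fun i => ?_⟩
    rw [Coind.hom_map, specializeSections_apply, ← hZ]
    funext j
    exact congrFun hZ' (i, j)
  · intro r g
    ext a
    change specialize (c : R →+* K) (Range.val 1 (r • g.hom a)) =
      specialize (c : R →+* K) (Range.val 1 (g.hom (algebraMap K A (c r) * a)))
    rw [Range.val_smul_base, specialize_smul', IsScalarTower.algebraMap_apply K B A,
      ← Algebra.smul_def, map_smul, ← specializeSections_apply c (_ • _), map_smul,
      IsScalarTower.algebraMap_apply K (Ser K) B, algebraMap_smul_mod, specializeSections_apply]
    funext i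
    exact MvPowerSeries.smul_eq_C_mul _ _
  · intro g hg
    have h1 : specialize (c : R →+* K) (coords g) = 0 := funext fun i =>
      congrFun (congrArg (fun g : Coind B A (ρ.map c).Mod => g.hom (π (Pi.single i.1 1))) hg) i.2
    obtain ⟨a, b, W, ha, hb, hW, h2⟩ := exists_eq_add_of_specialize_eq_zero L hR c (hcoords g) h1
    obtain ⟨w, rfl⟩ := hex W hW
    have h3 : g = a • w + b • g := hinj _ _ h2
    rw [h3]
    exact add_mem (Submodule.smul_mem_smul ha Submodule.mem_top)
      (Submodule.smul_mem_smul hb Submodule.mem_top)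

end Fiber

end MatrixFamily

section

variable {K A B : Type u} [Field K] [IsAlgClosed K] [CommRing A] [IsLocalRing A] [Algebra K A]
  [Algebra (Ser K) A] [CommRing B] [IsLocalRing B] [Algebra K B] [Algebra (Ser K) B] [Algebra B A]
  [IsScalarTower (Ser K) B A] [IsScalarTower K B A] [Module.Finite B A]

/-- The coinductions of almost all members of a matrix family form a matrix family. -/
theorem IsFiniteOverSer.exists_matrixFamily_coind (hA : IsFiniteOverSer K A)
    (hB : IsFiniteOverSer K B) (C : SmoothCurve K) {d : ℕ} (ρ : MatrixFamily K B C.R d) :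
    ∃ (C' : SmoothCurve K) (d' : ℕ) (ρ' : MatrixFamily K A C'.R d'),
      {c : C.R →ₐ[K] K | ¬ ∃ c' : C'.R →ₐ[K] K,
        Nonempty (Coind B A (ρ.map c).Mod ≃ₗ[A] (ρ'.map c').Mod)}.Finite := by
  have := hB.tower
  have := hB.sing.isNoetherianRing
  have : IsNoetherianRing C.R := Algebra.FiniteType.isNoetherianRing K C.R
  obtain ⟨f, hf, hfib⟩ := ρ.exists_isFiber_coind (A := A)
    (isLocallyPrincipal_of_smooth K C.R C.ringKrullDim_eq)
  have hfin := C.finite_zeros hf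
  obtain ⟨C', φ, d', ρ', hρ'⟩ := hA.exists_matrixFamily C (Coind B A (ρ.Range 1)) (by
    refine hfin.subset fun c hc h => hc ⟨ModuleCat.of A (Coind B A (ρ.map c).Mod), hfib c h, ?_⟩
    exact hA.isCohenMacaulay_coind hB (MatrixFamily.isCohenMacaulay_mod hB))
  refine ⟨C', d', ρ', (hfin.union (φ.finite_of_finite hρ')).subset fun c hc => ?_⟩
  by_contra h
  rw [Set.mem_union, not_or] at h
  have h1 := not_not.1 h.1
  obtain ⟨c', rfl, h2⟩ := not_not.1 h.2
  exact hc ⟨c', (hfib _ h1).nonempty_equiv h2⟩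

end

end SurfaceCM

namespace SurfaceCM

open Ser

/-! ### Transfer of parametrizing sets -/

section

variable {K P : Type u} [Field K] [CommRing P] [IsLocalRing P] [Algebra K P]

theorem CMFamily.HasRank.eq {F : CMFamily K P} {r s : ℕ} (hr : F.HasRank r) (hs : F.HasRank s) :
    r = s := by
  have := F.isDomain
  obtain ⟨m, hm⟩ := Ideal.exists_maximal F.R
  exact (hr ⟨m, hm⟩).symm.trans (hs ⟨m, hm⟩)

/-- There is a parametrizing set which is minimal in every rank. -/
theorem exists_minimal_parametrizingSet (h : ∃ D : Set (CMFamily K P), IsParametrizingSet D) :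
    ∃ D : Set (CMFamily K P), IsParametrizingSet D ∧
      ∀ r, (ofRank D r).ncard = familyNumber K P r := by
  obtain ⟨D₀, hD₀⟩ := h
  choose D hD hDr using fun r => Nat.sInf_mem
    (s := {d | ∃ D : Set (CMFamily K P), IsParametrizingSet D ∧ (ofRank D r).ncard = d})
    ⟨_, D₀, hD₀, rfl⟩
  -- The part of rank r is taken from a set that is minimal in rank r. These parts do not interfere,
  -- since the rank of a family is unique: its base has a closed point.
  have h1 : ∀ r, ofRank (⋃ s, ofRank (D s) s) r = ofRank (D r) r := by
    intro r
    ext F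
    constructor
    · rintro ⟨hF, hr⟩
      obtain ⟨s, hF, hs⟩ := Set.mem_iUnion.1 hF
      obtain rfl := hs.eq hr
      exact ⟨hF, hr⟩
    · exact fun hF => ⟨Set.mem_iUnion.2 ⟨r, hF⟩, hF.2⟩
  refine ⟨⋃ r, ofRank (D r) r, fun r => ?_, fun r => ?_⟩
  · rw [h1]
    exact hD r r
  · rw [h1, hDr]
    rfl

end

variable {K P Q : Type u} [Field K] [CommRing P] [IsLocalRing P] [Algebra K P]
  [CommRing Q] [IsLocalRing Q] [Algebra K Q] [Algebra (Ser K) Q]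

variable (K) in
/-- An operation on modules which transfers the classification of Cohen-Macaulay modules from one
singularity to another one. -/
structure IsTransfer (Φ : ModuleCat.{u} P → ModuleCat.{u} Q) : Prop where
  congr : ∀ {M M' : ModuleCat.{u} P}, Nonempty (M ≃ₗ[P] M') → Nonempty (Φ M ≃ₗ[Q] Φ M')
  isCohenMacaulay : ∀ {M : ModuleCat.{u} P}, IsCohenMacaulay P M → IsCohenMacaulay Q (Φ M)
  exists_isSummand : ∃ C : ℕ, ∀ N : ModuleCat.{u} Q, IsIndecomposableCM Q N →
    ∃ M : ModuleCat.{u} P, IsIndecomposableCM P M ∧ IsSummand Q N (Φ M) ∧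
      Module.finrank P M ≤ C * Module.finrank Q N
  exists_matrixFamily : ∃ C : ℕ, ∀ (F : CMFamily K P) (r : ℕ), F.HasRank r →
    ∃ (C₁ : SmoothCurve K) (d : ℕ) (ρ : MatrixFamily K Q C₁.R d), d ≤ C * r ∧
      {m : MaximalSpectrum F.R | ¬ ∃ c : C₁.R →ₐ[K] K,
        Nonempty (Φ (F.fiber m) ≃ₗ[Q] (ρ.map c).Mod)}.Finite

variable {Φ : ModuleCat.{u} P → ModuleCat.{u} Q}

namespace IsTransfer

variable [IsAlgClosed K]

theorem finitelyMany_summands (h : IsTransfer K Φ) (hQ : IsFiniteOverSer K Q)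
    {S : Set (ModuleCat.{u} P)} (hS : S.Finite) :
    FinitelyManyIsoClasses fun N : ModuleCat.{u} Q => IsIndecomposableCM Q N ∧
      ∃ M : ModuleCat.{u} P, IsCohenMacaulay P M ∧ IsSummand Q N (Φ M) ∧
        ∃ M' ∈ S, Nonempty (M ≃ₗ[P] M') := by
  refine (FinitelyManyIsoClasses.biUnion (s := {M' ∈ S | IsCohenMacaulay Q (Φ M')})
    (P := fun M' N => IsIndecomposableCM Q N ∧ IsSummand Q N (Φ M'))
    (hS.subset fun M hM => hM.1) fun M' hM' => hQ.finitelyMany_summands hM'.2).mono ?_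
  rintro N ⟨hN, M, hM, hNM, M', hM', hMM'⟩
  obtain ⟨g⟩ := h.congr hMM'
  exact ⟨M', ⟨hM', hQ.isCohenMacaulay_congr (h.isCohenMacaulay hM) g.symm⟩, hN,
    hNM.trans (IsSummand.of_equiv g)⟩

theorem isCMFinite (h : IsTransfer K Φ) (hQ : IsFiniteOverSer K Q) (hP : IsCMFinite P) :
    IsCMFinite Q := by
  obtain ⟨S, hS, hPS⟩ := hP
  obtain ⟨C, hC⟩ := h.exists_isSummand
  refine (h.finitelyMany_summands hQ hS).mono fun N hN => ?_
  obtain ⟨M, hM, hNM, -⟩ := hC N hN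
  exact ⟨hN, M, hM.1, hNM, hPS M hM⟩

/-- The indecomposable summands of the images of the members of a family belong, with finitely many
exceptions, to a bounded number of families. -/
theorem exists_families (h : IsTransfer K Φ) (hQ : IsFiniteOverSer K Q) :
    ∃ C : ℕ, ∀ (F : CMFamily K P) (r : ℕ), F.HasRank r →
      ∃ T : Set (CMFamily K Q), T.Finite ∧ T.ncard ≤ C * r ∧ (∀ G ∈ T, ∃ s, G.HasRank s) ∧
        FinitelyManyIsoClasses fun N : ModuleCat.{u} Q => IsIndecomposableCM Q N ∧
          (∃ m, IsSummand Q N (Φ (F.fiber m))) ∧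
          ¬ ∃ G ∈ T, ∃ m : MaximalSpectrum G.R, Nonempty (N ≃ₗ[Q] G.fiber m) := by
  obtain ⟨C, hC⟩ := h.exists_matrixFamily
  refine ⟨C, fun F r hF => ?_⟩
  obtain ⟨C₁, d, ρ, hd, hρ⟩ := hC F r hF
  obtain ⟨n, D, δ, τ, hn, hτ⟩ := ρ.exists_indecomposable_families hQ C₁
  choose G p hp using fun i => (τ i).exists_cmFamily hQ (D i)
  refine ⟨Set.range G, Set.finite_range G, ?_, ?_, ?_⟩
  · rw [← Set.image_univ]
    refine (Set.ncard_image_le Set.finite_univ).trans ?_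
    rw [Set.ncard_univ, Nat.card_eq_fintype_card, Fintype.card_fin]
    exact hn.trans hd
  · rintro _ ⟨i, rfl⟩
    -- The rank over Q is the quotient of the ranks over K[[x,y]]. Should the denominator be zero,
    -- division yields 0 by convention, and the inequality of ranks shows that 0 is the right value.
    refine ⟨δ i / Module.finrank (Ser K) Q, fun m => ?_⟩
    obtain ⟨g⟩ := hp i m
    have h1 := hQ.finrank_eq (MatrixFamily.isCohenMacaulay_mod (ρ := (τ i).map (p i m)) hQ).1
    have h2 := hQ.finrank_le (MatrixFamily.isCohenMacaulay_mod (ρ := (τ i).map (p i m)) hQ)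
    rw [MatrixFamily.finrank_mod, g.finrank_eq] at h1 h2
    rcases Nat.eq_zero_or_pos (Module.finrank (Ser K) Q) with h0 | h0
    · rw [h0, zero_mul] at h1
      rw [h0, Nat.div_zero]
      exact Nat.le_zero.1 (h1 ▸ h2)
    · exact (Nat.div_eq_of_eq_mul_right h0 h1).symm
  -- Uncovered modules are summands of Φ of a member outside the matrix family, or of a matrix
  -- member at an exceptional point. There are finitely many such members, each with finitely many
  -- indecomposable summands.
  · refine ((FinitelyManyIsoClasses.biUnion hρ
      (P := fun m N => IsIndecomposableCM Q N ∧ IsSummand Q N (Φ (F.fiber m)))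
      fun m _ => hQ.finitelyMany_summands (h.isCohenMacaulay (F.isCohenMacaulay m))).or
      (FinitelyManyIsoClasses.biUnion hτ
      (P := fun c N => IsIndecomposableCM Q N ∧ IsSummand Q N (ρ.map c).Mod)
      fun c _ => hQ.finitelyMany_summands (MatrixFamily.isCohenMacaulay_mod hQ))).mono ?_
    rintro N ⟨hN, ⟨m, hm⟩, hNG⟩
    by_cases h1 : ∃ c : C₁.R →ₐ[K] K, Nonempty (Φ (F.fiber m) ≃ₗ[Q] (ρ.map c).Mod)
    · obtain ⟨c, ⟨g⟩⟩ := h1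
      have h2 : IsSummand Q N (ρ.map c).Mod := hm.trans (IsSummand.of_equiv g)
      refine Or.inr ⟨c, fun h3 => hNG ?_, hN, h2⟩
      obtain ⟨i, c', ⟨g'⟩⟩ := h3 N hN h2
      obtain ⟨g''⟩ := hp i ((p i).symm c')
      rw [Equiv.apply_symm_apply] at g''
      exact ⟨G i, ⟨i, rfl⟩, _, ⟨g'.trans g''⟩⟩
    · exact Or.inl ⟨m, h1, hN, hm⟩

/-- A parametrizing set is transferred to a parametrizing set of comparable size. -/
theorem exists_isParametrizingSet (h : IsTransfer K Φ) (hQ : IsFiniteOverSer K Q) :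
    ∃ C C' : ℕ, ∀ D : Set (CMFamily K P), IsParametrizingSet D →
      ∃ D' : Set (CMFamily K Q), IsParametrizingSet D' ∧ ∀ r, (ofRank D' r).ncard ≤
        ∑ s ∈ Finset.range (C * r + 1), (ofRank D s).ncard * (C' * s) := by
  obtain ⟨C, hC⟩ := h.exists_isSummand
  obtain ⟨C', hC'⟩ := h.exists_families hQ
  refine ⟨C, C', fun D hD => ?_⟩
  choose! T hT1 hT2 hT3 hT4 using hC'
  -- A module N of rank r is a summand of Φ(M) with rank M ≤ Cr, so only families of these ranks
  -- contribute. Of `U r` only the families of rank exactly r are kept.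
  let U : ℕ → Set (CMFamily K Q) := fun r =>
    ⋃ s ∈ Finset.range (C * r + 1), ⋃ F ∈ ofRank D s, T F s
  have hUfin : ∀ r, (U r).Finite := fun r =>
    (Finset.finite_toSet _).biUnion fun s _ => (hD s).1.biUnion fun F hF => hT1 F s hF.2
  have hU : ∀ r, ofRank (⋃ s, ofRank (U s) s) r = ofRank (U r) r := by
    intro r
    ext F
    constructor
    · rintro ⟨hF, hr⟩
      obtain ⟨s, hF, hs⟩ := Set.mem_iUnion.1 hF
      obtain rfl := hs.eq hr
      exact ⟨hF, hr⟩
    · exact fun hF => ⟨Set.mem_iUnion.2 ⟨r, hF⟩, hF.2⟩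
  refine ⟨⋃ s, ofRank (U s) s, fun r => ?_, fun r => ?_⟩
  · rw [hU]
    refine ⟨(hUfin r).subset fun F hF => hF.1, ?_⟩
    choose S hS hSD using fun s => (hD s).2
    refine ((FinitelyManyIsoClasses.biUnion (Finset.finite_toSet (Finset.range (C * r + 1)))
      fun s _ => h.finitelyMany_summands hQ (hS s)).or
      (FinitelyManyIsoClasses.biUnion (Finset.finite_toSet (Finset.range (C * r + 1)))
      fun s _ => FinitelyManyIsoClasses.biUnion (hD s).1 fun F hF => hT4 F s hF.2)).mono ?_
    rintro N ⟨hN, hr, hNU⟩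
    obtain ⟨M, hM, hNM, hMC⟩ := hC N hN
    have hs : Module.finrank P M ∈ Finset.range (C * r + 1) := by
      rw [Finset.mem_range, ← hr]; lia
    by_cases h1 : ∃ F ∈ ofRank D (Module.finrank P M), ∃ m : MaximalSpectrum F.R,
        Nonempty (M ≃ₗ[P] F.fiber m)
    · obtain ⟨F, hF, m, hm⟩ := h1
      obtain ⟨g⟩ := h.congr (M' := F.fiber m) hm
      refine Or.inr ⟨_, hs, F, hF, hN, ⟨m, hNM.trans (IsSummand.of_equiv g)⟩, fun h2 => hNU ?_⟩
      obtain ⟨G, hG, m', hm'⟩ := h2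
      refine ⟨G, ⟨Set.mem_biUnion hs (Set.mem_biUnion hF hG), ?_⟩, m', hm'⟩
      obtain ⟨t, ht⟩ := hT3 F _ hF.2 G hG
      obtain ⟨g'⟩ := hm'
      have : r = t := by rw [← hr, ← ht m', g'.finrank_eq]
      exact this ▸ ht
    · exact Or.inl ⟨_, hs, hN, M, hM.1, hNM, hSD _ M ⟨hM, rfl, h1⟩⟩
  · rw [hU]
    refine (Set.ncard_le_ncard (fun F hF => hF.1) (hUfin r)).trans ?_
    refine (Finset.set_ncard_biUnion_le _ _).trans (Finset.sum_le_sum fun s _ => ?_)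
    have h1 := Finset.set_ncard_biUnion_le (hD s).1.toFinset fun F => T F s
    simp only [Set.Finite.mem_toFinset] at h1
    refine h1.trans ((Finset.sum_le_card_nsmul _ _ (C' * s) fun F hF =>
      hT2 F s ((hD s).1.mem_toFinset.1 hF).2).trans ?_)
    rw [smul_eq_mul, Set.ncard_eq_toFinset_card _ (hD s).1]

theorem isCMTame_or_isCMFinite (h : IsTransfer K Φ) (hQ : IsFiniteOverSer K Q)
    (hP : IsCMTame K P) : IsCMTame K Q ∨ IsCMFinite Q := by
  by_cases hfin : IsCMFinite Q
  · exact Or.inr hfin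
  · obtain ⟨C, C', hC⟩ := h.exists_isParametrizingSet hQ
    obtain ⟨-, D, hD⟩ := hP
    obtain ⟨D', hD', -⟩ := hC D hD
    exact Or.inl ⟨hfin, D', hD'⟩

theorem isCMBounded_or_isCMFinite (h : IsTransfer K Φ) (hQ : IsFiniteOverSer K Q)
    (hP : IsCMBounded K P) : IsCMBounded K Q ∨ IsCMFinite Q := by
  obtain ⟨htame, φ, hφ⟩ := hP
  refine (h.isCMTame_or_isCMFinite hQ htame).imp_left fun htame' => ⟨htame', ?_⟩
  obtain ⟨C, C', hC⟩ := h.exists_isParametrizingSet hQ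
  obtain ⟨D, hD, hDr⟩ := exists_minimal_parametrizingSet htame.2
  obtain ⟨D', hD', hle⟩ := hC D hD
  -- The polynomial φ need not be monotone; taking absolute values of its coefficients gives a
  -- majorant ψ that is monotone on ℕ.
  obtain ⟨ψ, hψ, hψ'⟩ : ∃ ψ : Polynomial ℝ, (∀ s : ℕ, φ.eval (s : ℝ) ≤ ψ.eval (s : ℝ)) ∧
      ∀ s t : ℕ, s ≤ t → ψ.eval (s : ℝ) ≤ ψ.eval (t : ℝ) := by
    refine ⟨∑ i ∈ Finset.range (φ.natDegree + 1),
      Polynomial.C |φ.coeff i| * Polynomial.X ^ i, fun s => ?_, fun s t hst => ?_⟩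
    · rw [Polynomial.eval_eq_sum_range, Polynomial.eval_finsetSum]
      refine Finset.sum_le_sum fun i _ => ?_
      rw [Polynomial.eval_mul, Polynomial.eval_C, Polynomial.eval_pow, Polynomial.eval_X]
      exact mul_le_mul_of_nonneg_right (le_abs_self _) (by positivity)
    · rw [Polynomial.eval_finsetSum, Polynomial.eval_finsetSum]
      refine Finset.sum_le_sum fun i _ => ?_
      simp only [Polynomial.eval_mul, Polynomial.eval_C, Polynomial.eval_pow, Polynomial.eval_X]
      gcongr
  -- There are Cr + 1 terms, each at most ψ(Cr) · C' · Cr.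
  refine ⟨(Polynomial.C (C : ℝ) * Polynomial.X + 1) * (ψ.comp (Polynomial.C (C : ℝ) * Polynomial.X) *
    (Polynomial.C ((C' * C : ℕ) : ℝ) * Polynomial.X)), fun r => ?_⟩
  have h1 : familyNumber K Q r ≤ (ofRank D' r).ncard := Nat.sInf_le ⟨D', hD', rfl⟩
  have h2 : (familyNumber K Q r : ℝ) ≤
      ∑ s ∈ Finset.range (C * r + 1), ((ofRank D s).ncard : ℝ) * (C' * s) := by
    exact_mod_cast h1.trans (hle r)
  refine h2.trans ?_
  have h3 : ∀ s ∈ Finset.range (C * r + 1), ((ofRank D s).ncard : ℝ) * (C' * s) ≤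
      ψ.eval ((C * r : ℕ) : ℝ) * (C' * (C * r : ℕ)) := by
    intro s hs
    have hs' : s ≤ C * r := by rw [Finset.mem_range] at hs; lia
    have h4 : ((ofRank D s).ncard : ℝ) ≤ ψ.eval ((C * r : ℕ) : ℝ) := by
      rw [hDr]
      exact ((hφ s).trans (hψ s)).trans (hψ' _ _ hs')
    have h5 : (s : ℝ) ≤ (C * r : ℕ) := by exact_mod_cast hs'
    have h6 : (0 : ℝ) ≤ ((ofRank D s).ncard : ℝ) := Nat.cast_nonneg _
    gcongr
    exact h6.trans h4
  refine (Finset.sum_le_card_nsmul _ _ _ h3).trans (le_of_eq ?_)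
  rw [Finset.card_range, nsmul_eq_mul]
  simp only [Polynomial.eval_mul, Polynomial.eval_add, Polynomial.eval_C, Polynomial.eval_X,
    Polynomial.eval_one, Polynomial.eval_comp, Nat.cast_mul, Nat.cast_add, Nat.cast_one]
  ring

end IsTransfer

end SurfaceCM

namespace SurfaceCM

open Ser

/-! ### Split and unramified extensions -/

section

variable {K A B : Type u} [Field K] [IsAlgClosed K] [CommRing A] [IsLocalRing A] [Algebra K A]
  [Algebra (Ser K) A] [CommRing B] [IsLocalRing B] [Algebra K B] [Algebra (Ser K) B] [Algebra B A]
  [IsScalarTower (Ser K) B A] [Module.Finite B A]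

theorem isTransfer_restrictScalars (hA : IsFiniteOverSer K A) (hB : IsFiniteOverSer K B)
    (h : IsSplitExtension B A) :
    IsTransfer K (ModuleCat.restrictScalars.{u} (algebraMap B A)).obj where
  congr {M M'} hMM' := by
    obtain ⟨g⟩ := hMM'
    exact ⟨{ g with map_smul' := fun b m => g.map_smul (algebraMap B A b) m }⟩
  isCohenMacaulay {M} hM := by
    let _ : Module B M := Module.compHom M (algebraMap B A)
    have : IsScalarTower B A M := ⟨fun s a w => by rw [Algebra.smul_def, mul_smul]; rfl⟩
    have h := hA.isCohenMacaulay_restrictScalars (M := M) hB hM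
    exact h
  exists_isSummand := hA.exists_isSummand_restrictScalars hB h
  exists_matrixFamily := by
    refine ⟨Module.finrank (Ser K) A, fun F r hF => ?_⟩
    obtain ⟨C, ρ, hρ⟩ := hA.exists_matrixFamily_of_cmFamily F hF
    refine ⟨C, _, ρ.restrict B, le_rfl, (hρ (fun _ => True) (by simp)).subset fun m hm h => hm ?_⟩
    obtain ⟨c, -, ⟨g⟩⟩ := h
    exact ⟨c, ρ.nonempty_equiv_restrict c g⟩

theorem isTransfer_coind [IsScalarTower K B A] (hA : IsFiniteOverSer K A)
    (hB : IsFiniteOverSer K B) (h : IsUnramifiedInCodimOne B A) :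
    IsTransfer K fun N : ModuleCat.{u} B => ModuleCat.of A (Coind B A N) where
  congr {N N'} hNN' := by
    obtain ⟨g⟩ := hNN'
    exact Coind.nonempty_equiv g
  isCohenMacaulay hN := hA.isCohenMacaulay_coind hB hN
  exists_isSummand := hA.exists_isSummand_coind hB h
  exists_matrixFamily := by
    obtain ⟨n, hn⟩ := IsFiniteOverSer.exists_finrank_coind_le K A B hB
    refine ⟨n * Module.finrank (Ser K) B, fun F r hF => ?_⟩
    obtain ⟨C, ρ, hρ⟩ := hB.exists_matrixFamily_of_cmFamily F hF
    obtain ⟨C', d, ρ', hρ'⟩ := hA.exists_matrixFamily_coind hB C ρ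
    refine ⟨C', d, ρ', ?_, ?_⟩
    -- The size d is constant, so one member that is a coinduced module bounds it.
    · obtain ⟨c, c', ⟨g⟩⟩ := C.exists_point_of_finite hρ'
      let _ : Module (Ser K) (Coind B A (ρ.map c).Mod) :=
        Module.compHom _ (algebraMap (Ser K) A)
      have : IsScalarTower (Ser K) A (Coind B A (ρ.map c).Mod) :=
        ⟨fun s a w => by rw [Algebra.smul_def, mul_smul]; rfl⟩
      have h1 := hn (ρ.map c).Mod (MatrixFamily.isCohenMacaulay_mod hB)
      have h2 := (g.restrictScalars (Ser K)).finrank_eq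
      rw [h2, MatrixFamily.finrank_mod, MatrixFamily.finrank_mod, ← mul_assoc] at h1
      exact h1
    · refine (hρ _ hρ').subset fun m hm h => hm ?_
      obtain ⟨c, ⟨c', ⟨g'⟩⟩, ⟨g⟩⟩ := h
      obtain ⟨g''⟩ := Coind.nonempty_equiv (A := A) g
      exact ⟨c', ⟨g''.trans g'⟩⟩

end

end SurfaceCM

theorem mainTheorem9 {K A B : Type u} [Field K] [IsAlgClosed K]
    [CommRing A] [IsLocalRing A] [Algebra K A]
    [CommRing B] [IsLocalRing B] [Algebra K B]
    (hA : SurfaceCM.IsNormalSurfaceSingularity K A)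
    (hB : SurfaceCM.IsNormalSurfaceSingularity K B)
    [Algebra B A] [IsScalarTower K B A] [Module.Finite B A]
    (hinj : Function.Injective (algebraMap B A)) :
    (SurfaceCM.IsSplitExtension B A →
      (SurfaceCM.IsCMTame K A → SurfaceCM.IsCMTame K B ∨ SurfaceCM.IsCMFinite B) ∧
      (SurfaceCM.IsCMBounded K A → SurfaceCM.IsCMBounded K B ∨ SurfaceCM.IsCMFinite B)) ∧
    (SurfaceCM.IsUnramifiedInCodimOne B A →
      (SurfaceCM.IsCMTame K B → SurfaceCM.IsCMTame K A ∨ SurfaceCM.IsCMFinite A) ∧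
      (SurfaceCM.IsCMBounded K B → SurfaceCM.IsCMBounded K A ∨ SurfaceCM.IsCMFinite A)) ∧
    (SurfaceCM.IsSplitExtension B A → SurfaceCM.IsUnramifiedInCodimOne B A →
      (SurfaceCM.IsCMTame K A ↔ SurfaceCM.IsCMTame K B) ∧
      (SurfaceCM.IsCMBounded K A ↔ SurfaceCM.IsCMBounded K B)) := by
  obtain ⟨_, hB'⟩ := hB.exists_isFiniteOverSer
  let _ : Algebra (SurfaceCM.Ser K) A :=
    ((algebraMap B A).comp (algebraMap (SurfaceCM.Ser K) B)).toAlgebra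
  have : IsScalarTower (SurfaceCM.Ser K) B A := IsScalarTower.of_algebraMap_eq fun _ => rfl
  have hA' := hB'.of_finite hA hinj
  have h1 := fun h : SurfaceCM.IsSplitExtension B A =>
    SurfaceCM.isTransfer_restrictScalars hA' hB' h
  have h2 := fun h : SurfaceCM.IsUnramifiedInCodimOne B A =>
    SurfaceCM.isTransfer_coind hA' hB' h
  refine ⟨fun h => ⟨(h1 h).isCMTame_or_isCMFinite hB', (h1 h).isCMBounded_or_isCMFinite hB'⟩,
    fun h => ⟨(h2 h).isCMTame_or_isCMFinite hA', (h2 h).isCMBounded_or_isCMFinite hA'⟩,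
    fun h h' => ⟨⟨fun hT => ?_, fun hT => ?_⟩, ⟨fun hT => ?_, fun hT => ?_⟩⟩⟩
  -- If B were CM finite, coinduction would make A CM finite, which tameness of A excludes. The
  -- other three cases are analogous.
  · exact ((h1 h).isCMTame_or_isCMFinite hB' hT).resolve_right fun hf =>
      hT.1 ((h2 h').isCMFinite hA' hf)
  · exact ((h2 h').isCMTame_or_isCMFinite hA' hT).resolve_right fun hf =>
      hT.1 ((h1 h).isCMFinite hB' hf)
  · exact ((h1 h).isCMBounded_or_isCMFinite hB' hT).resolve_right fun hf =>
      hT.1.1 ((h2 h').isCMFinite hA' hf)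
  · exact ((h2 h').isCMBounded_or_isCMFinite hA' hT).resolve_right fun hf =>
      hT.1.1 ((h1 h).isCMFinite hB' hf)
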